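/- Let $d\ge 1$ and let $V(z,\omega)$, $z\in\mathbb Z^d$, be i.i.d. random variables with values in $[0,\infty]$ on a probability space $(\Omega,\mathcal F,\mathbb P)$ such that $\mathbb P(V(0)=0)<1$ and $\operatorname{ess\,inf} V(0)=0$; if $d=1$, assume in addition that $\mathbb P(V(0)\in(0,\infty))>0$. Let $P^x$, with expectation $E^x$, be the law of the simple symmetric random walk $(S_n)_{n\ge0}$ on $\mathbb Z^d$ started at $x$, let $\tau_y=\inf\{n\ge0:S_n=y\}$, and let $\|\cdot\|$ be the Euclidean norm. For a potential $W:\mathbb Z^d\times\Omega\to[0,\infty]$ put $$Z_{y}(W)=\mathbb E\,E^0\Big(\mathbf 1_{\{\tau_y<\infty\}}e^{-\sum_{n=0}^{\tau_y-1}W(S_n,\omega)}\Big),\qquad y\in\mathbb Z^d ,$$ and let $Q_y$ be the annealed path measure of $V$, $$Q_y(A)=Z_y(V)^{-1}\,\mathbb E\,E^0\Big(\mathbf 1_{\{\tau_y<\infty\}}\mathbf 1_A\,e^{-\sum_{n=0}^{\tau_y-1}V(S_n,\omega)}\Big).$$ Then for every $\lambda\ge0$ and $h\in\mathbb R^d$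 the annealed Lyapunov exponent $$\beta_{\lambda+V}(h)=-\lim_{r\to\infty}\frac1r\log Z_{[rh]}(\lambda+V)$$ exists as a finite limit ($[\cdot]$ is the coordinatewise integer part). There is a constant $C\in(0,\infty)$ such that $$\limsup_{\|y\|\to\infty}\frac{E_{Q_y}(\tau_y)}{\|y\|}\le C ,$$ and for every such constant $C$ and every unit vector $s\in\mathbb R^d$ the right derivative of $\lambda\mapsto\beta_{\lambda+V}(s)$ at $\lambda=0$ exists, is finite, and satisfies $$\frac{d\beta_{\lambda+V}(s)}{d\lambda}\Big|_{\lambda=0+}\le C .$$ -/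

import Mathlib

open MeasureTheory ProbabilityTheory Filter Topology
open scoped ENNReal

noncomputable section

namespace AnnealedWalk

variable {d : ℕ}

/-- The nearest-neighbour step encoded by `(i, b)`: `e_i` if `b` is true, `-e_i` otherwise. -/
def unitStep (p : Fin d × Bool) : Fin d → ℤ :=
  if p.2 then Pi.single p.1 1 else -Pi.single p.1 1

/-- The path started at `x` with the given sequence of steps. -/
def walkPath (x : Fin d → ℤ) (ξ : ℕ → Fin d × Bool) (n : ℕ) : Fin d → ℤ :=
  x + ∑ k ∈ Finset.range n, unitStep (ξ k)

/-- The law `P^x`, on path space, of simple symmetric random walk on `ℤ^d` started at `x`: the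
steps are independent and uniform on the `2d` unit vectors `± e_i`. -/
def srw [NeZero d] (x : Fin d → ℤ) : Measure (ℕ → Fin d → ℤ) :=
  (Measure.infinitePi fun _ : ℕ => (PMF.uniformOfFintype (Fin d × Bool)).toMeasure).map
    (walkPath x)

/-- The hitting time `τ_y = inf {n ≥ 0 : S_n = y}`, equal to `⊤` if `y` is never hit. -/
def hitTime (y : Fin d → ℤ) (S : ℕ → Fin d → ℤ) : ℕ∞ :=
  ⨅ (n : ℕ) (_ : S n = y), (n : ℕ∞)

open Classical in
/-- `1_{τ_y < ∞} exp (-∑_{n < τ_y} v (S_n))` for a fixed potential `v`, where `exp (-∞) = 0`. -/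
def pathWeight (v : (Fin d → ℤ) → ℝ≥0∞) (y : Fin d → ℤ) (S : ℕ → Fin d → ℤ) : ℝ≥0∞ :=
  if hitTime y S < ⊤ then
    EReal.exp (-((∑ n ∈ Finset.range (hitTime y S).toNat, v (S n) : ℝ≥0∞) : EReal))
  else 0

variable [NeZero d] {Ω : Type*} [MeasurableSpace Ω]

/-- The quenched partition function `Z^{ω,x}_y` of a fixed potential `v = V(·, ω)`. -/
def quenchedZ (v : (Fin d → ℤ) → ℝ≥0∞) (x y : Fin d → ℤ) : ℝ≥0∞ :=
  ∫⁻ S, pathWeight v y S ∂(srw x)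

/-- The annealed partition function `Z^x_y = 𝔼 Z^{ω,x}_y`. -/
def annealedZ (μ : Measure Ω) (V : (Fin d → ℤ) → Ω → ℝ≥0∞) (x y : Fin d → ℤ) : ℝ≥0∞ :=
  ∫⁻ ω, quenchedZ (fun z => V z ω) x y ∂μ

/-- The annealed path measure
`Q^x_y (A) = (Z^x_y)⁻¹ 𝔼 E^x (1_{τ_y < ∞} 1_A exp (-∑_{n < τ_y} V (S_n, ω)))`. -/
def annealedQ (μ : Measure Ω) (V : (Fin d → ℤ) → Ω → ℝ≥0∞) (x y : Fin d → ℤ) :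
    Measure (ℕ → Fin d → ℤ) :=
  (annealedZ μ V x y)⁻¹ •
    ((μ.prod (srw x)).withDensity fun p => pathWeight (fun z => V z p.1) y p.2).map Prod.snd

/-- The expected crossing time `E_{Q^0_y} (τ_y)`. -/
def meanCrossingTime (μ : Measure Ω) (V : (Fin d → ℤ) → Ω → ℝ≥0∞) (y : Fin d → ℤ) : ℝ≥0∞ :=
  ∫⁻ S, (hitTime y S : ℝ≥0∞) ∂(annealedQ μ V 0 y)

/-- The Euclidean norm of a lattice point. -/
def latticeNorm {d : ℕ} (y : Fin d → ℤ) : ℝ :=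
  ‖(WithLp.toLp 2 fun i => (y i : ℝ) : EuclideanSpace ℝ (Fin d))‖

/-- `limsup_{‖y‖ → ∞} E_{Q^0_y} (τ_y) / ‖y‖`, as an element of `[0, ∞]`. -/
def limsupCrossingTime (μ : Measure Ω) (V : (Fin d → ℤ) → Ω → ℝ≥0∞) : ℝ≥0∞ :=
  limsup (fun y : Fin d → ℤ => meanCrossingTime μ V y / ENNReal.ofReal (latticeNorm y))
    (comap latticeNorm atTop)

/-- The coordinatewise integer part `[h]` of a vector `h`. -/
def intPart {d : ℕ} (h : EuclideanSpace ℝ (Fin d)) : Fin d → ℤ := fun i => ⌊h i⌋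

/-- `-(1/r) log Z^0_{[r h]}`. -/
def decayRate (μ : Measure Ω) (V : (Fin d → ℤ) → Ω → ℝ≥0∞) (h : EuclideanSpace ℝ (Fin d))
    (r : ℝ) : ℝ :=
  -(1 / r) * Real.log (annealedZ μ V 0 (intPart (r • h))).toReal

/-- The annealed Lyapunov exponent `β_V (h) = -lim_{r → ∞} (1/r) log Z^0_{[r h]}`. -/
def lyapunov (μ : Measure Ω) (V : (Fin d → ℤ) → Ω → ℝ≥0∞) (h : EuclideanSpace ℝ (Fin d)) : ℝ :=
  limUnder atTop (decayRate μ V h)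

/-- The potential `t + V`, used for `t ≥ 0`. -/
def shiftPotential {d : ℕ} {Ω : Type*} (t : ℝ) (V : (Fin d → ℤ) → Ω → ℝ≥0∞) :
    (Fin d → ℤ) → Ω → ℝ≥0∞ :=
  fun z ω => ENNReal.ofReal t + V z ω

end AnnealedWalk

end

noncomputable section

namespace AnnealedWalk

variable {d : ℕ}

/-! ### The killed random walk operator and its Green function -/

/-! Let a_n be the annealed weight of the paths from 0 that first hit y at time n (`crossMass`).
Adding a constant t to V multiplies a_n by exp(-tn), so Z_y(t+V) is the Laplace transform of (a_n).
Convexity of its logarithm gives concavity of the Lyapunov exponent along chords starting at t = 0.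
Jensen's inequality gives log Z_y(V) - log Z_y(t+V) ≤ t E_{Q_y}(τ_y). Along y = [rs] these pass to
the limit: the slopes of the exponent from 0 increase as t decreases to 0 and stay below C, so the
right derivative exists and is at most C. The exponents themselves are limits by Fekete's lemma:
Green functions are series of monomials in exp(-V(z)) with nonnegative coefficients, hence
positively correlated, and concatenating paths makes Z supermultiplicative.

The substance is the bound E_{Q_y}(τ_y) = O(‖y‖), which goes through the number R of sites visited
before τ_y. Put φ = 𝔼 exp(-V(0)) < 1. A path with R visited sites has averaged weight at most φ^R,
so φ^{-R} has integral at most 1 against the annealed path weight. Linearizing the exponential gives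
(-log φ) E_Q(R) ≤ 1 - log Z_y (`tsum_visitMass_le`), and a direct path to y shows -log Z_y = O(‖y‖).

To compare time with range (`tsum_crossMass_mul_le`), fix z and let k be the radius of the smallest
box around z with a site where V ≥ v₀. Such an obstacle bounds the Green functions with pole in the
box by Γ_k. The weight of the visits to z is then at most Γ_k² times a sum over entrance sites a and
last exit sites b of a quantity depending only on V outside the box. By independence, the obstacle
event costs at most q^((2k-1)^d) with q = ℙ(V(0) < v₀), and inserting a crossing from a to b inside
the box costs a factor 1/θ_k; the resulting path visits a. Summing over z and k bounds the expected
time by the expected range, provided the series in k converges.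

For d ≥ 2, q^((2k-1)^d) beats crude exponential bounds on Γ_k and 1/θ_k. For d = 1 all rates are
exponential in k. There Γ_k is only linear in k, and one needs θ_k ≥ c ρ^(2k) with ρ > q. A renewal
argument at the first site with 0 < V ≤ M supplies this: crossing g free sites has probability
1/(g+1), and divergence of the harmonic series pushes the growth rate of the crossing weight
strictly above ℙ(V(0) = 0). Then v₀ is chosen so small that q < ρ. -/

/-- `exp (-a)` for `a ∈ [0, ∞]`. -/
def expNeg (a : ℝ≥0∞) : ℝ≥0∞ := EReal.exp (-(a : EReal))

lemma expNeg_zero : expNeg 0 = 1 := by simp [expNeg]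

lemma expNeg_top : expNeg ⊤ = 0 := by simp [expNeg]

lemma expNeg_add (a b : ℝ≥0∞) : expNeg (a + b) = expNeg a * expNeg b := by
  unfold expNeg
  rw [← EReal.exp_add, EReal.coe_ennreal_add, EReal.neg_add, sub_eq_add_neg] <;> simp

lemma expNeg_antitone : Antitone expNeg := by
  intro a b h
  exact EReal.exp_monotone (EReal.neg_le_neg_iff.2 (by exact_mod_cast h))

lemma expNeg_le_one (a : ℝ≥0∞) : expNeg a ≤ 1 := by
  rw [← expNeg_zero]; exact expNeg_antitone (zero_le)

lemma expNeg_ne_top (a : ℝ≥0∞) : expNeg a ≠ ⊤ :=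
  ne_top_of_le_ne_top ENNReal.one_ne_top (expNeg_le_one a)

lemma expNeg_lt_one {a : ℝ≥0∞} (h : a ≠ 0) : expNeg a < 1 := by
  simp only [expNeg, EReal.exp_lt_one_iff]
  rw [EReal.neg_lt_comm, neg_zero]
  exact_mod_cast pos_iff_ne_zero.2 h

lemma expNeg_pos {a : ℝ≥0∞} (h : a ≠ ⊤) : 0 < expNeg a := by
  simp only [expNeg, EReal.zero_lt_exp_iff]
  rw [bot_lt_iff_ne_bot, ne_eq, EReal.neg_eq_bot_iff]
  simpa using h

lemma expNeg_ofReal {t : ℝ} (ht : 0 ≤ t) :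
    expNeg (ENNReal.ofReal t) = ENNReal.ofReal (Real.exp (-t)) := by
  unfold expNeg
  rw [EReal.coe_ennreal_ofReal, max_eq_left ht, ← EReal.coe_neg, EReal.exp_coe]

lemma expNeg_sum {ι : Type*} (s : Finset ι) (f : ι → ℝ≥0∞) :
    expNeg (∑ i ∈ s, f i) = ∏ i ∈ s, expNeg (f i) := by
  classical
  induction s using Finset.induction_on with
  | empty => simp [expNeg_zero]
  | insert a s ha ih => rw [Finset.sum_insert ha, Finset.prod_insert ha, expNeg_add, ih]

lemma measurable_expNeg : Measurable expNeg := expNeg_antitone.measurable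

/-- The average of `f` over the `2d` neighbours of `x`. -/
def nbrAvg (f : (Fin d → ℤ) → ℝ≥0∞) (x : Fin d → ℤ) : ℝ≥0∞ :=
  ∑ p : Fin d × Bool, (2 * d : ℝ≥0∞)⁻¹ * f (x + unitStep p)

/-- One step of the random walk in the potential `v`, killed outside `A`. -/
def killedStep (A : Set (Fin d → ℤ)) (v f : (Fin d → ℤ) → ℝ≥0∞) : (Fin d → ℤ) → ℝ≥0∞ :=
  A.indicator fun x => expNeg (v x) * nbrAvg f x

/-- The Green operator of the random walk in the potential `v`, killed outside `A`. -/
def green (A : Set (Fin d → ℤ)) (v f : (Fin d → ℤ) → ℝ≥0∞) (x : Fin d → ℤ) : ℝ≥0∞ :=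
  ∑' n, (killedStep A v)^[n] f x

section Average

lemma nbrAvg_mono {f g : (Fin d → ℤ) → ℝ≥0∞} (h : ∀ x, f x ≤ g x) (x : Fin d → ℤ) :
    nbrAvg f x ≤ nbrAvg g x :=
  Finset.sum_le_sum fun _ _ => by gcongr; exact h _

lemma nbrAvg_const_mul (c : ℝ≥0∞) (f : (Fin d → ℤ) → ℝ≥0∞) (x : Fin d → ℤ) :
    nbrAvg (fun z => c * f z) x = c * nbrAvg f x := by
  simp only [nbrAvg, Finset.mul_sum]
  exact Finset.sum_congr rfl fun _ _ => by ring

lemma nbrAvg_add (f g : (Fin d → ℤ) → ℝ≥0∞) (x : Fin d → ℤ) :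
    nbrAvg (fun z => f z + g z) x = nbrAvg f x + nbrAvg g x := by
  simp only [nbrAvg, mul_add, Finset.sum_add_distrib]

lemma nbrAvg_tsum {ι : Type*} (f : ι → (Fin d → ℤ) → ℝ≥0∞) (x : Fin d → ℤ) :
    nbrAvg (fun z => ∑' i, f i z) x = ∑' i, nbrAvg (f i) x := by
  simp only [nbrAvg, ← ENNReal.tsum_mul_left]
  rw [Summable.tsum_finsetSum fun _ _ => ENNReal.summable]

lemma nbrAvg_const [NeZero d] (c : ℝ≥0∞) (x : Fin d → ℤ) : nbrAvg (fun _ => c) x = c := by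
  have h : (2 * d : ℝ≥0∞) ≠ 0 := by simp [NeZero.ne d]
  have h' : (2 * d : ℝ≥0∞) ≠ ⊤ := ENNReal.mul_ne_top (by simp) (by simp)
  simp only [nbrAvg, Finset.sum_const, Finset.card_univ, Fintype.card_prod, Fintype.card_fin,
    Fintype.card_bool, nsmul_eq_mul]
  rw [← mul_assoc, Nat.cast_mul, mul_comm (d : ℝ≥0∞), Nat.cast_ofNat, ENNReal.mul_inv_cancel h h',
    one_mul]

lemma le_nbrAvg (f : (Fin d → ℤ) → ℝ≥0∞) (x : Fin d → ℤ) (p : Fin d × Bool) :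
    (2 * d : ℝ≥0∞)⁻¹ * f (x + unitStep p) ≤ nbrAvg f x :=
  Finset.single_le_sum (f := fun p => (2 * d : ℝ≥0∞)⁻¹ * f (x + unitStep p))
    (fun _ _ => zero_le) (Finset.mem_univ p)

end Average

section Killed

variable {A B : Set (Fin d → ℤ)} {v f g : (Fin d → ℤ) → ℝ≥0∞}

lemma killedStep_of_mem {x : Fin d → ℤ} (hx : x ∈ A) :
    killedStep A v f x = expNeg (v x) * nbrAvg f x := by
  simp [killedStep, hx]

lemma killedStep_of_notMem {x : Fin d → ℤ} (hx : x ∉ A) : killedStep A v f x = 0 := by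
  simp [killedStep, hx]

lemma killedStep_le (x : Fin d → ℤ) : killedStep A v f x ≤ nbrAvg f x := by
  by_cases hx : x ∈ A
  · rw [killedStep_of_mem hx]
    exact mul_le_of_le_one_left (zero_le) (expNeg_le_one _)
  · simp [killedStep_of_notMem hx]

lemma killedStep_mono (h : ∀ x, f x ≤ g x) (x : Fin d → ℤ) :
    killedStep A v f x ≤ killedStep A v g x := by
  by_cases hx : x ∈ A
  · rw [killedStep_of_mem hx, killedStep_of_mem hx]
    gcongr
    exact nbrAvg_mono h x
  · simp [killedStep_of_notMem hx]

lemma killedStep_mono_set (h : A ⊆ B) (x : Fin d → ℤ) :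
    killedStep A v f x ≤ killedStep B v f x :=
  Set.indicator_le_indicator_of_subset h (fun _ => zero_le) x

lemma killedStep_tsum {ι : Type*} (f : ι → (Fin d → ℤ) → ℝ≥0∞) :
    killedStep A v (fun z => ∑' i, f i z) = fun z => ∑' i, killedStep A v (f i) z := by
  ext x
  by_cases hx : x ∈ A
  · simp only [killedStep_of_mem hx, nbrAvg_tsum, ENNReal.tsum_mul_left]
  · simp [killedStep_of_notMem hx]

lemma killedStep_add (x : Fin d → ℤ) :
    killedStep A v (fun z => f z + g z) x = killedStep A v f x + killedStep A v g x := by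
  by_cases hx : x ∈ A
  · simp only [killedStep_of_mem hx, nbrAvg_add, mul_add]
  · simp [killedStep_of_notMem hx]

lemma killedStep_const_mul (c : ℝ≥0∞) :
    killedStep A v (fun z => c * f z) = fun z => c * killedStep A v f z := by
  ext x
  by_cases hx : x ∈ A
  · simp only [killedStep_of_mem hx, nbrAvg_const_mul]
    ring
  · simp [killedStep_of_notMem hx]

lemma killedStep_iterate_tsum {ι : Type*} (f : ι → (Fin d → ℤ) → ℝ≥0∞) (n : ℕ) :
    (killedStep A v)^[n] (fun z => ∑' i, f i z) = fun z => ∑' i, (killedStep A v)^[n] (f i) z := by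
  induction n with
  | zero => rfl
  | succ n ih => simp only [Function.iterate_succ_apply', ih, killedStep_tsum]

lemma killedStep_iterate_const_mul (c : ℝ≥0∞) (n : ℕ) :
    (killedStep A v)^[n] (fun z => c * f z) = fun z => c * (killedStep A v)^[n] f z := by
  induction n with
  | zero => rfl
  | succ n ih => simp only [Function.iterate_succ_apply', ih, killedStep_const_mul]

lemma killedStep_sum {ι : Type*} (s : Finset ι) (f : ι → (Fin d → ℤ) → ℝ≥0∞) (x : Fin d → ℤ) :
    killedStep A v (fun z => ∑ i ∈ s, f i z) x = ∑ i ∈ s, killedStep A v (f i) x := by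
  by_cases hx : x ∈ A
  · simp only [killedStep_of_mem hx, nbrAvg, Finset.mul_sum]
    rw [Finset.sum_comm]
  · simp [killedStep_of_notMem hx]

lemma green_eq (x : Fin d → ℤ) :
    green A v f x = f x + killedStep A v (green A v f) x := by
  have : green A v f = fun z => ∑' n, (killedStep A v)^[n] f z := rfl
  rw [this, killedStep_tsum]
  simp only [← Function.iterate_succ_apply' (f := killedStep A v)]
  rw [tsum_eq_zero_add' ENNReal.summable]
  rfl

lemma green_of_notMem {x : Fin d → ℤ} (hx : x ∉ A) : green A v f x = f x := by
  rw [green_eq, killedStep_of_notMem hx, add_zero]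

lemma le_green (x : Fin d → ℤ) : f x ≤ green A v f x := by
  rw [green_eq]; exact le_self_add

/-- The Green operator yields the least solution of `u = f + K u`. -/
lemma green_le {u : (Fin d → ℤ) → ℝ≥0∞} (h : ∀ x, f x + killedStep A v u x ≤ u x)
    (x : Fin d → ℤ) : green A v f x ≤ u x := by
  refine ENNReal.tsum_le_of_sum_range_le fun N => ?_
  induction N generalizing x with
  | zero => simp
  | succ N ih =>
    -- The partial sum of length N+1 is f plus K applied to the partial sum of length N, so the
    -- bound propagates by monotonicity of K.
    rw [Finset.sum_range_succ']
    simp only [Function.iterate_succ_apply', Function.iterate_zero, id]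
    rw [← killedStep_sum, add_comm]
    exact (add_le_add le_rfl (killedStep_mono ih x)).trans (h x)

lemma green_mono_set (h : A ⊆ B) (x : Fin d → ℤ) : green A v f x ≤ green B v f x :=
  green_le (fun x => by
    rw [green_eq (A := B)]; exact add_le_add le_rfl (killedStep_mono_set h x)) x

lemma green_const_mul (c : ℝ≥0∞) (x : Fin d → ℤ) :
    green A v (fun z => c * f z) x = c * green A v f x := by
  simp only [green, killedStep_iterate_const_mul, ENNReal.tsum_mul_left]

/-- Linearity in the source f: the functions `green A v (Pi.single z 1)` are the kernel, and
decompositions over sites go through this expansion. -/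
lemma green_eq_tsum (x : Fin d → ℤ) :
    green A v f x = ∑' z, f z * green A v (Pi.single z 1) x := by
  have hf : f = fun x => ∑' z, f z * Pi.single (M := fun _ => ℝ≥0∞) z 1 x := by
    ext x
    rw [tsum_eq_single x]
    · simp
    · intro z hz
      simp [Pi.single_eq_of_ne hz.symm]
  conv_lhs => rw [hf]
  simp only [green, killedStep_iterate_tsum, killedStep_iterate_const_mul,
    ← ENNReal.tsum_mul_left]
  rw [ENNReal.tsum_comm]

/-- If `f` vanishes on `A` and is dominated off `A` by `u`, which is superharmonic on `A`, then
`u` dominates the Green potential of `f`. -/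
lemma green_le_of_superharmonic {u : (Fin d → ℤ) → ℝ≥0∞} (hfA : ∀ x ∈ A, f x = 0)
    (hfu : ∀ x ∉ A, f x ≤ u x) (hu : ∀ x ∈ A, expNeg (v x) * nbrAvg u x ≤ u x)
    (x : Fin d → ℤ) : green A v f x ≤ u x := by
  refine green_le (fun x => ?_) x
  by_cases hx : x ∈ A
  · rw [hfA x hx, zero_add, killedStep_of_mem hx]; exact hu x hx
  · rw [killedStep_of_notMem hx, add_zero]; exact hfu x hx

lemma green_le_one [NeZero d] (hfA : ∀ x ∈ A, f x = 0) (hf : ∀ x, f x ≤ 1) (x : Fin d → ℤ) :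
    green A v f x ≤ 1 :=
  green_le_of_superharmonic (u := fun _ => 1) hfA (fun x _ => hf x)
    (fun x _ => by rw [nbrAvg_const, mul_one]; exact expNeg_le_one _) x

open Classical in
/-- Decomposition of the Green potential at the first entrance into `B`. -/
lemma green_first_entrance (A B : Set (Fin d → ℤ)) (v f : (Fin d → ℤ) → ℝ≥0∞) (x : Fin d → ℤ) :
    green A v f x = green (A \ B) v (fun z => if z ∈ B then green A v f z else f z) x := by
  set F : (Fin d → ℤ) → ℝ≥0∞ := fun z => if z ∈ B then green A v f z else f z with hF
  -- Minimality is used in both directions: each side is a supersolution of the problem defining the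
  -- other. On B the second direction relies on this first inequality.
  have hle : ∀ x, green (A \ B) v F x ≤ green A v f x := by
    refine green_le fun x => ?_
    by_cases hx : x ∈ B
    · rw [killedStep_of_notMem (fun h => h.2 hx)]
      simp [hF, hx]
    · simp only [hF, hx, if_false]
      conv_rhs => rw [green_eq]
      exact add_le_add le_rfl (killedStep_mono_set Set.sdiff_subset x)
  refine le_antisymm (green_le (fun x => ?_) x) (hle x)
  by_cases hx : x ∈ B
  · rw [green_of_notMem (fun h => h.2 hx)]
    simp only [hF, hx, if_true]
    rw [green_eq]
    exact add_le_add le_rfl (killedStep_mono hle x)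
  · rw [green_eq (A := A \ B)]
    have : F x = f x := by simp [hF, hx]
    rw [this]
    by_cases hxA : x ∈ A
    · rw [killedStep_of_mem hxA, killedStep_of_mem (A := A \ B) ⟨hxA, hx⟩]
    · rw [killedStep_of_notMem hxA]; simp

/-- Decomposition of the Green potential at the last exit from `B`. -/
lemma green_le_last_exit (A B : Set (Fin d → ℤ)) (v f : (Fin d → ℤ) → ℝ≥0∞) (x : Fin d → ℤ) :
    green A v f x ≤ green (A \ B) v f x +
      green A v (B.indicator (killedStep A v (green (A \ B) v f))) x := by
  -- The right side is a supersolution: at sites of B, where the walk on `A \ B` is stopped, the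
  -- extra source supplies the missing step.
  refine green_le (u := fun x => green (A \ B) v f x +
      green A v (B.indicator (killedStep A v (green (A \ B) v f))) x) (fun x => ?_) x
  rw [killedStep_add]
  conv_rhs => rw [green_eq, green_eq (A := A)]
  rw [← add_assoc, ← add_assoc]
  gcongr ?_ + _
  by_cases hx : x ∈ B
  · rw [Set.indicator_of_mem hx]; gcongr; exact le_self_add
  · rw [Set.indicator_of_notMem hx, add_zero]
    by_cases hxA : x ∈ A
    · rw [killedStep_of_mem hxA, killedStep_of_mem (A := A \ B) ⟨hxA, hx⟩]
    · rw [killedStep_of_notMem hxA]; simp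

/-- The Green function is bounded in terms of the probability of not returning. -/
lemma green_single_le [NeZero d] {b : Fin d → ℤ} {δ : ℝ≥0∞} (hδ : δ ≠ 0) (hδ' : δ ≠ ⊤)
    (hret : nbrAvg (green (A \ {b}) v (Pi.single b 1)) b * expNeg (v b) + δ ≤ 1)
    (x : Fin d → ℤ) : green A v (Pi.single b 1) x ≤ δ⁻¹ := by
  set u := green (A \ {b}) v (Pi.single b 1) with hu
  have hu1 : ∀ x, u x ≤ 1 := by
    refine green_le_one (fun x hx => ?_) fun x => ?_
    · exact Pi.single_eq_of_ne hx.2 _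
    · by_cases h : x = b
      · subst h; simp
      · simp [Pi.single_eq_of_ne h]
  have hub : u b = 1 := by
    rw [hu, green_of_notMem (by simp)]; simp
  -- With u the weight of hitting b, δ⁻¹ u is a supersolution: away from b because u is harmonic
  -- there, and at b because the return weight is at most 1 - δ.
  refine (green_le (u := fun x => δ⁻¹ * u x) (fun x => ?_) x).trans
    (mul_le_of_le_one_right (zero_le) (hu1 x))
  by_cases hx : x = b
  · subst hx
    have : killedStep A v (fun x => δ⁻¹ * u x) x ≤ δ⁻¹ * (nbrAvg u x * expNeg (v x)) := by
      by_cases hx : x ∈ A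
      · rw [killedStep_of_mem hx, nbrAvg_const_mul]
        exact le_of_eq (by ring)
      · simp [killedStep_of_notMem hx]
    rw [hub, mul_one, Pi.single_eq_same]
    calc 1 + killedStep A v (fun x => δ⁻¹ * u x) x
        ≤ δ⁻¹ * δ + δ⁻¹ * (nbrAvg u x * expNeg (v x)) := by
          rw [ENNReal.inv_mul_cancel hδ hδ']; gcongr
      _ = δ⁻¹ * (nbrAvg u x * expNeg (v x) + δ) := by ring
      _ ≤ δ⁻¹ * 1 := by gcongr
      _ = δ⁻¹ := mul_one _
  · rw [Pi.single_eq_of_ne hx, zero_add, killedStep_const_mul]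
    change δ⁻¹ * killedStep A v u x ≤ δ⁻¹ * u x
    gcongr
    conv_rhs => rw [hu, green_eq, Pi.single_eq_of_ne hx, zero_add]
    by_cases hxA : x ∈ A
    · rw [killedStep_of_mem hxA, killedStep_of_mem (A := A \ {b}) ⟨hxA, hx⟩]
    · rw [killedStep_of_notMem hxA]; simp

/-- A subharmonic barrier `ψ` vanishing at `b` bounds the Green function with pole `b`. -/
lemma green_single_le_of_barrier [NeZero d] {b : Fin d → ℤ} {δ : ℝ≥0∞} (hδ : δ ≠ 0)
    (ψ : (Fin d → ℤ) → ℝ≥0∞) (hψ1 : ∀ x, ψ x ≤ 1) (hψb : ψ b = 0)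
    (hψ : ∀ x, x ≠ b → ψ x ≤ nbrAvg ψ x ∨ ψ x ≤ 1 - expNeg (v x))
    (hδψ : δ ≤ nbrAvg ψ b ∨ δ ≤ 1 - expNeg (v b)) (x : Fin d → ℤ) :
    green A v (Pi.single b 1) x ≤ δ⁻¹ := by
  have havg : ∀ x, nbrAvg (fun z => 1 - ψ z) x + nbrAvg ψ x = 1 := fun x => by
    rw [← nbrAvg_add]
    simp only [tsub_add_cancel_of_le (hψ1 _)]
    exact nbrAvg_const 1 x
  have havg1 : ∀ x, nbrAvg (fun z => 1 - ψ z) x ≤ 1 := fun x =>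
    (le_self_add).trans (havg x).le
  -- 1 - ψ is superharmonic off b: where ψ is subharmonic this is clear, and elsewhere the killing 1
  -- - exp(-v) is at least ψ. Hence it dominates the weight of hitting b.
  have hle : ∀ x, green (A \ {b}) v (Pi.single b 1) x ≤ 1 - ψ x := by
    refine green_le_of_superharmonic (fun x hx => Pi.single_eq_of_ne hx.2 _) (fun x _ => ?_)
      (fun x hx => ?_)
    · by_cases h : x = b
      · subst h; simp [hψb]
      · simp [Pi.single_eq_of_ne h]
    · refine ENNReal.le_sub_of_add_le_right (ne_top_of_le_ne_top ENNReal.one_ne_top (hψ1 x)) ?_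
      rcases hψ x hx.2 with h | h
      · calc _ ≤ 1 * nbrAvg (fun z => 1 - ψ z) x + nbrAvg ψ x := by
              gcongr; exact expNeg_le_one _
          _ = 1 := by rw [one_mul, havg]
      · calc _ ≤ expNeg (v x) * 1 + (1 - expNeg (v x)) := by
              gcongr; exact havg1 x
          _ = 1 := by rw [mul_one, add_tsub_cancel_of_le (expNeg_le_one _)]
  -- The same dichotomy at b itself shows that at least δ is lost before a return.
  have hδ1 : nbrAvg (green (A \ {b}) v (Pi.single b 1)) b * expNeg (v b) + δ ≤ 1 := by
    have h1 := nbrAvg_mono hle b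
    rcases hδψ with h | h
    · calc _ ≤ nbrAvg (fun z => 1 - ψ z) b * 1 + nbrAvg ψ b := by
            gcongr; exact expNeg_le_one _
        _ = 1 := by rw [mul_one, havg]
    · calc _ ≤ 1 * expNeg (v b) + (1 - expNeg (v b)) := by
            gcongr; exact h1.trans (havg1 b)
        _ = 1 := by rw [one_mul, add_tsub_cancel_of_le (expNeg_le_one _)]
  exact green_single_le hδ (ne_top_of_le_ne_top ENNReal.one_ne_top (le_add_self.trans hδ1)) hδ1 x

end Killed

/-! ### The path measure in terms of the killed random walk operator -/

section PathSpace

/-- The sequence with first term `a`, followed by `s`. -/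
def consSeq {α : Type*} (a : α) (s : ℕ → α) : ℕ → α
  | 0 => a
  | n + 1 => s n

lemma measurable_consSeq {α : Type*} [MeasurableSpace α] :
    Measurable fun q : α × (ℕ → α) => consSeq q.1 q.2 := by
  refine measurable_pi_lambda _ fun n => ?_
  cases n with
  | zero => exact measurable_fst
  | succ n => exact (measurable_pi_apply n).comp measurable_snd

/-- An i.i.d. sequence is its first term followed by an independent copy of itself; this is the
source of the Markov property at time one. -/
lemma infinitePi_eq_map_consSeq {α : Type*} [MeasurableSpace α] (ν : Measure α)
    [IsProbabilityMeasure ν] :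
    (ν.prod (Measure.infinitePi fun _ : ℕ => ν)).map (fun q => consSeq q.1 q.2) =
      Measure.infinitePi fun _ : ℕ => ν := by
  classical
  refine Measure.eq_infinitePi _ fun s t ht => ?_
  rw [Measure.map_apply measurable_consSeq
    (MeasurableSet.pi s.countable_toSet fun i _ => ht i)]
  have hinj : Set.InjOn Nat.succ (Nat.succ ⁻¹' (s : Set ℕ)) := Nat.succ_injective.injOn
  have hpre : (fun q : α × (ℕ → α) => consSeq q.1 q.2) ⁻¹' (Set.pi s t) =
      (if 0 ∈ s then t 0 else Set.univ) ×ˢ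
        (Set.pi (s.preimage Nat.succ hinj) fun n => t (n + 1)) := by
    ext ⟨a, ξ⟩
    simp only [Set.mem_preimage, Set.mem_pi, Finset.mem_coe, Set.mem_prod, Finset.mem_preimage]
    constructor
    · intro h
      refine ⟨?_, fun n hn => h (n + 1) hn⟩
      split_ifs with h0
      · exact h 0 h0
      · trivial
    · rintro ⟨h0, h1⟩ n hn
      cases n with
      | zero => rw [if_pos hn] at h0; exact h0
      | succ n => exact h1 n hn
  rw [hpre, Measure.prod_prod, Measure.infinitePi_pi _ (fun i _ => ht (i + 1))]
  have hprod : ∏ i ∈ s.preimage Nat.succ hinj, ν (t (i + 1)) = ∏ i ∈ s.erase 0, ν (t i) := by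
    refine Finset.prod_bij (fun n _ => n + 1) ?_ ?_ ?_ ?_
    · intro n hn; simpa using hn
    · intro a _ b _ h; simpa using h
    · intro b hb
      rw [Finset.mem_erase] at hb
      exact ⟨b - 1, by simpa [Nat.sub_add_cancel (Nat.one_le_iff_ne_zero.2 hb.1)] using hb.2,
        Nat.sub_add_cancel (Nat.one_le_iff_ne_zero.2 hb.1)⟩
    · intros; rfl
  rw [hprod]
  split_ifs with h0
  · rw [Finset.mul_prod_erase s (fun i => ν (t i)) h0]
  · rw [measure_univ, one_mul, Finset.erase_eq_of_notMem h0]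

lemma measurable_walkPath (x : Fin d → ℤ) : Measurable (walkPath x) := by
  refine measurable_pi_lambda _ fun n => ?_
  unfold walkPath
  refine measurable_const.add (Finset.measurable_fun_sum _ fun k _ => ?_)
  exact (measurable_of_countable unitStep).comp (measurable_pi_apply k)

lemma walkPath_consSeq (x : Fin d → ℤ) (p : Fin d × Bool) (ξ : ℕ → Fin d × Bool) :
    walkPath x (consSeq p ξ) = consSeq x (walkPath (x + unitStep p) ξ) := by
  ext1 n
  cases n with
  | zero => simp [walkPath, consSeq]
  | succ n =>
    simp only [walkPath, consSeq, Finset.sum_range_succ']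
    abel

instance [NeZero d] (x : Fin d → ℤ) : IsProbabilityMeasure (srw x) :=
  Measure.isProbabilityMeasure_map (measurable_walkPath x).aemeasurable

/-- The Markov property at time one. -/
lemma lintegral_srw [NeZero d] (x : Fin d → ℤ) {F : (ℕ → Fin d → ℤ) → ℝ≥0∞} (hF : Measurable F) :
    ∫⁻ S, F S ∂(srw x) = nbrAvg (fun z => ∫⁻ S, F (consSeq x S) ∂(srw z)) x := by
  have hcons : Measurable fun S : ℕ → Fin d → ℤ => consSeq x S :=
    measurable_consSeq.comp (measurable_const.prodMk measurable_id)
  have hU : ∀ p : Fin d × Bool,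
      (PMF.uniformOfFintype (Fin d × Bool)).toMeasure {p} = (2 * d : ℝ≥0∞)⁻¹ := fun p => by
    rw [PMF.toMeasure_apply_singleton _ _ (measurableSet_singleton p)]
    simp [mul_comm]
  have hFw : Measurable fun ξ => F (walkPath x ξ) := hF.comp (measurable_walkPath x)
  have hFc : Measurable fun q : (Fin d × Bool) × (ℕ → Fin d × Bool) =>
      F (walkPath x (consSeq q.1 q.2)) := hFw.comp measurable_consSeq
  unfold srw nbrAvg
  conv_lhs => rw [lintegral_map hF (measurable_walkPath x), ← infinitePi_eq_map_consSeq,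
    lintegral_map hFw measurable_consSeq,
    lintegral_prod _ hFc.aemeasurable, lintegral_fintype]
  refine Finset.sum_congr rfl fun p _ => ?_
  have hFx : Measurable fun S => F (consSeq x S) := hF.comp hcons
  rw [hU, mul_comm]
  simp only [walkPath_consSeq]
  rw [lintegral_map hFx (measurable_walkPath _)]

lemma hitTime_eq_coe_iff {y : Fin d → ℤ} {S : ℕ → Fin d → ℤ} {n : ℕ} :
    hitTime y S = n ↔ S n = y ∧ ∀ k < n, S k ≠ y := by
  constructor
  · intro h
    have hlt : ∀ k < n, S k ≠ y := fun k hk hS => by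
      have : hitTime y S ≤ k := iInf₂_le k hS
      rw [h] at this
      exact absurd (by exact_mod_cast this) (not_le.2 hk)
    refine ⟨?_, hlt⟩
    by_contra hn
    have : ((n + 1 : ℕ) : ℕ∞) ≤ hitTime y S := by
      refine le_iInf₂ fun k hk => ?_
      have hkn : n < k := by
        rcases lt_trichotomy k n with h | h | h
        · exact absurd hk (hlt k h)
        · exact absurd (h ▸ hk) hn
        · exact h
      exact_mod_cast hkn
    rw [h] at this
    have : n + 1 ≤ n := by exact_mod_cast this
    omega
  · rintro ⟨h1, h2⟩
    refine le_antisymm (iInf₂_le n h1) (le_iInf₂ fun k hk => ?_)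
    have : n ≤ k := not_lt.1 fun h => h2 k h hk
    exact_mod_cast this

open Classical in
/-- The contribution to `pathWeight` of the paths hitting `y` for the first time at time `n`. -/
def crossWeight (v : (Fin d → ℤ) → ℝ≥0∞) (y : Fin d → ℤ) (n : ℕ) (S : ℕ → Fin d → ℤ) : ℝ≥0∞ :=
  if hitTime y S = n then expNeg (∑ k ∈ Finset.range n, v (S k)) else 0

lemma measurable_crossWeight_uncurry {α : Type*} [MeasurableSpace α]
    {v : (Fin d → ℤ) → α → ℝ≥0∞} (hv : ∀ z, Measurable (v z)) (y : Fin d → ℤ) (n : ℕ) :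
    Measurable fun q : α × (ℕ → Fin d → ℤ) => crossWeight (fun z => v z q.1) y n q.2 := by
  unfold crossWeight
  have hset : ∀ k, MeasurableSet {q : α × (ℕ → Fin d → ℤ) | q.2 k = y} := fun k =>
    measurableSet_eq_fun ((measurable_pi_apply k).comp measurable_snd) measurable_const
  refine Measurable.ite ?_ (measurable_expNeg.comp (Finset.measurable_fun_sum _ fun k _ => ?_))
    measurable_const
  · have : {q : α × (ℕ → Fin d → ℤ) | hitTime y q.2 = n} =
        {q : α × (ℕ → Fin d → ℤ) | q.2 n = y} ∩
          ⋂ k ∈ Set.Iio n, {q : α × (ℕ → Fin d → ℤ) | q.2 k = y}ᶜ := by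
      ext; simp [hitTime_eq_coe_iff]
    rw [this]
    exact (hset n).inter (MeasurableSet.biInter (Set.to_countable _) fun k _ => (hset k).compl)
  · have h : Measurable fun q : α × (Fin d → ℤ) => v q.2 q.1 :=
      measurable_from_prod_countable_left fun z => hv z
    exact h.comp (measurable_fst.prodMk ((measurable_pi_apply k).comp measurable_snd))

lemma measurable_crossWeight (v : (Fin d → ℤ) → ℝ≥0∞) (y : Fin d → ℤ) (n : ℕ) :
    Measurable (crossWeight v y n) :=
  (measurable_crossWeight_uncurry (α := Unit) (v := fun z _ => v z)
    (fun _ => measurable_const) y n).comp (measurable_prodMk_left (x := ()))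

lemma crossWeight_succ_consSeq (v : (Fin d → ℤ) → ℝ≥0∞) (x y : Fin d → ℤ) (n : ℕ)
    (S : ℕ → Fin d → ℤ) :
    crossWeight v y (n + 1) (consSeq x S) =
      if x = y then 0 else expNeg (v x) * crossWeight v y n S := by
  have hc : hitTime y (consSeq x S) = ((n + 1 : ℕ) : ℕ∞) ↔ x ≠ y ∧ hitTime y S = n := by
    rw [hitTime_eq_coe_iff, hitTime_eq_coe_iff]
    constructor
    · rintro ⟨h, h'⟩
      exact ⟨h' 0 (Nat.succ_pos n), h, fun k hk => h' (k + 1) (Nat.succ_lt_succ hk)⟩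
    · rintro ⟨h0, h, h'⟩
      refine ⟨h, fun k hk => ?_⟩
      cases k with
      | zero => exact h0
      | succ k => exact h' k (Nat.lt_of_succ_lt_succ hk)
  unfold crossWeight
  simp only [hc, Finset.sum_range_succ', consSeq]
  by_cases hx : x = y
  · simp [hx]
  · simp only [hx, ne_eq, not_false_eq_true, true_and, if_false]
    split_ifs
    · rw [add_comm, expNeg_add]
    · simp

/-- Conditioning on the first step gives path integrals the recursion of the operator iterates.
Killing outside `{y}ᶜ` encodes that the hit at time n is the first. -/
lemma lintegral_crossWeight [NeZero d] (v : (Fin d → ℤ) → ℝ≥0∞) (y : Fin d → ℤ) (n : ℕ)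
    (x : Fin d → ℤ) :
    ∫⁻ S, crossWeight v y n S ∂(srw x) = (killedStep {y}ᶜ v)^[n] (Pi.single y 1) x := by
  induction n generalizing x with
  | zero =>
    rw [lintegral_srw x (measurable_crossWeight v y 0)]
    have : (fun z => ∫⁻ S, crossWeight v y 0 (consSeq x S) ∂(srw z)) =
        fun _ => (Pi.single y 1 : (Fin d → ℤ) → ℝ≥0∞) x := by
      ext z
      have h0 : ∀ S, hitTime y (consSeq x S) = ((0 : ℕ) : ℕ∞) ↔ x = y := fun S => by
        rw [hitTime_eq_coe_iff]; simp [consSeq]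
      simp only [crossWeight, h0]
      by_cases hx : x = y
      · subst hx; simp [expNeg_zero]
      · simp [hx, Pi.single_eq_of_ne]
    rw [this, nbrAvg_const]
    rfl
  | succ n ih =>
    rw [lintegral_srw x (measurable_crossWeight v y _), Function.iterate_succ_apply']
    simp only [crossWeight_succ_consSeq]
    by_cases hx : x = y
    · rw [killedStep_of_notMem (by simp [hx])]
      simp [hx, nbrAvg]
    · rw [killedStep_of_mem (by simp [hx])]
      simp only [hx, if_false]
      rw [← nbrAvg_const_mul]
      congr 1
      ext z
      rw [lintegral_const_mul _ (measurable_crossWeight v y n), ih]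

lemma crossWeight_eq_of_hitTime {v : (Fin d → ℤ) → ℝ≥0∞} {y : Fin d → ℤ} {S : ℕ → Fin d → ℤ}
    {n : ℕ} (h : hitTime y S = n) (m : ℕ) :
    crossWeight v y m S = if m = n then pathWeight v y S else 0 := by
  unfold crossWeight
  rw [h]
  by_cases hm : m = n
  · subst hm
    simp [pathWeight, h, expNeg]
  · rw [if_neg hm, if_neg]
    exact_mod_cast Ne.symm hm

lemma crossWeight_eq_zero_of_hitTime_top {v : (Fin d → ℤ) → ℝ≥0∞} {y : Fin d → ℤ}
    {S : ℕ → Fin d → ℤ} (h : hitTime y S = ⊤) (m : ℕ) : crossWeight v y m S = 0 := by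
  unfold crossWeight
  rw [h, if_neg]
  exact ENat.top_ne_natCast m

lemma pathWeight_eq_tsum (v : (Fin d → ℤ) → ℝ≥0∞) (y : Fin d → ℤ) (S : ℕ → Fin d → ℤ) :
    pathWeight v y S = ∑' n, crossWeight v y n S := by
  induction h : hitTime y S using ENat.recTopCoe with
  | top => simp [crossWeight_eq_zero_of_hitTime_top h, pathWeight, h]
  | coe n => simp [crossWeight_eq_of_hitTime h]

lemma pathWeight_mul_hitTime_eq_tsum (v : (Fin d → ℤ) → ℝ≥0∞) (y : Fin d → ℤ)
    (S : ℕ → Fin d → ℤ) :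
    pathWeight v y S * (hitTime y S : ℝ≥0∞) = ∑' n : ℕ, crossWeight v y n S * n := by
  induction h : hitTime y S using ENat.recTopCoe with
  | top => simp [crossWeight_eq_zero_of_hitTime_top h, pathWeight, h]
  | coe n =>
    simp only [crossWeight_eq_of_hitTime h]
    rw [tsum_eq_single n fun m hm => by simp [hm]]
    simp

lemma measurable_pathWeight_uncurry {α : Type*} [MeasurableSpace α]
    {v : (Fin d → ℤ) → α → ℝ≥0∞} (hv : ∀ z, Measurable (v z)) (y : Fin d → ℤ) :
    Measurable fun q : α × (ℕ → Fin d → ℤ) => pathWeight (fun z => v z q.1) y q.2 := by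
  simp only [pathWeight_eq_tsum]
  exact Measurable.tsum fun n => measurable_crossWeight_uncurry hv y n

lemma measurable_pathWeight (v : (Fin d → ℤ) → ℝ≥0∞) (y : Fin d → ℤ) :
    Measurable (pathWeight v y) := by
  have : pathWeight v y = fun S => ∑' n, crossWeight v y n S := funext (pathWeight_eq_tsum v y)
  rw [this]
  exact Measurable.tsum fun n => measurable_crossWeight v y n

open Classical in
lemma measurable_hitTime (y : Fin d → ℤ) :
    Measurable fun S : ℕ → Fin d → ℤ => (hitTime y S : ℝ≥0∞) := by
  have h : ∀ S : ℕ → Fin d → ℤ, (hitTime y S : ℝ≥0∞) =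
      ⨅ n : ℕ, {S : ℕ → Fin d → ℤ | S n = y}.piecewise (fun _ => (n : ℝ≥0∞)) (fun _ => ⊤) S := by
    intro S
    induction hS : hitTime y S using ENat.recTopCoe with
    | top =>
      symm
      rw [ENat.toENNReal_top, iInf_eq_top]
      intro n
      rw [Set.piecewise_eq_of_notMem]
      intro hn
      have : hitTime y S ≤ n := iInf₂_le n hn
      rw [hS] at this
      exact absurd this (by simp)
    | coe n =>
      obtain ⟨h1, h2⟩ := hitTime_eq_coe_iff.1 hS
      refine le_antisymm (le_iInf fun m => ?_) ((iInf_le _ n).trans ?_)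
      · by_cases hm : S m = y
        · rw [Set.piecewise_eq_of_mem {S : ℕ → Fin d → ℤ | S m = y} _ _ hm]
          have : n ≤ m := not_lt.1 fun h => h2 m h hm
          simpa using this
        · rw [Set.piecewise_eq_of_notMem {S : ℕ → Fin d → ℤ | S m = y} _ _ hm]; exact le_top
      · rw [Set.piecewise_eq_of_mem {S : ℕ → Fin d → ℤ | S n = y} _ _ h1]; simp
  simp only [h]
  refine Measurable.iInf fun n => Measurable.piecewise ?_ measurable_const measurable_const
  exact measurableSet_eq_fun (measurable_pi_apply n) measurable_const

lemma quenchedZ_eq_green [NeZero d] (v : (Fin d → ℤ) → ℝ≥0∞) (x y : Fin d → ℤ) :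
    quenchedZ v x y = green {y}ᶜ v (Pi.single y 1) x := by
  unfold quenchedZ green
  simp only [pathWeight_eq_tsum, ← lintegral_crossWeight]
  rw [lintegral_tsum fun n => (measurable_crossWeight v y n).aemeasurable]

end PathSpace

section Annealed

variable {Ω : Type*}

/-- The annealed weight of the paths from `0` which hit `y` for the first time at time `n`. -/
def crossMass [MeasurableSpace Ω] (μ : Measure Ω) (V : (Fin d → ℤ) → Ω → ℝ≥0∞)
    (y : Fin d → ℤ) (n : ℕ) : ℝ≥0∞ :=
  ∫⁻ ω, (killedStep {y}ᶜ fun z => V z ω)^[n] (Pi.single y 1) 0 ∂μ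

lemma measurable_nbrAvg {m : MeasurableSpace Ω} {F : (Fin d → ℤ) → Ω → ℝ≥0∞}
    (hF : ∀ z, Measurable[m] (F z)) (x : Fin d → ℤ) :
    Measurable[m] fun ω => nbrAvg (fun z => F z ω) x :=
  Finset.measurable_fun_sum _ fun _ _ => (hF _).const_mul _

/-- The killed operator on `A` only reads the potential on `A`. -/
lemma measurable_killedStep_iterate {m : MeasurableSpace Ω} {A : Set (Fin d → ℤ)}
    {V : (Fin d → ℤ) → Ω → ℝ≥0∞} (hV : ∀ z ∈ A, Measurable[m] (V z))
    (f : (Fin d → ℤ) → ℝ≥0∞) (n : ℕ) (x : Fin d → ℤ) :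
    Measurable[m] fun ω => (killedStep A fun z => V z ω)^[n] f x := by
  induction n generalizing x with
  | zero => exact measurable_const
  | succ n ih =>
    simp only [Function.iterate_succ_apply']
    by_cases hx : x ∈ A
    · simp only [killedStep_of_mem hx]
      exact (measurable_expNeg.comp (hV x hx)).mul (measurable_nbrAvg (fun z => ih z) x)
    · simp only [killedStep_of_notMem hx]
      exact measurable_const

lemma measurable_green {m : MeasurableSpace Ω} {A : Set (Fin d → ℤ)}
    {V : (Fin d → ℤ) → Ω → ℝ≥0∞} (hV : ∀ z ∈ A, Measurable[m] (V z))
    (f : (Fin d → ℤ) → ℝ≥0∞) (x : Fin d → ℤ) :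
    Measurable[m] fun ω => green A (fun z => V z ω) f x :=
  Measurable.tsum fun n => measurable_killedStep_iterate hV f n x

lemma annealedZ_eq_lintegral_green [NeZero d] [MeasurableSpace Ω] (μ : Measure Ω)
    (V : (Fin d → ℤ) → Ω → ℝ≥0∞)
    (x y : Fin d → ℤ) :
    annealedZ μ V x y = ∫⁻ ω, green {y}ᶜ (fun z => V z ω) (Pi.single y 1) x ∂μ := by
  simp only [annealedZ, quenchedZ_eq_green]

lemma annealedZ_eq_tsum_crossMass [NeZero d] [MeasurableSpace Ω] {μ : Measure Ω}
    {V : (Fin d → ℤ) → Ω → ℝ≥0∞}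
    (hV : ∀ z, Measurable (V z)) (y : Fin d → ℤ) :
    annealedZ μ V 0 y = ∑' n, crossMass μ V y n := by
  rw [annealedZ_eq_lintegral_green]
  unfold green crossMass
  rw [lintegral_tsum fun n => (measurable_killedStep_iterate (fun z _ => hV z) _ n 0).aemeasurable]

/-- By Fubini the mean of τ_y under Q_y is the normalized first moment of the sequence `crossMass`,
the form used both for tilting in t and for the bound on the time. -/
lemma meanCrossingTime_eq [NeZero d] [MeasurableSpace Ω] {μ : Measure Ω} [SFinite μ]
    {V : (Fin d → ℤ) → Ω → ℝ≥0∞}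
    (hV : ∀ z, Measurable (V z)) (y : Fin d → ℤ) :
    meanCrossingTime μ V y = (annealedZ μ V 0 y)⁻¹ * ∑' n : ℕ, crossMass μ V y n * n := by
  have hpw := measurable_pathWeight_uncurry hV y
  have hτ : Measurable fun q : Ω × (ℕ → Fin d → ℤ) => (hitTime y q.2 : ℝ≥0∞) :=
    (measurable_hitTime y).comp measurable_snd
  unfold meanCrossingTime annealedQ
  rw [lintegral_smul_measure, smul_eq_mul, lintegral_map (measurable_hitTime y) measurable_snd,
    lintegral_withDensity_eq_lintegral_mul _ hpw hτ]
  congr 1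
  rw [lintegral_prod _ (hpw.mul hτ).aemeasurable]
  simp only [Pi.mul_apply, pathWeight_mul_hitTime_eq_tsum]
  unfold crossMass
  simp only [← lintegral_crossWeight]
  have hmeas : ∀ n : ℕ, Measurable fun ω => ∫⁻ S, crossWeight (fun z => V z ω) y n S ∂(srw 0) :=
    fun n => (measurable_crossWeight_uncurry hV y n).lintegral_prod_right'
  calc _ = ∫⁻ ω, ∑' n : ℕ, (∫⁻ S, crossWeight (fun z => V z ω) y n S ∂(srw 0)) * n ∂μ := by
        refine lintegral_congr fun ω => ?_
        rw [lintegral_tsum fun n => ((measurable_crossWeight _ y n).mul_const _).aemeasurable]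
        congr 1; ext n
        rw [lintegral_mul_const _ (measurable_crossWeight _ y n)]
    _ = _ := by
        rw [lintegral_tsum fun n => ((hmeas n).mul_const _).aemeasurable]
        congr 1; ext n
        rw [lintegral_mul_const _ (hmeas n)]

end Annealed

/-! ### I.i.d. potentials: independence, positive correlation, supermultiplicativity -/

section Field

variable {Ω : Type*}

/-- The random variables `V z` are independent and identically distributed under `μ`. -/
structure IsIIDField [MeasurableSpace Ω] (μ : Measure Ω) (V : (Fin d → ℤ) → Ω → ℝ≥0∞) : Prop where
  meas : ∀ z, Measurable (V z)
  indep : iIndepFun V μ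
  ident : ∀ z, IdentDistrib (V z) (V 0) μ μ

/-- `𝔼 exp (-V(0))`. -/
def meanExp [MeasurableSpace Ω] (μ : Measure Ω) (V : (Fin d → ℤ) → Ω → ℝ≥0∞) : ℝ≥0∞ :=
  ∫⁻ ω, expNeg (V 0 ω) ∂μ

/-- The `σ`-algebra generated by the potential at the sites of `S`. -/
@[reducible]
def sitesAlgebra (V : (Fin d → ℤ) → Ω → ℝ≥0∞) (S : Set (Fin d → ℤ)) : MeasurableSpace Ω :=
  ⨆ z ∈ S, MeasurableSpace.comap (V z) inferInstance

lemma measurable_sitesAlgebra {V : (Fin d → ℤ) → Ω → ℝ≥0∞} {S : Set (Fin d → ℤ)}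
    {z : Fin d → ℤ} (hz : z ∈ S) : Measurable[sitesAlgebra V S] (V z) :=
  measurable_iff_comap_le.2
    (le_iSup₂_of_le (f := fun z (_ : z ∈ S) => MeasurableSpace.comap (V z) inferInstance) z hz
      le_rfl)

variable [MeasurableSpace Ω] {μ : Measure Ω} {V : (Fin d → ℤ) → Ω → ℝ≥0∞}

namespace IsIIDField

lemma sitesAlgebra_le (hV : IsIIDField μ V) (S : Set (Fin d → ℤ)) :
    sitesAlgebra V S ≤ ‹MeasurableSpace Ω› :=
  iSup₂_le fun z _ => measurable_iff_comap_le.1 (hV.meas z)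

lemma lintegral_mul (hV : IsIIDField μ V) {S T : Set (Fin d → ℤ)} (hST : Disjoint S T)
    {f g : Ω → ℝ≥0∞} (hf : Measurable[sitesAlgebra V S] f) (hg : Measurable[sitesAlgebra V T] g) :
    ∫⁻ ω, f ω * g ω ∂μ = (∫⁻ ω, f ω ∂μ) * ∫⁻ ω, g ω ∂μ :=
  lintegral_mul_eq_lintegral_mul_lintegral_of_independent_measurableSpace
    (hV.sitesAlgebra_le S) (hV.sitesAlgebra_le T)
    (indep_iSup_of_disjoint (fun z => measurable_iff_comap_le.1 (hV.meas z)) hV.indep hST) hf hg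

lemma lintegral_comp (hV : IsIIDField μ V) {g : ℝ≥0∞ → ℝ≥0∞} (hg : Measurable g)
    (z : Fin d → ℤ) : ∫⁻ ω, g (V z ω) ∂μ = ∫⁻ ω, g (V 0 ω) ∂μ :=
  ((hV.ident z).comp hg).lintegral_eq

lemma lintegral_prod [IsProbabilityMeasure μ] (hV : IsIIDField μ V) (s : Finset (Fin d → ℤ))
    {g : (Fin d → ℤ) → ℝ≥0∞ → ℝ≥0∞} (hg : ∀ z, Measurable (g z)) :
    ∫⁻ ω, ∏ z ∈ s, g z (V z ω) ∂μ = ∏ z ∈ s, ∫⁻ ω, g z (V 0 ω) ∂μ := by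
  classical
  induction s using Finset.induction_on with
  | empty => simp
  | insert a s ha ih =>
    simp only [Finset.prod_insert ha]
    rw [← ih, ← hV.lintegral_comp (hg a) a]
    refine hV.lintegral_mul (S := {a}) (T := s) (by simpa using ha)
      ((hg a).comp (measurable_sitesAlgebra rfl)) ?_
    exact Finset.measurable_fun_prod _ fun z hz =>
      (hg z).comp (measurable_sitesAlgebra (Finset.mem_coe.2 hz))

/-- The law of the field is invariant under translations. -/
lemma lintegral_shift [IsProbabilityMeasure μ] (hV : IsIIDField μ V)
    {Φ : ((Fin d → ℤ) → ℝ≥0∞) → ℝ≥0∞} (hΦ : Measurable Φ) (x : Fin d → ℤ) :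
    ∫⁻ ω, Φ (fun z => V (x + z) ω) ∂μ = ∫⁻ ω, Φ (fun z => V z ω) ∂μ := by
  have hind : iIndepFun (fun z => V (x + z)) μ := hV.indep.precomp (add_right_injective x)
  have h1 := hV.indep.map_fun_eq_infinitePi_map hV.meas
  have h2 := hind.map_fun_eq_infinitePi_map fun z => hV.meas _
  have h3 : (fun z => μ.map (V (x + z))) = fun z => μ.map (V z) := by
    ext1 z
    rw [(hV.ident (x + z)).map_eq, (hV.ident z).map_eq]
  rw [← lintegral_map hΦ (measurable_pi_lambda _ fun z => hV.meas (x + z)),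
    ← lintegral_map hΦ (measurable_pi_lambda _ fun z => hV.meas z), h1, h2, h3]

end IsIIDField

end Field

/-! ### The ℓ¹ distance and direct paths without repeated sites -/

section Distance

/-- The `ℓ¹` distance on `ℤ^d`. -/
def latticeDist (a b : Fin d → ℤ) : ℕ := ∑ i, (a i - b i).natAbs

lemma latticeDist_self (a : Fin d → ℤ) : latticeDist a a = 0 := by simp [latticeDist]

lemma eq_of_latticeDist_eq_zero {a b : Fin d → ℤ} (h : latticeDist a b = 0) : a = b := by
  ext i
  have := (Finset.sum_eq_zero_iff.1 h) i (Finset.mem_univ i)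
  omega

lemma unitStep_apply_self (p : Fin d × Bool) : unitStep p p.1 = if p.2 then 1 else -1 := by
  unfold unitStep; split_ifs <;> simp

lemma unitStep_apply_of_ne {p : Fin d × Bool} {i : Fin d} (h : i ≠ p.1) : unitStep p i = 0 := by
  unfold unitStep; split_ifs <;> simp [h]

/-- Some neighbour of `a ≠ b` is closer to `b`, and lies between `a` and `b`. -/
lemma exists_unitStep_closer {a b : Fin d → ℤ} (h : a ≠ b) :
    ∃ p : Fin d × Bool, latticeDist (a + unitStep p) b + 1 = latticeDist a b ∧
      a ⊓ b ≤ a + unitStep p ∧ a + unitStep p ≤ a ⊔ b := by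
  obtain ⟨i, hi⟩ := Function.ne_iff.1 h
  refine ⟨(i, decide (a i < b i)), ?_, ?_, ?_⟩
  · unfold latticeDist
    rw [← Finset.add_sum_erase _ _ (Finset.mem_univ i),
      ← Finset.add_sum_erase Finset.univ (fun j => (a j - b j).natAbs) (Finset.mem_univ i)]
    have h1 : ∑ j ∈ Finset.univ.erase i,
        ((a + unitStep (i, decide (a i < b i))) j - b j).natAbs =
        ∑ j ∈ Finset.univ.erase i, (a j - b j).natAbs := by
      refine Finset.sum_congr rfl fun j hj => ?_
      rw [Pi.add_apply, unitStep_apply_of_ne (Finset.ne_of_mem_erase hj), add_zero]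
    rw [h1, Pi.add_apply, unitStep_apply_self (i, decide (a i < b i))]
    rcases lt_or_gt_of_ne hi with h | h
    · simp only [h, decide_true, if_true]; omega
    · simp only [not_lt.2 h.le, decide_false, Bool.false_eq_true, if_false]; omega
  · intro j
    by_cases hj : j = i
    · subst hj
      rw [Pi.add_apply, unitStep_apply_self (j, decide (a j < b j)), Pi.inf_apply]
      rcases lt_or_gt_of_ne hi with h | h
      · simp only [h, decide_true, if_true]; exact inf_le_left.trans (by omega)
      · simp only [not_lt.2 h.le, decide_false, Bool.false_eq_true, if_false]
        exact inf_le_right.trans (by omega)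
    · rw [Pi.add_apply, unitStep_apply_of_ne hj, add_zero]; exact inf_le_left
  · intro j
    by_cases hj : j = i
    · subst hj
      rw [Pi.add_apply, unitStep_apply_self (j, decide (a j < b j)), Pi.sup_apply]
      rcases lt_or_gt_of_ne hi with h | h
      · simp only [h, decide_true, if_true]; exact le_trans (by omega) le_sup_right
      · simp only [not_lt.2 h.le, decide_false, Bool.false_eq_true, if_false]
        exact le_trans (by omega) le_sup_left
    · rw [Pi.add_apply, unitStep_apply_of_ne hj, add_zero]; exact le_sup_left

lemma two_mul_inv_le_one [NeZero d] : (2 * d : ℝ≥0∞)⁻¹ ≤ 1 := by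
  rw [ENNReal.inv_le_one]
  have : 1 ≤ 2 * d := by have := NeZero.pos d; omega
  exact_mod_cast this

/-- A direct path from `a` to `b` inside a box, without repeated sites. -/
lemma exists_path_le_green [NeZero d] {l u : Fin d → ℤ} {b : Fin d → ℤ} (hb : b ∈ Set.Icc l u)
    {a : Fin d → ℤ} (ha : a ∈ Set.Icc l u) :
    ∃ P : Finset (Fin d → ℤ), P.card = latticeDist a b + 1 ∧
      (∀ x ∈ P, latticeDist x b ≤ latticeDist a b) ∧
      ∀ v : (Fin d → ℤ) → ℝ≥0∞, ∏ x ∈ P, ((2 * d : ℝ≥0∞)⁻¹ * expNeg (v x)) ≤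
        green (Set.Icc l u \ {b}) v (Pi.single b 1) a * expNeg (v b) := by
  induction hn : latticeDist a b generalizing a with
  | zero =>
    obtain rfl := eq_of_latticeDist_eq_zero hn
    refine ⟨{a}, by simp, by simp [latticeDist_self], fun v => ?_⟩
    rw [Finset.prod_singleton, green_of_notMem (by simp), Pi.single_eq_same]
    gcongr
    -- The product carries one (2d)⁻¹ per site, hence one more than there are steps; the surplus
    -- factor is discarded here.
    exact two_mul_inv_le_one
  | succ n ih =>
    have hab : a ≠ b := fun h => by subst h; simp [latticeDist_self] at hn
    obtain ⟨p, hp, hp1, hp2⟩ := exists_unitStep_closer hab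
    have ha' : a + unitStep p ∈ Set.Icc l u :=
      ⟨(le_inf ha.1 hb.1).trans hp1, hp2.trans (sup_le ha.2 hb.2)⟩
    obtain ⟨P, hP1, hP2, hP3⟩ := ih ha' (by omega)
    -- The remaining sites are strictly closer to b, so the path never repeats a site. This keeps
    -- the product over P a product of independent factors.
    have haP : a ∉ P := fun h => by have := hP2 a h; omega
    refine ⟨insert a P, by rw [Finset.card_insert_of_notMem haP]; omega, ?_, fun v => ?_⟩
    · intro x hx
      rcases Finset.mem_insert.1 hx with rfl | hx
      · omega
      · exact (hP2 x hx).trans (by omega)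
    · rw [Finset.prod_insert haP, green_eq, Pi.single_eq_of_ne hab, zero_add,
        killedStep_of_mem (A := Set.Icc l u \ {b}) ⟨ha, hab⟩]
      calc _ ≤ (2 * d : ℝ≥0∞)⁻¹ * expNeg (v a) *
            (green (Set.Icc l u \ {b}) v (Pi.single b 1) (a + unitStep p) * expNeg (v b)) := by
            gcongr; exact hP3 v
        _ = expNeg (v a) * ((2 * d : ℝ≥0∞)⁻¹ *
            green (Set.Icc l u \ {b}) v (Pi.single b 1) (a + unitStep p)) * expNeg (v b) := by ring
        _ ≤ _ := by gcongr; exact le_nbrAvg _ a p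

end Distance

/-! ### Hitting weights: superharmonicity, concatenation and translation -/

section Hit

variable {v : (Fin d → ℤ) → ℝ≥0∞}

lemma single_le_one (b x : Fin d → ℤ) : (Pi.single b 1 : (Fin d → ℤ) → ℝ≥0∞) x ≤ 1 := by
  by_cases h : x = b
  · subst h; simp
  · simp [Pi.single_eq_of_ne h]

lemma hit_le_one [NeZero d] {A : Set (Fin d → ℤ)} {b : Fin d → ℤ} (hb : b ∉ A) (x : Fin d → ℤ) :
    green A v (Pi.single b 1) x ≤ 1 :=
  green_le_one (fun _ hx => Pi.single_eq_of_ne (ne_of_mem_of_not_mem hx hb) _) (single_le_one b) x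

lemma hit_self {A : Set (Fin d → ℤ)} {b : Fin d → ℤ} (hb : b ∉ A) :
    green A v (Pi.single b 1) b = 1 := by
  rw [green_of_notMem hb, Pi.single_eq_same]

/-- The hitting weight of `y` is superharmonic everywhere. -/
lemma hit_superharmonic [NeZero d] (y x : Fin d → ℤ) :
    expNeg (v x) * nbrAvg (green {y}ᶜ v (Pi.single y 1)) x ≤ green {y}ᶜ v (Pi.single y 1) x := by
  by_cases hx : x = y
  · subst hx
    rw [hit_self (by simp)]
    calc _ ≤ 1 * nbrAvg (fun _ => 1) x := by
          gcongr
          · exact expNeg_le_one _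
          · exact nbrAvg_mono (hit_le_one (by simp)) x
      _ = 1 := by rw [nbrAvg_const, one_mul]
  · conv_rhs => rw [green_eq, killedStep_of_mem (by simpa using hx)]
    exact le_add_self

/-- Concatenation of paths: going to b through A and collecting u there never exceeds u, since u is
superharmonic on A. For u the weight of hitting y this is the strong Markov inequality. -/
lemma hit_mul_le {A : Set (Fin d → ℤ)} {b : Fin d → ℤ} (hb : b ∉ A)
    {u : (Fin d → ℤ) → ℝ≥0∞} (hu : ∀ x ∈ A, expNeg (v x) * nbrAvg u x ≤ u x) (x : Fin d → ℤ) :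
    green A v (Pi.single b 1) x * u b ≤ u x := by
  rw [mul_comm, ← green_const_mul]
  refine green_le_of_superharmonic (fun x hx => ?_) (fun x _ => ?_) hu x
  · rw [Pi.single_eq_of_ne (ne_of_mem_of_not_mem hx hb), mul_zero]
  · by_cases h : x = b
    · subst h; simp
    · simp [Pi.single_eq_of_ne h]

lemma killedStep_iterate_shift (x y : Fin d → ℤ) (n : ℕ) (z : Fin d → ℤ) :
    (killedStep {x + y}ᶜ v)^[n] (Pi.single (x + y) 1) (x + z) =
      (killedStep {y}ᶜ fun z => v (x + z))^[n] (Pi.single y 1) z := by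
  induction n generalizing z with
  | zero =>
    by_cases h : z = y
    · subst h; simp
    · have h' : x + z ≠ x + y := fun h' => h (add_left_cancel h')
      simp [Pi.single_eq_of_ne h, Pi.single_eq_of_ne h']
  | succ n ih =>
    rw [Function.iterate_succ_apply', Function.iterate_succ_apply']
    by_cases h : z = y
    · subst h; rw [killedStep_of_notMem (by simp), killedStep_of_notMem (by simp)]
    · rw [killedStep_of_mem (by simpa using h), killedStep_of_mem (by simpa using h)]
      simp only [nbrAvg, add_assoc, ih]

lemma green_shift (x y z : Fin d → ℤ) :
    green {x + y}ᶜ v (Pi.single (x + y) 1) (x + z) =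
      green {y}ᶜ (fun z => v (x + z)) (Pi.single y 1) z := by
  simp only [green, killedStep_iterate_shift]

end Hit

/-! ### Positive correlation of Green functions -/

section Correlation

variable {Ω : Type*} [MeasurableSpace Ω] {μ : Measure Ω} {V : (Fin d → ℤ) → Ω → ℝ≥0∞}

/-- Chebyshev's association inequality: the two powers are increasing in the same variable, so
symmetrizing with an independent copy reduces the claim to a pointwise rearrangement inequality. -/
lemma lintegral_pow_mul_le [IsProbabilityMeasure μ] {W : Ω → ℝ≥0∞} (hW : Measurable W)
    (m n : ℕ) :
    (∫⁻ ω, W ω ^ m ∂μ) * ∫⁻ ω, W ω ^ n ∂μ ≤ ∫⁻ ω, W ω ^ (m + n) ∂μ := by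
  have key : ∀ a b : ℝ≥0∞, a ^ m * b ^ n + b ^ m * a ^ n ≤ a ^ (m + n) + b ^ (m + n) := by
    intro a b
    wlog hab : a ≤ b generalizing a b
    · rw [add_comm, add_comm (a ^ (m + n))]; exact this b a (le_of_not_ge hab)
    obtain ⟨c, hc⟩ := exists_add_of_le (pow_le_pow_left₀ (zero_le) hab m)
    obtain ⟨e, he⟩ := exists_add_of_le (pow_le_pow_left₀ (zero_le) hab n)
    rw [pow_add, pow_add, hc, he]
    calc _ = a ^ m * a ^ n + (a ^ m + c) * a ^ n + a ^ m * e := by ring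
      _ ≤ a ^ m * a ^ n + (a ^ m + c) * a ^ n + (a ^ m + c) * e := by
        gcongr; exact le_self_add
      _ = _ := by ring
  have hm : Measurable fun ω => W ω ^ m := hW.pow_const m
  have hn : Measurable fun ω => W ω ^ n := hW.pow_const n
  have hmn : Measurable fun ω => W ω ^ (m + n) := hW.pow_const _
  have h2 : 2 * ((∫⁻ ω, W ω ^ m ∂μ) * ∫⁻ ω, W ω ^ n ∂μ) ≤ 2 * ∫⁻ ω, W ω ^ (m + n) ∂μ := by
    calc _ = ∫⁻ ω, ∫⁻ ω', (W ω ^ m * W ω' ^ n + W ω' ^ m * W ω ^ n) ∂μ ∂μ := by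
          simp only [lintegral_add_left (hn.const_mul _), lintegral_const_mul _ hn,
            lintegral_mul_const _ hm]
          rw [lintegral_add_left (hm.mul_const _), lintegral_mul_const _ hm,
            lintegral_const_mul _ hn, two_mul]
      _ ≤ ∫⁻ ω, ∫⁻ ω', (W ω ^ (m + n) + W ω' ^ (m + n)) ∂μ ∂μ :=
          lintegral_mono fun ω => lintegral_mono fun ω' => key _ _
      _ = _ := by
          simp only [lintegral_add_left measurable_const, lintegral_const, measure_univ, mul_one]
          rw [lintegral_add_left hmn, lintegral_const, measure_univ, mul_one, two_mul]
  rwa [ENNReal.mul_le_mul_iff_right (by simp) (by simp)] at h2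

/-- A monomial in the variables `exp (-V(z))`. -/
def expMonomial (n : (Fin d → ℤ) →₀ ℕ) (v : (Fin d → ℤ) → ℝ≥0∞) : ℝ≥0∞ :=
  n.prod fun z k => expNeg (v z) ^ k

lemma expMonomial_add (m n : (Fin d → ℤ) →₀ ℕ) (v : (Fin d → ℤ) → ℝ≥0∞) :
    expMonomial (m + n) v = expMonomial m v * expMonomial n v :=
  Finsupp.prod_add_index' (fun _ => pow_zero _) fun _ _ _ => pow_add _ _ _

lemma expMonomial_single (x : Fin d → ℤ) (v : (Fin d → ℤ) → ℝ≥0∞) :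
    expMonomial (Finsupp.single x 1) v = expNeg (v x) := by
  simp [expMonomial]

lemma measurable_expMonomial (hV : ∀ z, Measurable (V z)) (n : (Fin d → ℤ) →₀ ℕ) :
    Measurable fun ω => expMonomial n fun z => V z ω :=
  Finset.measurable_fun_prod _ fun z _ => (measurable_expNeg.comp (hV z)).pow_const _

/-- By independence all three integrals factor over the sites, where the one-variable inequality
applies. -/
lemma lintegral_expMonomial_mul_le [IsProbabilityMeasure μ] (hV : IsIIDField μ V)
    (m n : (Fin d → ℤ) →₀ ℕ) :
    (∫⁻ ω, expMonomial m (fun z => V z ω) ∂μ) * ∫⁻ ω, expMonomial n (fun z => V z ω) ∂μ ≤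
      ∫⁻ ω, expMonomial (m + n) (fun z => V z ω) ∂μ := by
  classical
  have h : ∀ k : (Fin d → ℤ) →₀ ℕ, k.support ⊆ m.support ∪ n.support →
      ∫⁻ ω, expMonomial k (fun z => V z ω) ∂μ =
        ∏ z ∈ m.support ∪ n.support, ∫⁻ ω, expNeg (V 0 ω) ^ k z ∂μ := by
    intro k hk
    rw [← hV.lintegral_prod _ (g := fun z a => expNeg a ^ k z)
      fun z => measurable_expNeg.pow_const _]
    refine lintegral_congr fun ω => ?_
    exact Finsupp.prod_of_support_subset _ hk _ fun _ _ => pow_zero _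
  rw [h m Finset.subset_union_left, h n Finset.subset_union_right, h _ Finsupp.support_add,
    ← Finset.prod_mul_distrib]
  refine Finset.prod_le_prod' fun z _ => ?_
  exact lintegral_pow_mul_le (measurable_expNeg.comp (hV.meas 0)) _ _

/-- Induction principle for the Green functions as functions of the potential. -/
lemma green_induction {P : (((Fin d → ℤ) → ℝ≥0∞) → ℝ≥0∞) → Prop} (hone : P fun _ => 1)
    (hsmul : ∀ (c : ℝ≥0∞) F, P F → P fun v => c * F v)
    (hmul : ∀ x F, P F → P fun v => expNeg (v x) * F v)
    (htsum : ∀ F : ℕ → ((Fin d → ℤ) → ℝ≥0∞) → ℝ≥0∞, (∀ i, P (F i)) → P fun v => ∑' i, F i v)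
    (A : Set (Fin d → ℤ)) (f : (Fin d → ℤ) → ℝ≥0∞) (x : Fin d → ℤ) :
    P fun v => green A v f x := by
  have hzero : P fun _ => 0 := by simpa using hsmul 0 _ hone
  have hsum : ∀ (s : Finset (Fin d × Bool)) (F : Fin d × Bool → ((Fin d → ℤ) → ℝ≥0∞) → ℝ≥0∞),
      (∀ i, P (F i)) → P fun v => ∑ i ∈ s, F i v := by
    intro s F hF
    classical
    induction s using Finset.induction_on with
    | empty => simpa using hzero
    | insert a s ha ih =>
      -- A sum of two functionals is presented to `htsum` as a series whose only nonzero terms are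
      -- those of index 0 and 1.
      have := htsum (fun i v => if i = 0 then F a v else if i = 1 then ∑ i ∈ s, F i v else 0) ?_
      · convert this using 1
        ext v
        rw [Finset.sum_insert ha, tsum_eq_sum (s := {0, 1}) (by simp +contextual)]
        simp
      · intro i
        by_cases h0 : i = 0
        · simpa [h0] using hF a
        · by_cases h1 : i = 1
          · simpa [h1] using ih
          · simpa [h0, h1] using hzero
  refine htsum _ fun n => ?_
  induction n generalizing x with
  | zero => simpa using hsmul (f x) _ hone
  | succ n ih =>
    simp only [Function.iterate_succ_apply']
    by_cases hx : x ∈ A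
    · simp only [killedStep_of_mem hx]
      exact hmul x _ (hsum _ _ fun p => hsmul _ _ (ih _))
    · simpa only [killedStep_of_notMem hx] using hzero

lemma lintegral_green_mul_expMonomial_le [IsProbabilityMeasure μ] (hV : IsIIDField μ V)
    (A : Set (Fin d → ℤ)) (f : (Fin d → ℤ) → ℝ≥0∞) (x : Fin d → ℤ) (n : (Fin d → ℤ) →₀ ℕ) :
    (∫⁻ ω, green A (fun z => V z ω) f x ∂μ) * ∫⁻ ω, expMonomial n (fun z => V z ω) ∂μ ≤
      ∫⁻ ω, green A (fun z => V z ω) f x * expMonomial n (fun z => V z ω) ∂μ := by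
  -- Quantifying over an extra monomial m makes the predicate stable under multiplication by
  -- exp(-V(x)): the new factor is absorbed into m.
  let P : (((Fin d → ℤ) → ℝ≥0∞) → ℝ≥0∞) → Prop := fun F =>
    Measurable (fun ω => F fun z => V z ω) ∧ ∀ m : (Fin d → ℤ) →₀ ℕ,
      (∫⁻ ω, F (fun z => V z ω) * expMonomial m (fun z => V z ω) ∂μ) *
        ∫⁻ ω, expMonomial n (fun z => V z ω) ∂μ ≤
      ∫⁻ ω, F (fun z => V z ω) * expMonomial m (fun z => V z ω) *
        expMonomial n (fun z => V z ω) ∂μ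
  have hM := measurable_expMonomial hV.meas
  have hP : P fun v => green A v f x := by
    refine green_induction ?_ ?_ ?_ ?_ A f x
    · refine ⟨measurable_const, fun m => ?_⟩
      simpa [expMonomial_add] using lintegral_expMonomial_mul_le hV m n
    · rintro c F ⟨hF, h⟩
      refine ⟨hF.const_mul c, fun m => ?_⟩
      have h1 : Measurable fun ω => F (fun z => V z ω) * expMonomial m (fun z => V z ω) :=
        hF.mul (hM m)
      have h2 : Measurable fun ω => F (fun z => V z ω) * expMonomial m (fun z => V z ω) *
        expMonomial n (fun z => V z ω) := h1.mul (hM n)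
      simp only [mul_assoc c]
      rw [lintegral_const_mul _ h1, lintegral_const_mul _ h2, mul_assoc]
      gcongr
      exact h m
    · rintro y F ⟨hF, h⟩
      refine ⟨(measurable_expNeg.comp (hV.meas y)).mul hF, fun m => ?_⟩
      have := h (Finsupp.single y 1 + m)
      simp only [expMonomial_add, expMonomial_single] at this
      convert this using 3
      · ext ω; ring
      · ring
    · intro F hF
      refine ⟨Measurable.tsum fun i => (hF i).1, fun m => ?_⟩
      have h1 : ∀ i, Measurable fun ω => F i (fun z => V z ω) * expMonomial m (fun z => V z ω) :=
        fun i => (hF i).1.mul (hM m)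
      have h2 : ∀ i, Measurable fun ω => F i (fun z => V z ω) * expMonomial m (fun z => V z ω) *
        expMonomial n (fun z => V z ω) := fun i => (h1 i).mul (hM n)
      simp only [← ENNReal.tsum_mul_right]
      rw [lintegral_tsum fun i => (h1 i).aemeasurable,
        lintegral_tsum fun i => (h2 i).aemeasurable, ← ENNReal.tsum_mul_right]
      exact ENNReal.tsum_le_tsum fun i => (hF i).2 m
  simpa [expMonomial] using hP.2 0

/-- Green functions, being sums of monomials in `exp (-V)`, are positively correlated. -/
lemma lintegral_green_mul_green_le [IsProbabilityMeasure μ] (hV : IsIIDField μ V)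
    (A B : Set (Fin d → ℤ)) (f g : (Fin d → ℤ) → ℝ≥0∞) (x y : Fin d → ℤ) :
    (∫⁻ ω, green A (fun z => V z ω) f x ∂μ) * ∫⁻ ω, green B (fun z => V z ω) g y ∂μ ≤
      ∫⁻ ω, green A (fun z => V z ω) f x * green B (fun z => V z ω) g y ∂μ := by
  have hG : Measurable fun ω => green A (fun z => V z ω) f x :=
    measurable_green (fun z _ => hV.meas z) f x
  -- The same induction in the second Green function, started from
  -- `lintegral_green_mul_expMonomial_le`.
  let P : (((Fin d → ℤ) → ℝ≥0∞) → ℝ≥0∞) → Prop := fun F =>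
    Measurable (fun ω => F fun z => V z ω) ∧ ∀ m : (Fin d → ℤ) →₀ ℕ,
      (∫⁻ ω, green A (fun z => V z ω) f x ∂μ) *
        (∫⁻ ω, F (fun z => V z ω) * expMonomial m (fun z => V z ω) ∂μ) ≤
      ∫⁻ ω, green A (fun z => V z ω) f x *
        (F (fun z => V z ω) * expMonomial m (fun z => V z ω)) ∂μ
  have hM := measurable_expMonomial hV.meas
  have hP : P fun v => green B v g y := by
    refine green_induction ?_ ?_ ?_ ?_ B g y
    · refine ⟨measurable_const, fun m => ?_⟩
      simpa using lintegral_green_mul_expMonomial_le hV A f x m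
    · rintro c F ⟨hF, h⟩
      refine ⟨hF.const_mul c, fun m => ?_⟩
      have h1 : Measurable fun ω => F (fun z => V z ω) * expMonomial m (fun z => V z ω) :=
        hF.mul (hM m)
      have h2 : Measurable fun ω => green A (fun z => V z ω) f x *
        (F (fun z => V z ω) * expMonomial m (fun z => V z ω)) := hG.mul h1
      simp only [mul_assoc c, mul_left_comm _ c]
      rw [lintegral_const_mul _ h1, lintegral_const_mul _ h2, mul_left_comm]
      gcongr
      exact h m
    · rintro y F ⟨hF, h⟩
      refine ⟨(measurable_expNeg.comp (hV.meas y)).mul hF, fun m => ?_⟩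
      have := h (Finsupp.single y 1 + m)
      simp only [expMonomial_add, expMonomial_single] at this
      convert this using 3
      · ext ω; ring
      · ring
    · intro F hF
      refine ⟨Measurable.tsum fun i => (hF i).1, fun m => ?_⟩
      have h1 : ∀ i, Measurable fun ω => F i (fun z => V z ω) * expMonomial m (fun z => V z ω) :=
        fun i => (hF i).1.mul (hM m)
      have h2 : ∀ i, Measurable fun ω => green A (fun z => V z ω) f x *
        (F i (fun z => V z ω) * expMonomial m (fun z => V z ω)) := fun i => hG.mul (h1 i)
      simp only [← ENNReal.tsum_mul_right, ← ENNReal.tsum_mul_left]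
      rw [lintegral_tsum fun i => (h1 i).aemeasurable,
        lintegral_tsum fun i => (h2 i).aemeasurable, ← ENNReal.tsum_mul_left]
      exact ENNReal.tsum_le_tsum fun i => (hF i).2 m
  simpa [expMonomial] using hP.2 0

end Correlation

/-! ### Supermultiplicativity and lower bound of the annealed partition function -/

section Supermultiplicative

variable [NeZero d] {Ω : Type*} [MeasurableSpace Ω] {μ : Measure Ω} [IsProbabilityMeasure μ]
  {V : (Fin d → ℤ) → Ω → ℝ≥0∞}

/-- By translation invariance the second factor is the weight from x to x + y in the same
environment. Positive correlation merges the two expectations, and the paths are concatenated at x.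
-/
lemma annealedZ_mul_le (hV : IsIIDField μ V) (x y : Fin d → ℤ) :
    annealedZ μ V 0 x * annealedZ μ V 0 y ≤ annealedZ μ V 0 (x + y) := by
  have hshift : annealedZ μ V 0 y =
      ∫⁻ ω, green {x + y}ᶜ (fun z => V z ω) (Pi.single (x + y) 1) x ∂μ := by
    have hΦ : Measurable fun v : (Fin d → ℤ) → ℝ≥0∞ => green {y}ᶜ v (Pi.single y 1) 0 :=
      measurable_green (V := fun z (v : (Fin d → ℤ) → ℝ≥0∞) => v z)
        (fun z _ => measurable_pi_apply z) (Pi.single y 1) 0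
    rw [annealedZ_eq_lintegral_green, ← hV.lintegral_shift hΦ x]
    refine lintegral_congr fun ω => ?_
    rw [← green_shift (v := fun z => V z ω) x y 0, add_zero]
  rw [hshift, annealedZ_eq_lintegral_green, annealedZ_eq_lintegral_green]
  refine (lintegral_green_mul_green_le hV _ _ _ _ _ _).trans (lintegral_mono fun ω => ?_)
  exact hit_mul_le (by simp) (fun z _ => hit_superharmonic _ _) 0

lemma annealedZ_le_one (x y : Fin d → ℤ) : annealedZ μ V x y ≤ 1 := by
  rw [annealedZ_eq_lintegral_green]
  calc _ ≤ ∫⁻ _, 1 ∂μ := lintegral_mono fun ω => hit_le_one (by simp) x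
    _ = 1 := by simp

/-- The direct path visits distinct sites, so its averaged weight is a product of single-site means.
The factor exp(-V b) is included because `exitWeight` omits it. -/
lemma pow_le_lintegral_green (hV : IsIIDField μ V) {l u a b : Fin d → ℤ}
    (ha : a ∈ Set.Icc l u) (hb : b ∈ Set.Icc l u) :
    ((2 * d : ℝ≥0∞)⁻¹ * meanExp μ V) ^ (latticeDist a b + 1) ≤
      ∫⁻ ω, green (Set.Icc l u \ {b}) (fun z => V z ω) (Pi.single b 1) a * expNeg (V b ω) ∂μ := by
  obtain ⟨P, hP1, -, hP3⟩ := exists_path_le_green hb ha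
  refine le_trans ?_ (lintegral_mono fun ω => hP3 fun z => V z ω)
  have hm : Measurable fun ω => expNeg (V 0 ω) := measurable_expNeg.comp (hV.meas 0)
  rw [hV.lintegral_prod P (g := fun _ a => (2 * d : ℝ≥0∞)⁻¹ * expNeg a)
    fun _ => measurable_expNeg.const_mul _, lintegral_const_mul _ hm, Finset.prod_const, hP1]
  rfl

lemma pow_le_annealedZ (hV : IsIIDField μ V) (y : Fin d → ℤ) :
    ((2 * d : ℝ≥0∞)⁻¹ * meanExp μ V) ^ (latticeDist 0 y + 1) ≤ annealedZ μ V 0 y := by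
  rw [annealedZ_eq_lintegral_green]
  refine (pow_le_lintegral_green hV (l := 0 ⊓ y) (u := 0 ⊔ y) ⟨inf_le_left, le_sup_left⟩
    ⟨inf_le_right, le_sup_right⟩).trans (lintegral_mono fun ω => ?_)
  refine (mul_le_of_le_one_right (zero_le) (expNeg_le_one _)).trans
    (green_mono_set (fun z hz => hz.2) 0)

end Supermultiplicative

/-! ### Existence of the Lyapunov exponents -/

section Lyapunov

lemma latticeDist_zero_le {e : Fin d → ℤ} {N : ℕ} (h : ∀ i, (e i).natAbs ≤ N) :
    latticeDist 0 e ≤ d * N := by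
  unfold latticeDist
  calc _ ≤ ∑ _i : Fin d, N := Finset.sum_le_sum fun i _ => by simpa using h i
    _ = d * N := by simp

/-- Fekete's lemma along the ray. The integer part is additive only up to a vector with entries of
size at most 1, so a constant dominating g on such vectors is added to restore subadditivity. -/
lemma tendsto_subadditive_intPart_div {g : (Fin d → ℤ) → ℝ} {K : ℝ} (hK : 0 ≤ K)
    (hg0 : ∀ x, 0 ≤ g x) (hgadd : ∀ x y, g (x + y) ≤ g x + g y)
    (hgle : ∀ x, g x ≤ K * (latticeDist 0 x + 1)) (h : EuclideanSpace ℝ (Fin d)) :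
    ∃ L, Tendsto (fun r : ℝ => g (intPart (r • h)) / r) atTop (𝓝 L) := by
  have hbd : ∀ (N : ℕ) (e : Fin d → ℤ), (∀ i, (e i).natAbs ≤ N) → g e ≤ K * (d * N + 1) := by
    intro N e he
    refine (hgle e).trans (mul_le_mul_of_nonneg_left ?_ hK)
    have := latticeDist_zero_le he
    have : (latticeDist 0 e : ℝ) ≤ ((d * N : ℕ) : ℝ) := by exact_mod_cast this
    push_cast at this
    linarith
  set u : ℕ → ℝ := fun n => g (intPart ((n : ℝ) • h)) + K * (d * (1 : ℕ) + 1) with hu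
  have hu0 : ∀ n, 0 ≤ u n := fun n => add_nonneg (hg0 _) (by positivity)
  have hsub : Subadditive u := by
    intro m n
    set e := intPart (((m + n : ℕ) : ℝ) • h) - intPart ((m : ℝ) • h) - intPart ((n : ℝ) • h)
    have he : ∀ i, (e i).natAbs ≤ 1 := by
      intro i
      simp only [e, Pi.sub_apply, intPart, PiLp.smul_apply, smul_eq_mul, Nat.cast_add, add_mul]
      have h1 := Int.le_floor_add ((m : ℝ) * h i) ((n : ℝ) * h i)
      have h2 := Int.le_floor_add_floor ((m : ℝ) * h i) ((n : ℝ) * h i)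
      omega
    have hsum : intPart (((m + n : ℕ) : ℝ) • h) =
        intPart ((m : ℝ) • h) + intPart ((n : ℝ) • h) + e := by simp only [e]; abel
    have h1 := hgadd (intPart ((m : ℝ) • h) + intPart ((n : ℝ) • h)) e
    have h2 := hgadd (intPart ((m : ℝ) • h)) (intPart ((n : ℝ) • h))
    have h3 := hbd 1 e he
    simp only [hu]
    rw [hsum]
    linarith
  have hlim := hsub.tendsto_lim ⟨0, by
    rintro _ ⟨n, rfl⟩; exact div_nonneg (hu0 n) (Nat.cast_nonneg n)⟩
  refine ⟨hsub.lim, ?_⟩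
  obtain ⟨N, hN⟩ := exists_nat_ge (∑ i, |h i| + 1)
  have hNi : ∀ i, |h i| + 1 ≤ N := fun i => by
    have := Finset.single_le_sum (f := fun i => |h i|) (fun i _ => abs_nonneg _)
      (Finset.mem_univ i)
    linarith
  set M : ℝ := K * (d * N + 1) + K * (d * (1 : ℕ) + 1) with hM
  -- Replacing r by its integer part moves the lattice point by a bounded vector e; subadditivity
  -- with e and with -e bounds the change of g.
  have hdiff : ∀ r : ℝ, 0 ≤ r → |g (intPart (r • h)) - u ⌊r⌋₊| ≤ M := by
    intro r hr
    set e := intPart (r • h) - intPart (((⌊r⌋₊ : ℕ) : ℝ) • h) with he_def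
    have hei : ∀ i, |(e i : ℝ)| ≤ N := by
      intro i
      have hfr : |r - (⌊r⌋₊ : ℝ)| ≤ 1 := by
        rw [abs_le]
        constructor
        · linarith [Nat.floor_le hr]
        · linarith [Nat.lt_floor_add_one r]
      have hprod : |r * h i - (⌊r⌋₊ : ℝ) * h i| ≤ |h i| := by
        rw [← sub_mul, abs_mul]
        exact mul_le_of_le_one_left (abs_nonneg _) hfr
      simp only [e, Pi.sub_apply, intPart, PiLp.smul_apply, smul_eq_mul, Int.cast_sub]
      have h1 := Int.floor_le (r * h i)
      have h2 := Int.lt_floor_add_one (r * h i)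
      have h3 := Int.floor_le ((⌊r⌋₊ : ℝ) * h i)
      have h4 := Int.lt_floor_add_one ((⌊r⌋₊ : ℝ) * h i)
      have h5 := hNi i
      rw [abs_le] at hprod ⊢
      constructor <;> linarith [hprod.1, hprod.2]
    have he : ∀ i, (e i).natAbs ≤ N := by
      intro i
      have h1 := hei i
      rw [← Int.cast_abs, Int.abs_eq_natAbs] at h1
      exact_mod_cast h1
    have he' : ∀ i, ((-e) i).natAbs ≤ N := by
      intro i; rw [Pi.neg_apply, Int.natAbs_neg]; exact he i
    have h1 := hgadd (intPart (((⌊r⌋₊ : ℕ) : ℝ) • h)) e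
    have h2 := hgadd (intPart (r • h)) (-e)
    rw [show intPart (((⌊r⌋₊ : ℕ) : ℝ) • h) + e = intPart (r • h) by simp [e]] at h1
    rw [show intPart (r • h) + -e = intPart (((⌊r⌋₊ : ℕ) : ℝ) • h) by simp [e]] at h2
    have h3 := hbd N e he
    have h4 := hbd N (-e) he'
    have h5 : 0 ≤ K * (d * (1 : ℕ) + 1) := by positivity
    simp only [hu, hM]
    rw [abs_le]
    constructor <;> linarith
  have hfloor := (hlim.comp (tendsto_nat_floor_atTop (α := ℝ))).mul
    (tendsto_nat_floor_div_atTop (R := ℝ))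
  rw [mul_one] at hfloor
  have herr : Tendsto (fun r : ℝ => (g (intPart (r • h)) - u ⌊r⌋₊) / r) atTop (𝓝 0) := by
    refine squeeze_zero_norm' (a := fun r : ℝ => M / r) ?_ (tendsto_const_nhds.div_atTop tendsto_id)
    filter_upwards [eventually_gt_atTop 0] with r hr
    rw [Real.norm_eq_abs, abs_div, abs_of_pos hr]
    gcongr
    exact hdiff r hr.le
  have := hfloor.add herr
  rw [add_zero] at this
  refine this.congr' ?_
  filter_upwards [eventually_ge_atTop 1] with r hr
  have hn : (⌊r⌋₊ : ℝ) ≠ 0 := by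
    have := Nat.floor_pos.2 hr
    positivity
  have hr0 : r ≠ 0 := by positivity
  simp only [Function.comp]
  field_simp
  ring

variable {Ω : Type*} [MeasurableSpace Ω] {μ : Measure Ω} {V : (Fin d → ℤ) → Ω → ℝ≥0∞}

lemma meanExp_le_one [IsProbabilityMeasure μ] : meanExp μ V ≤ 1 := by
  calc _ ≤ ∫⁻ _, 1 ∂μ := lintegral_mono fun ω => expNeg_le_one _
    _ = 1 := by simp

lemma stepMass_ne_zero (h0 : meanExp μ V ≠ 0) : (2 * d : ℝ≥0∞)⁻¹ * meanExp μ V ≠ 0 :=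
  mul_ne_zero (ENNReal.inv_ne_zero.2 (ENNReal.mul_ne_top (by simp) (by simp))) h0

variable [NeZero d] [IsProbabilityMeasure μ]

lemma stepMass_le_one : (2 * d : ℝ≥0∞)⁻¹ * meanExp μ V ≤ 1 :=
  mul_le_one' two_mul_inv_le_one meanExp_le_one

lemma annealedZ_ne_zero (hV : IsIIDField μ V) (h0 : meanExp μ V ≠ 0) (y : Fin d → ℤ) :
    annealedZ μ V 0 y ≠ 0 :=
  fun h => pow_ne_zero _ (stepMass_ne_zero h0) (le_antisymm (h ▸ pow_le_annealedZ hV y) zero_le)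

lemma annealedZ_ne_top (x y : Fin d → ℤ) : annealedZ μ V x y ≠ ⊤ :=
  ne_top_of_le_ne_top ENNReal.one_ne_top (annealedZ_le_one x y)

lemma annealedZ_toReal_pos (hV : IsIIDField μ V) (h0 : meanExp μ V ≠ 0) (y : Fin d → ℤ) :
    0 < (annealedZ μ V 0 y).toReal :=
  ENNReal.toReal_pos (annealedZ_ne_zero hV h0 y) (annealedZ_ne_top 0 y)

lemma neg_log_annealedZ_le (hV : IsIIDField μ V) (h0 : meanExp μ V ≠ 0) (y : Fin d → ℤ) :
    -Real.log (annealedZ μ V 0 y).toReal ≤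
      -Real.log ((2 * d : ℝ≥0∞)⁻¹ * meanExp μ V).toReal * (latticeDist 0 y + 1) := by
  have h1 := ENNReal.toReal_mono (annealedZ_ne_top 0 y) (pow_le_annealedZ hV y)
  have hpos : 0 < ((2 * d : ℝ≥0∞)⁻¹ * meanExp μ V).toReal := ENNReal.toReal_pos
    (stepMass_ne_zero h0) (ne_top_of_le_ne_top ENNReal.one_ne_top stepMass_le_one)
  rw [ENNReal.toReal_pow] at h1
  have h2 := Real.log_le_log (pow_pos hpos _) h1
  rw [Real.log_pow] at h2
  push_cast at h2
  linarith

lemma stepMass_log_nonneg : 0 ≤ -Real.log ((2 * d : ℝ≥0∞)⁻¹ * meanExp μ V).toReal := by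
  rw [neg_nonneg]
  exact Real.log_nonpos ENNReal.toReal_nonneg
    (by simpa using ENNReal.toReal_mono ENNReal.one_ne_top stepMass_le_one)

/-- Positivity of `meanExp` keeps Z positive, so no logarithm takes its default value at 0; the
Fekete limit is then identified with `limUnder`. -/
lemma tendsto_decayRate (hV : IsIIDField μ V) (h0 : meanExp μ V ≠ 0)
    (h : EuclideanSpace ℝ (Fin d)) :
    Tendsto (decayRate μ V h) atTop (𝓝 (lyapunov μ V h)) := by
  have hpos := annealedZ_toReal_pos hV h0
  obtain ⟨L, hL⟩ := tendsto_subadditive_intPart_div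
    (g := fun y => -Real.log (annealedZ μ V 0 y).toReal) stepMass_log_nonneg
    (fun y => by
      rw [neg_nonneg]
      exact Real.log_nonpos ENNReal.toReal_nonneg
        (by simpa using ENNReal.toReal_mono ENNReal.one_ne_top (annealedZ_le_one 0 y)))
    (fun x y => by
      have h1 := ENNReal.toReal_mono (annealedZ_ne_top 0 (x + y)) (annealedZ_mul_le hV x y)
      rw [ENNReal.toReal_mul] at h1
      have h2 := Real.log_le_log (mul_pos (hpos x) (hpos y)) h1
      rw [Real.log_mul (hpos x).ne' (hpos y).ne'] at h2
      linarith)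
    (neg_log_annealedZ_le hV h0) h
  have hL' : Tendsto (decayRate μ V h) atTop (𝓝 L) := by
    refine hL.congr fun r => ?_
    unfold decayRate
    ring
  unfold lyapunov
  rwa [hL'.limUnder_eq]

end Lyapunov

/-! ### The number of visited sites -/

section Range

/-- The sites visited by `S` strictly before the hitting time of `y`, if that is finite. -/
def visitedSites (y : Fin d → ℤ) (S : ℕ → Fin d → ℤ) : Finset (Fin d → ℤ) :=
  (Finset.range (hitTime y S).toNat).image S

/-- The part of `pathWeight` due to the paths which visit `a` before hitting `y`. -/
def visitWeight (v : (Fin d → ℤ) → ℝ≥0∞) (y a : Fin d → ℤ) (S : ℕ → Fin d → ℤ) : ℝ≥0∞ :=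
  pathWeight v y S - pathWeight (Function.update v a ⊤) y S

lemma pathWeight_eq_expNeg {v : (Fin d → ℤ) → ℝ≥0∞} {y : Fin d → ℤ} {S : ℕ → Fin d → ℤ} {n : ℕ}
    (h : hitTime y S = n) : pathWeight v y S = expNeg (∑ k ∈ Finset.range n, v (S k)) := by
  simp [pathWeight, h, expNeg]

lemma pathWeight_of_top {v : (Fin d → ℤ) → ℝ≥0∞} {y : Fin d → ℤ} {S : ℕ → Fin d → ℤ}
    (h : hitTime y S = ⊤) : pathWeight v y S = 0 := by
  simp [pathWeight, h]

lemma pathWeight_update_top (v : (Fin d → ℤ) → ℝ≥0∞) (y a : Fin d → ℤ) (S : ℕ → Fin d → ℤ) :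
    pathWeight (Function.update v a ⊤) y S =
      if a ∈ visitedSites y S then 0 else pathWeight v y S := by
  induction h : hitTime y S using ENat.recTopCoe with
  | top => simp [pathWeight_of_top h]
  | coe n =>
    rw [pathWeight_eq_expNeg h, pathWeight_eq_expNeg h]
    simp only [visitedSites, h, ENat.toNat_natCast]
    split_ifs with ha
    · obtain ⟨k, hk, rfl⟩ := Finset.mem_image.1 ha
      have : ∑ j ∈ Finset.range n, Function.update v (S k) ⊤ (S j) = ⊤ := by
        rw [ENNReal.sum_eq_top]
        exact ⟨k, hk, by simp⟩
      rw [this, expNeg_top]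
    · congr 1
      refine Finset.sum_congr rfl fun k hk => ?_
      rw [Function.update_of_ne]
      rintro rfl
      exact ha (Finset.mem_image_of_mem _ hk)

lemma visitWeight_eq (v : (Fin d → ℤ) → ℝ≥0∞) (y a : Fin d → ℤ) (S : ℕ → Fin d → ℤ) :
    visitWeight v y a S = if a ∈ visitedSites y S then pathWeight v y S else 0 := by
  unfold visitWeight
  rw [pathWeight_update_top]
  split_ifs <;> simp

lemma tsum_visitWeight (v : (Fin d → ℤ) → ℝ≥0∞) (y : Fin d → ℤ) (S : ℕ → Fin d → ℤ) :
    ∑' a, visitWeight v y a S = (visitedSites y S).card * pathWeight v y S := by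
  simp only [visitWeight_eq]
  rw [tsum_eq_sum (s := visitedSites y S) (by simp +contextual), Finset.sum_ite_mem,
    Finset.inter_self, Finset.sum_const, nsmul_eq_mul]

lemma measurable_update_apply {α : Type*} [MeasurableSpace α] {v : (Fin d → ℤ) → α → ℝ≥0∞}
    (hv : ∀ z, Measurable (v z)) (a z : Fin d → ℤ) :
    Measurable fun ω => Function.update (fun z => v z ω) a ⊤ z := by
  by_cases h : z = a
  · subst h; simp
  · simpa [Function.update_of_ne h] using hv z

lemma measurable_visitWeight_uncurry {α : Type*} [MeasurableSpace α]
    {v : (Fin d → ℤ) → α → ℝ≥0∞} (hv : ∀ z, Measurable (v z)) (y a : Fin d → ℤ) :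
    Measurable fun q : α × (ℕ → Fin d → ℤ) => visitWeight (fun z => v z q.1) y a q.2 :=
  (measurable_pathWeight_uncurry hv y).sub
    (measurable_pathWeight_uncurry (measurable_update_apply hv a) y)

lemma measurable_visitWeight (v : (Fin d → ℤ) → ℝ≥0∞) (y a : Fin d → ℤ) :
    Measurable (visitWeight v y a) :=
  (measurable_pathWeight _ y).sub (measurable_pathWeight _ y)

/-- For the zero potential the visit weights sum to the number of visited sites. If y is never hit
both vanish, because `toNat` of `⊤` is 0 and the set is empty. -/
lemma measurable_card_visitedSites (y : Fin d → ℤ) :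
    Measurable fun S : ℕ → Fin d → ℤ => (visitedSites y S).card := by
  have h : ∀ S : ℕ → Fin d → ℤ, ((visitedSites y S).card : ℝ≥0∞) =
      ∑' a, visitWeight (fun _ => 0) y a S := by
    intro S
    rw [tsum_visitWeight]
    induction h : hitTime y S using ENat.recTopCoe with
    | top => simp [visitedSites, h]
    | coe n => simp [pathWeight_eq_expNeg h, expNeg_zero]
  refine measurable_to_countable' fun n => ?_
  have : (fun S : ℕ → Fin d → ℤ => (visitedSites y S).card) ⁻¹' {n} =
      {S | ∑' a, visitWeight (fun _ => 0) y a S = n} := by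
    ext S
    simp [← h]
  rw [this]
  exact measurableSet_eq_fun (Measurable.tsum fun a => measurable_visitWeight _ y a)
    measurable_const

lemma green_add {A : Set (Fin d → ℤ)} {v f g : (Fin d → ℤ) → ℝ≥0∞} (x : Fin d → ℤ) :
    green A v (fun z => f z + g z) x = green A v f x + green A v g x := by
  rw [green_eq_tsum, green_eq_tsum (f := f), green_eq_tsum (f := g), ← ENNReal.tsum_add]
  simp only [add_mul]

lemma green_sdiff_singleton (v f : (Fin d → ℤ) → ℝ≥0∞) (y a x : Fin d → ℤ) :
    green ({y}ᶜ \ {a}) v f x = green {y}ᶜ (Function.update v a ⊤) f x := by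
  have : killedStep ({y}ᶜ \ {a}) v = killedStep {y}ᶜ (Function.update v a ⊤) := by
    ext f z
    by_cases hz : z = a
    · subst hz
      rw [killedStep_of_notMem (by simp)]
      by_cases hy : z = y
      · rw [killedStep_of_notMem (by simp [hy])]
      · rw [killedStep_of_mem (by simpa using hy)]; simp [expNeg_top]
    · by_cases hy : z = y
      · rw [killedStep_of_notMem (by simp [hy]), killedStep_of_notMem (by simp [hy])]
      · rw [killedStep_of_mem (by simp [hy, hz]), killedStep_of_mem (by simpa using hy),
          Function.update_of_ne hz]
  simp only [green, this]

/-- The weight of the paths from `x` to `y` via `a` factorizes at the first visit to `a`. -/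
lemma green_mul_green_eq_lintegral_visitWeight [NeZero d] (v : (Fin d → ℤ) → ℝ≥0∞)
    {y a : Fin d → ℤ} (hay : a ≠ y) (x : Fin d → ℤ) :
    green ({y}ᶜ \ {a}) v (Pi.single a 1) x * green {y}ᶜ v (Pi.single y 1) a =
      ∫⁻ S, visitWeight v y a S ∂(srw x) := by
  -- An infinite potential at `a` leaves exactly the paths avoiding `a`. This term is split off in
  -- two ways, pathwise and by first entrance into {a}, and cancelled since it is finite.
  have h1 : quenchedZ v x y = quenchedZ (Function.update v a ⊤) x y +
      ∫⁻ S, visitWeight v y a S ∂(srw x) := by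
    unfold quenchedZ
    rw [← lintegral_add_left (measurable_pathWeight _ y)]
    refine lintegral_congr fun S => ?_
    rw [pathWeight_update_top, visitWeight_eq]
    split_ifs <;> simp
  have h2 : quenchedZ v x y = quenchedZ (Function.update v a ⊤) x y +
      green ({y}ᶜ \ {a}) v (Pi.single a 1) x * green {y}ᶜ v (Pi.single y 1) a := by
    rw [quenchedZ_eq_green, quenchedZ_eq_green, ← green_sdiff_singleton,
      green_first_entrance _ {a}, mul_comm, ← green_const_mul, ← green_add]
    congr 1
    ext z
    by_cases hz : z = a
    · subst hz; simp [Pi.single_eq_of_ne hay]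
    · simp [hz]
  have hfin : quenchedZ (Function.update v a ⊤) x y ≠ ⊤ := by
    rw [quenchedZ_eq_green]
    exact ne_top_of_le_ne_top ENNReal.one_ne_top (hit_le_one (by simp) x)
  exact (ENNReal.add_right_inj hfin).1 (h2.symm.trans h1)

/-- Only one visit to each site is charged. Repeated sites disappear, so that independence applies
after averaging. -/
lemma pathWeight_le_prod (v : (Fin d → ℤ) → ℝ≥0∞) (y : Fin d → ℤ) (S : ℕ → Fin d → ℤ) :
    pathWeight v y S ≤ ∏ z ∈ visitedSites y S, expNeg (v z) := by
  have key : ∀ s : Finset ℕ, ∑ z ∈ s.image S, v z ≤ ∑ k ∈ s, v (S k) := by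
    intro s
    induction s using Finset.induction_on with
    | empty => simp
    | insert k s hk ih =>
      rw [Finset.image_insert, Finset.sum_insert hk]
      by_cases h : S k ∈ s.image S
      · rw [Finset.insert_eq_of_mem h]; exact ih.trans le_add_self
      · rw [Finset.sum_insert h]; gcongr
  induction h : hitTime y S using ENat.recTopCoe with
  | top => simp [pathWeight_of_top h]
  | coe n =>
    rw [pathWeight_eq_expNeg h, ← expNeg_sum]
    simp only [visitedSites, h, ENat.toNat_natCast]
    exact expNeg_antitone (key _)

variable {Ω : Type*} [MeasurableSpace Ω] [NeZero d] {μ : Measure Ω}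
  {V : (Fin d → ℤ) → Ω → ℝ≥0∞}

/-- The annealed weight of the paths from `0` to `y` via `a`. -/
def visitMass (μ : Measure Ω) (V : (Fin d → ℤ) → Ω → ℝ≥0∞) (y a : Fin d → ℤ) : ℝ≥0∞ :=
  ∫⁻ ω, ∫⁻ S, visitWeight (fun z => V z ω) y a S ∂(srw 0) ∂μ

variable [IsProbabilityMeasure μ]

/-- For a fixed path with R visited sites, averaging over the environment gives weight at most
`meanExp` to the power R, which cancels the exponential moment. -/
lemma lintegral_pow_card_mul_pathWeight_le (hV : IsIIDField μ V) (h0 : meanExp μ V ≠ 0)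
    (y : Fin d → ℤ) :
    ∫⁻ ω, ∫⁻ S, (meanExp μ V)⁻¹ ^ (visitedSites y S).card *
      pathWeight (fun z => V z ω) y S ∂(srw 0) ∂μ ≤ 1 := by
  have hpw := measurable_pathWeight_uncurry hV.meas y
  have hcard : Measurable fun S => (meanExp μ V)⁻¹ ^ (visitedSites y S).card :=
    (measurable_of_countable fun n : ℕ => (meanExp μ V)⁻¹ ^ n).comp
      (measurable_card_visitedSites y)
  rw [lintegral_lintegral_swap ((hcard.comp measurable_snd).mul hpw).aemeasurable]
  have hle : ∀ S, ∫⁻ ω, (meanExp μ V)⁻¹ ^ (visitedSites y S).card *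
      pathWeight (fun z => V z ω) y S ∂μ ≤ 1 := by
    intro S
    calc _ ≤ ∫⁻ ω, (meanExp μ V)⁻¹ ^ (visitedSites y S).card *
          ∏ z ∈ visitedSites y S, expNeg (V z ω) ∂μ := by
          refine lintegral_mono fun ω => ?_
          gcongr
          exact pathWeight_le_prod _ y S
      _ = (meanExp μ V)⁻¹ ^ (visitedSites y S).card * meanExp μ V ^ (visitedSites y S).card := by
          rw [lintegral_const_mul' _ _ (ENNReal.pow_ne_top (ENNReal.inv_ne_top.2 h0)),
            hV.lintegral_prod _ (g := fun _ => expNeg) fun _ => measurable_expNeg,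
            Finset.prod_const]
          rfl
      _ = 1 := by
          rw [← mul_pow, ENNReal.inv_mul_cancel h0
            (ne_top_of_le_ne_top ENNReal.one_ne_top meanExp_le_one), one_pow]
  calc _ ≤ ∫⁻ _, 1 ∂(srw (0 : Fin d → ℤ)) := lintegral_mono hle
    _ = 1 := by simp

/-- The expected number of visited sites is at most proportional to `-log Z`. -/
lemma tsum_visitMass_le (hV : IsIIDField μ V) (h0 : meanExp μ V ≠ 0) (y : Fin d → ℤ) :
    ENNReal.ofReal (-Real.log (meanExp μ V).toReal) * ∑' a, visitMass μ V y a ≤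
      ENNReal.ofReal (-Real.log (annealedZ μ V 0 y).toReal + 1) * annealedZ μ V 0 y := by
  have hpw := measurable_pathWeight_uncurry hV.meas y
  set φ := meanExp μ V with hφ
  set Z := annealedZ μ V 0 y with hZ
  have hφtop : φ ≠ ⊤ := ne_top_of_le_ne_top ENNReal.one_ne_top meanExp_le_one
  have hφpos : 0 < φ.toReal := ENNReal.toReal_pos h0 hφtop
  have hZpos : 0 < Z.toReal := annealedZ_toReal_pos hV h0 y
  have hZtop : Z ≠ ⊤ := annealedZ_ne_top 0 y
  have hc0 : 0 ≤ -Real.log Z.toReal := by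
    rw [neg_nonneg]
    exact Real.log_nonpos ENNReal.toReal_nonneg
      (by simpa using ENNReal.toReal_mono ENNReal.one_ne_top
            (annealedZ_le_one (μ := μ) (V := V) 0 y))
  -- This is x + 1 ≤ exp x at x = -r log φ + log Z. The shift by log Z gives the exponential moment
  -- the coefficient Z, so its total contribution is at most Z.
  have hpt : ∀ r : ℕ, ENNReal.ofReal (-Real.log φ.toReal) * r ≤
      ENNReal.ofReal (-Real.log Z.toReal) + Z * φ⁻¹ ^ r := by
    intro r
    have hexp : Real.exp (-Real.log φ.toReal * r + Real.log Z.toReal) =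
        Z.toReal * (φ.toReal⁻¹) ^ r := by
      rw [Real.exp_add, Real.exp_log hZpos, mul_comm (-Real.log φ.toReal), Real.exp_nat_mul,
        Real.exp_neg, Real.exp_log hφpos, mul_comm]
    have h1 := Real.add_one_le_exp (-Real.log φ.toReal * r + Real.log Z.toReal)
    rw [hexp] at h1
    have h2 : Z * φ⁻¹ ^ r = ENNReal.ofReal (Z.toReal * (φ.toReal⁻¹) ^ r) := by
      rw [ENNReal.ofReal_mul hZpos.le, ENNReal.ofReal_toReal hZtop,
        ENNReal.ofReal_pow (inv_nonneg.2 hφpos.le), ENNReal.ofReal_inv_of_pos hφpos,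
        ENNReal.ofReal_toReal hφtop]
    rw [h2, ← ENNReal.ofReal_add hc0 (by positivity), ← ENNReal.ofReal_natCast r,
      ← ENNReal.ofReal_mul' (Nat.cast_nonneg r)]
    exact ENNReal.ofReal_le_ofReal (by linarith)
  have hsum : ∑' a, visitMass μ V y a =
      ∫⁻ ω, ∫⁻ S, (visitedSites y S).card * pathWeight (fun z => V z ω) y S ∂(srw 0) ∂μ := by
    simp only [← tsum_visitWeight, visitMass]
    rw [← lintegral_tsum fun a => (measurable_visitWeight_uncurry hV.meas y
      a).lintegral_prod_right'.aemeasurable]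
    refine lintegral_congr fun ω => ?_
    rw [lintegral_tsum fun a => (measurable_visitWeight _ y a).aemeasurable]
  have hZeq : ∫⁻ ω, ∫⁻ S, pathWeight (fun z => V z ω) y S ∂(srw 0) ∂μ = Z := rfl
  have hm : Measurable fun ω => ∫⁻ S, pathWeight (fun z => V z ω) y S ∂(srw 0) :=
    hpw.lintegral_prod_right'
  calc _ = ∫⁻ ω, ∫⁻ S, ENNReal.ofReal (-Real.log φ.toReal) *
        ((visitedSites y S).card * pathWeight (fun z => V z ω) y S) ∂(srw 0) ∂μ := by
        rw [hsum, ← lintegral_const_mul' _ _ ENNReal.ofReal_ne_top]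
        simp only [← lintegral_const_mul' _ _ ENNReal.ofReal_ne_top]
    _ ≤ ∫⁻ ω, ∫⁻ S, (ENNReal.ofReal (-Real.log Z.toReal) * pathWeight (fun z => V z ω) y S +
        Z * (φ⁻¹ ^ (visitedSites y S).card * pathWeight (fun z => V z ω) y S)) ∂(srw 0) ∂μ := by
        refine lintegral_mono fun ω => lintegral_mono fun S => ?_
        rw [← mul_assoc, ← mul_assoc, ← add_mul]
        gcongr
        exact hpt _
    _ = ENNReal.ofReal (-Real.log Z.toReal) * Z + Z * ∫⁻ ω, ∫⁻ S,
        φ⁻¹ ^ (visitedSites y S).card * pathWeight (fun z => V z ω) y S ∂(srw 0) ∂μ := by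
        simp only [lintegral_add_left ((measurable_pathWeight _ y).const_mul _),
          lintegral_const_mul' _ _ ENNReal.ofReal_ne_top, lintegral_const_mul' _ _ hZtop]
        rw [lintegral_add_left (hm.const_mul _), lintegral_const_mul' _ _ ENNReal.ofReal_ne_top,
          lintegral_const_mul' _ _ hZtop, hZeq]
    _ ≤ ENNReal.ofReal (-Real.log Z.toReal) * Z + Z * 1 := by
        gcongr
        exact lintegral_pow_card_mul_pathWeight_le hV h0 y
    _ = _ := by
        rw [ENNReal.ofReal_add hc0 zero_le_one, ENNReal.ofReal_one]
        ring

end Range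

/-! ### Local comparison of the time spent with the number of visited sites -/

section Box

/-- The sup-norm ball of radius `r` around `z`. -/
def latticeBox (z : Fin d → ℤ) (r : ℤ) : Finset (Fin d → ℤ) :=
  Finset.Icc (fun i => z i - r) fun i => z i + r

lemma mem_latticeBox {z x : Fin d → ℤ} {r : ℤ} :
    x ∈ latticeBox z r ↔ ∀ i, z i - r ≤ x i ∧ x i ≤ z i + r := by
  simp only [latticeBox, Finset.mem_Icc, Pi.le_def, forall_and]

lemma mem_latticeBox_comm {z x : Fin d → ℤ} {r : ℤ} : x ∈ latticeBox z r ↔ z ∈ latticeBox x r := by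
  simp only [mem_latticeBox]
  exact forall_congr' fun i => by constructor <;> rintro ⟨h1, h2⟩ <;> constructor <;> linarith

lemma self_mem_latticeBox (z : Fin d → ℤ) (k : ℕ) : z ∈ latticeBox z k :=
  mem_latticeBox.2 fun i => by constructor <;> omega

lemma card_latticeBox (z : Fin d → ℤ) (r : ℤ) : (latticeBox z r).card = (2 * r + 1).toNat ^ d := by
  rw [latticeBox, Pi.card_Icc]
  have : ∀ i, (Finset.Icc (z i - r) (z i + r)).card = (2 * r + 1).toNat := fun i => by
    rw [Int.card_Icc]; congr 1; ring
  simp [this]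

lemma latticeDist_le_of_mem_latticeBox {z a b : Fin d → ℤ} {k : ℕ} (ha : a ∈ latticeBox z k)
    (hb : b ∈ latticeBox z k) : latticeDist a b ≤ d * (2 * k) := by
  unfold latticeDist
  calc _ ≤ ∑ _i : Fin d, 2 * k := Finset.sum_le_sum fun i _ => by
        have := mem_latticeBox.1 ha i
        have := mem_latticeBox.1 hb i
        omega
    _ = d * (2 * k) := by simp

end Box

/-! ### Splitting the time at the entrance into and last exit from a box -/

section TimeSum

variable {A B : Set (Fin d → ℤ)} {v f : (Fin d → ℤ) → ℝ≥0∞}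

lemma tsum_mul_natCast (a : ℕ → ℝ≥0∞) : ∑' n : ℕ, a n * n = ∑' j, ∑' m, a (m + (j + 1)) := by
  have h1 : ∀ n : ℕ, a n * n = ∑' j : ℕ, if j < n then a n else 0 := fun n => by
    rw [tsum_eq_sum (s := Finset.range n) fun j hj => if_neg fun h => hj (Finset.mem_range.2 h)]
    rw [Finset.sum_congr rfl fun j hj => if_pos (Finset.mem_range.1 hj)]
    simp [mul_comm]
  simp only [h1]
  rw [ENNReal.tsum_comm]
  congr 1; ext j
  have h2 := Summable.sum_add_tsum_nat_add' (f := fun n : ℕ => if j < n then a n else 0)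
    (k := j + 1) ENNReal.summable
  rw [← h2, Finset.sum_eq_zero, zero_add]
  · congr 1; ext m
    rw [if_pos (by omega)]
  · intro n hn
    rw [if_neg (by have := Finset.mem_range.1 hn; omega)]

/-- Writing n as the number of times j < n splits a path of length n at each such j, with a nonempty
remainder; summing both pieces gives G K G. -/
lemma tsum_killedStep_iterate_mul_natCast (x : Fin d → ℤ) :
    ∑' n : ℕ, (killedStep A v)^[n] f x * n = green A v (killedStep A v (green A v f)) x := by
  have h : killedStep A v (green A v f) = fun z => ∑' m, (killedStep A v)^[m + 1] f z := by
    have : green A v f = fun z => ∑' n, (killedStep A v)^[n] f z := rfl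
    rw [this, killedStep_tsum]
    simp only [Function.iterate_succ_apply']
  rw [tsum_mul_natCast, h]
  simp only [green, killedStep_iterate_tsum, ← Function.iterate_add_apply]
  congr 1; ext j; congr 1; ext m
  rw [show m + (j + 1) = j + (m + 1) by omega]

/-- The expected time before hitting `y`, as a sum over the sites visited. -/
lemma tsum_hit_mul_natCast_le (v : (Fin d → ℤ) → ℝ≥0∞) (x y : Fin d → ℤ) :
    ∑' n : ℕ, (killedStep {y}ᶜ v)^[n] (Pi.single y 1) x * n ≤
      ∑' z, if z = y then 0 else
        green {y}ᶜ v (Pi.single z 1) x * green {y}ᶜ v (Pi.single y 1) z := by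
  rw [tsum_killedStep_iterate_mul_natCast, green_eq_tsum]
  refine ENNReal.tsum_le_tsum fun z => ?_
  split_ifs with h
  · rw [killedStep_of_notMem (by simpa using h), zero_mul]
  · rw [mul_comm]
    gcongr
    conv_rhs => rw [green_eq]
    exact le_add_self

/-- The entrance part: paths from `x` to the box. -/
lemma green_le_entrance {y z : Fin d → ℤ} (B : Finset (Fin d → ℤ)) (hz : z ∈ B) (hzy : z ≠ y)
    {Γ : ℝ≥0∞} (hΓ : ∀ a, green {y}ᶜ v (Pi.single z 1) a ≤ Γ) (x : Fin d → ℤ) :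
    green {y}ᶜ v (Pi.single z 1) x ≤
      Γ * ∑ a ∈ B.erase y, green ({y}ᶜ \ (B : Set (Fin d → ℤ))) v (Pi.single a 1) x := by
  classical
  rw [green_first_entrance _ (B : Set (Fin d → ℤ)), green_eq_tsum, Finset.mul_sum,
    tsum_eq_sum (s := B.erase y)]
  · refine Finset.sum_le_sum fun a ha => ?_
    rw [if_pos (Finset.mem_coe.2 (Finset.mem_of_mem_erase ha))]
    gcongr
    exact hΓ a
  · intro a ha
    -- Entering the box at y contributes nothing, since the walk is stopped there and z ≠ y; this is
    -- why y is erased from the sum.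
    by_cases haB : a ∈ B
    · have hay : a = y := by
        by_contra h
        exact ha (Finset.mem_erase.2 ⟨h, haB⟩)
      subst hay
      rw [if_pos (Finset.mem_coe.2 haB), green_of_notMem (by simp), Pi.single_eq_of_ne hzy.symm,
        zero_mul]
    · rw [if_neg (by simpa using haB), Pi.single_eq_of_ne (by rintro rfl; exact haB hz), zero_mul]

/-- The weight of going from `b ∈ B` to `y` without returning to `B`. -/
def exitWeight (B : Finset (Fin d → ℤ)) (v : (Fin d → ℤ) → ℝ≥0∞) (y b : Fin d → ℤ) : ℝ≥0∞ :=
  if y ∈ B then Pi.single (M := fun _ => ℝ≥0∞) y 1 b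
  else nbrAvg (green ({y}ᶜ \ (B : Set (Fin d → ℤ))) v (Pi.single y 1)) b

lemma hit_le_exitWeight [NeZero d] {y z : Fin d → ℤ} (B : Finset (Fin d → ℤ)) (hz : z ∈ B)
    (hzy : z ≠ y) {Γ : ℝ≥0∞} (hΓ : ∀ b ∈ B, green {y}ᶜ v (Pi.single b 1) z ≤ Γ) :
    green {y}ᶜ v (Pi.single y 1) z ≤ Γ * ∑ b ∈ B, exitWeight B v y b := by
  -- If the target lies in the box there is no last exit; the convention that `exitWeight` is then a
  -- unit mass at y, together with 1 ≤ Γ, suffices.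
  by_cases hy : y ∈ B
  · have h1 : 1 ≤ Γ := by
      refine le_trans ?_ (hΓ z hz)
      simpa using le_green (A := {y}ᶜ) (v := v) (f := Pi.single z 1) z
    have h2 : 1 ≤ ∑ b ∈ B, exitWeight B v y b := by
      refine le_trans ?_ (Finset.single_le_sum (fun _ _ => zero_le) hy)
      simp [exitWeight, hy]
    exact (hit_le_one (by simp) z).trans (one_le_mul h1 h2)
  · refine (green_le_last_exit _ (B : Set (Fin d → ℤ)) v _ z).trans ?_
    rw [green_of_notMem (A := {y}ᶜ \ (B : Set (Fin d → ℤ))) (fun h => h.2 (Finset.mem_coe.2 hz)),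
      Pi.single_eq_of_ne hzy, zero_add, green_eq_tsum, Finset.mul_sum, tsum_eq_sum (s := B)]
    · refine Finset.sum_le_sum fun b hb => ?_
      rw [Set.indicator_of_mem (Finset.mem_coe.2 hb), mul_comm, exitWeight, if_neg hy]
      gcongr
      · exact hΓ b hb
      · exact killedStep_le b
    · intro b hb
      rw [Set.indicator_of_notMem (by simpa using hb), zero_mul]

/-- `exitWeight` leaves out exp(-v b) so as to depend only on the potential outside the box;
restoring that factor gives a genuine path weight from b to y. -/
lemma expNeg_mul_exitWeight_le [NeZero d] (B : Finset (Fin d → ℤ)) (v : (Fin d → ℤ) → ℝ≥0∞)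
    (y b : Fin d → ℤ) :
    expNeg (v b) * exitWeight B v y b ≤ green {y}ᶜ v (Pi.single y 1) b := by
  unfold exitWeight
  split_ifs with hy
  · calc _ ≤ 1 * Pi.single (M := fun _ => ℝ≥0∞) y 1 b := by gcongr; exact expNeg_le_one _
      _ ≤ _ := by rw [one_mul]; exact le_green b
  · refine le_trans ?_ (hit_superharmonic y b)
    gcongr
    exact nbrAvg_mono (green_mono_set Set.sdiff_subset) b

/-- Replacing the part of a path between its first entrance into and its last exit from a box by
a path inside the box. -/
lemma green_mul_exitWeight_mul_le [NeZero d] {y a : Fin d → ℤ} (B : Finset (Fin d → ℤ))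
    (ha : a ∈ B) (b x : Fin d → ℤ) :
    green ({y}ᶜ \ (B : Set (Fin d → ℤ))) v (Pi.single a 1) x * exitWeight B v y b *
        (green ((B : Set (Fin d → ℤ)) \ {b}) v (Pi.single b 1) a * expNeg (v b)) ≤
      green ({y}ᶜ \ {a}) v (Pi.single a 1) x * green {y}ᶜ v (Pi.single y 1) a := by
  calc _ = green ({y}ᶜ \ (B : Set (Fin d → ℤ))) v (Pi.single a 1) x *
        (green ((B : Set (Fin d → ℤ)) \ {b}) v (Pi.single b 1) a *
          (expNeg (v b) * exitWeight B v y b)) := by ring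
    _ ≤ green ({y}ᶜ \ {a}) v (Pi.single a 1) x *
        (green ((B : Set (Fin d → ℤ)) \ {b}) v (Pi.single b 1) a *
          green {y}ᶜ v (Pi.single y 1) b) := by
        gcongr
        · refine green_mono_set (Set.sdiff_subset_sdiff_right ?_) x
          simpa using ha
        · exact expNeg_mul_exitWeight_le B v y b
    _ ≤ _ := by
        gcongr
        exact hit_mul_le (by simp) (fun z _ => hit_superharmonic y z) a

end TimeSum

/-! ### The distance to the nearest obstacle -/

section Local

variable {Ω : Type*} {V : (Fin d → ℤ) → Ω → ℝ≥0∞}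

/-- The event that the box of radius `k` around `z` is the smallest one which contains a site where
the potential is at least `v₀`. -/
def firstObstacle (V : (Fin d → ℤ) → Ω → ℝ≥0∞) (v₀ : ℝ≥0∞) (z : Fin d → ℤ) (k : ℕ) : Set Ω :=
  {ω | (∀ x ∈ latticeBox z (k - 1), V x ω < v₀) ∧ ∃ w ∈ latticeBox z k, v₀ ≤ V w ω}

lemma measurableSet_firstObstacle (v₀ : ℝ≥0∞) (z : Fin d → ℤ) (k : ℕ) :
    MeasurableSet[sitesAlgebra V (latticeBox z k)] (firstObstacle V v₀ z k) := by
  have hsub : ∀ x ∈ latticeBox z (k - 1), x ∈ latticeBox z k := fun x hx => by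
    rw [mem_latticeBox] at hx ⊢
    exact fun i => by have := hx i; constructor <;> linarith [this.1, this.2]
  have h : firstObstacle V v₀ z k = (⋂ x ∈ latticeBox z (k - 1), V x ⁻¹' Set.Iio v₀) ∩
      ⋃ w ∈ latticeBox z k, V w ⁻¹' Set.Ici v₀ := by
    ext ω; simp [firstObstacle]
  rw [h]
  refine MeasurableSet.inter ?_ ?_
  · refine Finset.measurableSet_biInter _ fun x hx => ?_
    exact measurable_sitesAlgebra (Finset.mem_coe.2 (hsub x hx)) measurableSet_Iio
  · refine Finset.measurableSet_biUnion _ fun x hx => ?_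
    exact measurable_sitesAlgebra (Finset.mem_coe.2 hx) measurableSet_Ici

lemma exists_firstObstacle [NeZero d] {v₀ : ℝ≥0∞} {ω : Ω} (h : ∃ x, v₀ ≤ V x ω)
    (z : Fin d → ℤ) : ∃ k, ω ∈ firstObstacle V v₀ z k := by
  classical
  obtain ⟨x, hx⟩ := h
  have hex : ∃ k : ℕ, ∃ w ∈ latticeBox z k, v₀ ≤ V w ω := by
    refine ⟨∑ i, (x i - z i).natAbs, x, mem_latticeBox.2 fun i => ?_, hx⟩
    have := Finset.single_le_sum (f := fun i => (x i - z i).natAbs) (fun i _ => Nat.zero_le _)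
      (Finset.mem_univ i)
    constructor <;> omega
  refine ⟨Nat.find hex, fun w hw => ?_, Nat.find_spec hex⟩
  by_contra hlt
  -- When the least radius is 0 the inner box has radius -1 and is empty, as there is at least one
  -- coordinate.
  rcases Nat.eq_zero_or_pos (Nat.find hex) with h0 | hpos
  · have := mem_latticeBox.1 hw 0
    rw [h0] at this
    push_cast at this
    omega
  · refine Nat.find_min hex (Nat.sub_lt hpos one_pos) ⟨w, ?_, not_lt.1 hlt⟩
    rwa [Nat.cast_sub (show 1 ≤ Nat.find hex from hpos), Nat.cast_one]

lemma measurable_exitWeight (B : Finset (Fin d → ℤ)) (y b : Fin d → ℤ) :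
    Measurable[sitesAlgebra V (B : Set (Fin d → ℤ))ᶜ]
      fun ω => exitWeight B (fun z => V z ω) y b := by
  unfold exitWeight
  split_ifs
  · exact measurable_const
  · exact measurable_nbrAvg (fun z => measurable_green
      (fun x hx => measurable_sitesAlgebra hx.2) _ _) b

variable [MeasurableSpace Ω] {μ : Measure Ω}

lemma measure_forall_lt [IsProbabilityMeasure μ] (hV : IsIIDField μ V) (v₀ : ℝ≥0∞)
    (s : Finset (Fin d → ℤ)) :
    μ {ω | ∀ x ∈ s, V x ω < v₀} = μ {ω | V 0 ω < v₀} ^ s.card := by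
  have hm : Measurable ((Set.Iio v₀).indicator (1 : ℝ≥0∞ → ℝ≥0∞)) :=
    measurable_one.indicator measurableSet_Iio
  have hset : MeasurableSet {ω | ∀ x ∈ s, V x ω < v₀} := by
    have : {ω | ∀ x ∈ s, V x ω < v₀} = ⋂ x ∈ s, V x ⁻¹' Set.Iio v₀ := by ext; simp
    rw [this]
    exact Finset.measurableSet_biInter _ fun x _ => hV.meas x measurableSet_Iio
  have h0 : ∫⁻ ω, (Set.Iio v₀).indicator (1 : ℝ≥0∞ → ℝ≥0∞) (V 0 ω) ∂μ = μ {ω | V 0 ω < v₀} := by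
    have h : MeasurableSet {ω | V 0 ω < v₀} := measurableSet_lt (hV.meas 0) measurable_const
    rw [← lintegral_indicator_one h]
    exact lintegral_congr fun ω => by by_cases h : V 0 ω < v₀ <;> simp [h]
  rw [← lintegral_indicator_one hset, ← h0, ← Finset.prod_const,
    ← hV.lintegral_prod s (g := fun _ => (Set.Iio v₀).indicator 1) fun _ => hm]
  refine lintegral_congr fun ω => ?_
  by_cases h : ω ∈ {ω | ∀ x ∈ s, V x ω < v₀}
  · rw [Set.indicator_of_mem h, Finset.prod_eq_one]
    · rfl
    · intro x hx
      exact Set.indicator_of_mem (Set.mem_Iio.2 (h x hx)) _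
  · rw [Set.indicator_of_notMem h]
    simp only [Set.mem_ofPred_eq, not_forall] at h
    obtain ⟨x, hx, hxv⟩ := h
    exact (Finset.prod_eq_zero hx (Set.indicator_of_notMem hxv _)).symm

/-- All sites of the inner box lie below v₀ independently. For k = 0 its radius is -1, matched by
the truncated subtraction `2 * k - 1 = 0`. -/
lemma measure_firstObstacle_le [IsProbabilityMeasure μ] (hV : IsIIDField μ V) (v₀ : ℝ≥0∞)
    (z : Fin d → ℤ) (k : ℕ) :
    μ (firstObstacle V v₀ z k) ≤ μ {ω | V 0 ω < v₀} ^ ((2 * k - 1) ^ d) := by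
  have h : firstObstacle V v₀ z k ⊆ {ω | ∀ x ∈ latticeBox z (k - 1), V x ω < v₀} :=
    fun ω hω => hω.1
  refine (measure_mono h).trans (le_of_eq ?_)
  rw [measure_forall_lt hV, card_latticeBox]
  congr 2
  omega

end Local

/-! ### Expected time against expected number of visited sites -/

section Comparison

variable [NeZero d] {Ω : Type*} [MeasurableSpace Ω] {μ : Measure Ω} [IsProbabilityMeasure μ]
  {V : (Fin d → ℤ) → Ω → ℝ≥0∞}

lemma ae_exists_le (hV : IsIIDField μ V) {v₀ : ℝ≥0∞} (hq : μ {ω | V 0 ω < v₀} < 1) :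
    ∀ᵐ ω ∂μ, ∃ x, v₀ ≤ V x ω := by
  have hle : ∀ k : ℕ, μ {ω | ¬ ∃ x, v₀ ≤ V x ω} ≤ μ {ω | V 0 ω < v₀} ^ k := by
    intro k
    have hsub : {ω | ¬ ∃ x, v₀ ≤ V x ω} ⊆ {ω | ∀ x ∈ latticeBox (0 : Fin d → ℤ) k, V x ω < v₀} :=
      fun ω hω x _ => not_le.1 fun h => hω ⟨x, h⟩
    refine (measure_mono hsub).trans ?_
    rw [measure_forall_lt hV, card_latticeBox]
    refine pow_le_pow_of_le_one zero_le hq.le ?_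
    calc k ≤ (2 * (k : ℤ) + 1).toNat := by omega
      _ ≤ _ := Nat.le_self_pow (NeZero.ne d) _
  exact le_antisymm (ge_of_tendsto' (ENNReal.tendsto_pow_atTop_nhds_zero_of_lt_one hq) hle) zero_le

/-- The environment outside the box is independent of the one inside. -/
lemma lintegral_exit_mul_le (hV : IsIIDField μ V) {y a : Fin d → ℤ} (hay : a ≠ y)
    (B : Finset (Fin d → ℤ)) (ha : a ∈ B) (b : Fin d → ℤ) {θ : ℝ≥0∞} (hθ0 : θ ≠ 0)
    (hθ : θ ≤ ∫⁻ ω, green ((B : Set (Fin d → ℤ)) \ {b}) (fun z => V z ω) (Pi.single b 1) a *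
      expNeg (V b ω) ∂μ) (hb : b ∈ B) :
    ∫⁻ ω, green ({y}ᶜ \ (B : Set (Fin d → ℤ))) (fun z => V z ω) (Pi.single a 1) 0 *
      exitWeight B (fun z => V z ω) y b ∂μ ≤ θ⁻¹ * visitMass μ V y a := by
  have hθtop : θ ≠ ⊤ := by
    refine ne_top_of_le_ne_top ENNReal.one_ne_top (hθ.trans ?_)
    calc _ ≤ ∫⁻ _, 1 ∂μ := lintegral_mono fun ω =>
          mul_le_one' (hit_le_one (by simp) a) (expNeg_le_one _)
      _ = 1 := by simp
  have hout : Measurable[sitesAlgebra V (B : Set (Fin d → ℤ))ᶜ] fun ω =>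
      green ({y}ᶜ \ (B : Set (Fin d → ℤ))) (fun z => V z ω) (Pi.single a 1) 0 *
        exitWeight B (fun z => V z ω) y b :=
    (measurable_green (fun x hx => measurable_sitesAlgebra hx.2) _ _).mul
      (measurable_exitWeight B y b)
  have hin : Measurable[sitesAlgebra V (B : Set (Fin d → ℤ))] fun ω =>
      green ((B : Set (Fin d → ℤ)) \ {b}) (fun z => V z ω) (Pi.single b 1) a * expNeg (V b ω) :=
    (measurable_green (fun x hx => measurable_sitesAlgebra hx.1) _ _).mul
      (measurable_expNeg.comp (measurable_sitesAlgebra (Finset.mem_coe.2 hb)))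
  -- Multiplying by θ amounts to inserting an independent crossing of the box from a to b, which
  -- completes the two outer pieces to paths visiting a.
  rw [← ENNReal.mul_le_iff_le_inv hθ0 hθtop]
  calc _ ≤ (∫⁻ ω, green ({y}ᶜ \ (B : Set (Fin d → ℤ))) (fun z => V z ω) (Pi.single a 1) 0 *
        exitWeight B (fun z => V z ω) y b ∂μ) *
        ∫⁻ ω, green ((B : Set (Fin d → ℤ)) \ {b}) (fun z => V z ω) (Pi.single b 1) a *
          expNeg (V b ω) ∂μ := by rw [mul_comm]; gcongr
    _ = _ := (hV.lintegral_mul disjoint_compl_left hout hin).symm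
    _ ≤ _ := by
        refine lintegral_mono fun ω => ?_
        rw [← green_mul_green_eq_lintegral_visitWeight _ hay]
        exact green_mul_exitWeight_mul_le B ha b 0

/-- The annealed expected time at `z`, on the event that the nearest obstacle is at distance `k`. -/
lemma lintegral_firstObstacle_le (hV : IsIIDField μ V) {v₀ : ℝ≥0∞} {y z : Fin d → ℤ}
    (hzy : z ≠ y) (k : ℕ) {Γ θ : ℝ≥0∞}
    (hΓ : ∀ v : (Fin d → ℤ) → ℝ≥0∞, (∃ w ∈ latticeBox z k, v₀ ≤ v w) → ∀ b ∈ latticeBox z k,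
      ∀ x, green {y}ᶜ v (Pi.single b 1) x ≤ Γ)
    (hθ0 : θ ≠ 0)
    (hθ : ∀ a ∈ latticeBox z k, ∀ b ∈ latticeBox z k, θ ≤ ∫⁻ ω,
      green ((latticeBox z k : Set (Fin d → ℤ)) \ {b}) (fun z => V z ω) (Pi.single b 1) a *
        expNeg (V b ω) ∂μ) :
    ∫⁻ ω, (firstObstacle V v₀ z k).indicator (fun ω =>
        green {y}ᶜ (fun z => V z ω) (Pi.single z 1) 0 *
          green {y}ᶜ (fun z => V z ω) (Pi.single y 1) z) ω ∂μ ≤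
      Γ ^ 2 * μ {ω | V 0 ω < v₀} ^ ((2 * k - 1) ^ d) * θ⁻¹ * (2 * k + 1) ^ d *
        ∑ a ∈ latticeBox z k, visitMass μ V y a := by
  set B := latticeBox z k with hB
  have hz : z ∈ B := self_mem_latticeBox z k
  set F := firstObstacle V v₀ z k with hF
  have hFm := measurableSet_firstObstacle (V := V) v₀ z k
  have hFm' : MeasurableSet F := hV.sitesAlgebra_le _ _ hFm
  let W : (Fin d → ℤ) → (Fin d → ℤ) → Ω → ℝ≥0∞ := fun a b ω =>
    green ({y}ᶜ \ (B : Set (Fin d → ℤ))) (fun z => V z ω) (Pi.single a 1) 0 *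
      exitWeight B (fun z => V z ω) y b
  have hW : ∀ a b, Measurable[sitesAlgebra V (B : Set (Fin d → ℤ))ᶜ] (W a b) := fun a b =>
    (measurable_green (fun x hx => measurable_sitesAlgebra hx.2) _ _).mul
      (measurable_exitWeight B y b)
  have hind : Measurable[sitesAlgebra V (B : Set (Fin d → ℤ))] (F.indicator (1 : Ω → ℝ≥0∞)) :=
    Measurable.indicator (f := fun _ => (1 : ℝ≥0∞)) measurable_const hFm
  -- One factor Γ pays for reaching z from the entrance site, the other for going from z to the last
  -- exit site. What remains, `W a b`, does not read the potential in the box.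
  have hpt : ∀ ω, F.indicator (fun ω => green {y}ᶜ (fun z => V z ω) (Pi.single z 1) 0 *
      green {y}ᶜ (fun z => V z ω) (Pi.single y 1) z) ω ≤
      Γ ^ 2 * ∑ a ∈ B.erase y, ∑ b ∈ B, F.indicator 1 ω * W a b ω := by
    intro ω
    by_cases hω : ω ∈ F
    · rw [Set.indicator_of_mem hω]
      have hΓ' := hΓ (fun z => V z ω) hω.2
      calc _ ≤ (Γ * ∑ a ∈ B.erase y,
            green ({y}ᶜ \ (B : Set (Fin d → ℤ))) (fun z => V z ω) (Pi.single a 1) 0) *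
            (Γ * ∑ b ∈ B, exitWeight B (fun z => V z ω) y b) := by
            gcongr
            · exact green_le_entrance B hz hzy (hΓ' z hz) 0
            · exact hit_le_exitWeight B hz hzy fun b hb => hΓ' b hb z
        _ = Γ ^ 2 * ∑ a ∈ B.erase y, ∑ b ∈ B, W a b ω := by
            simp only [W]
            rw [← Finset.sum_mul_sum]
            ring
        _ = _ := by simp [Set.indicator_of_mem hω]
    · rw [Set.indicator_of_notMem hω]; exact zero_le
  have hE : ∀ a ∈ B.erase y, ∀ b ∈ B, ∫⁻ ω, F.indicator 1 ω * W a b ω ∂μ ≤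
      μ {ω | V 0 ω < v₀} ^ ((2 * k - 1) ^ d) * (θ⁻¹ * visitMass μ V y a) := by
    intro a ha b hb
    rw [Finset.mem_erase] at ha
    rw [hV.lintegral_mul disjoint_compl_right hind (hW a b), lintegral_indicator_one hFm']
    gcongr
    · exact measure_firstObstacle_le hV v₀ z k
    · exact lintegral_exit_mul_le hV ha.1 B ha.2 b hθ0 (hθ a ha.2 b hb) hb
  have hmeas : ∀ a b, Measurable fun ω => F.indicator (1 : Ω → ℝ≥0∞) ω * W a b ω := fun a b =>
    (measurable_one.indicator hFm').mul ((hW a b).mono (hV.sitesAlgebra_le _) le_rfl)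
  have hcard : (B.card : ℝ≥0∞) = (2 * k + 1) ^ d := by
    rw [hB, card_latticeBox]
    have : (2 * (k : ℤ) + 1).toNat = 2 * k + 1 := by omega
    rw [this]; push_cast; ring
  calc _ ≤ ∫⁻ ω, Γ ^ 2 * ∑ a ∈ B.erase y, ∑ b ∈ B, F.indicator 1 ω * W a b ω ∂μ :=
        lintegral_mono hpt
    _ = Γ ^ 2 * ∑ a ∈ B.erase y, ∑ b ∈ B, ∫⁻ ω, F.indicator 1 ω * W a b ω ∂μ := by
        rw [lintegral_const_mul _ (Finset.measurable_fun_sum _ fun a _ =>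
          Finset.measurable_fun_sum _ fun b _ => hmeas a b),
          lintegral_finsetSum _ fun a _ => Finset.measurable_fun_sum _ fun b _ => hmeas a b]
        congr 1
        exact Finset.sum_congr rfl fun a _ => lintegral_finsetSum _ fun b _ => hmeas a b
    _ ≤ Γ ^ 2 * ∑ a ∈ B.erase y, ∑ b ∈ B,
        μ {ω | V 0 ω < v₀} ^ ((2 * k - 1) ^ d) * (θ⁻¹ * visitMass μ V y a) := by
        gcongr with a ha b hb
        exact hE a ha b hb
    _ ≤ Γ ^ 2 * ∑ a ∈ B, ∑ b ∈ B,
        μ {ω | V 0 ω < v₀} ^ ((2 * k - 1) ^ d) * (θ⁻¹ * visitMass μ V y a) := by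
        gcongr
        exact Finset.erase_subset _ _
    _ = _ := by
        simp only [Finset.sum_const, nsmul_eq_mul, hcard, ← Finset.mul_sum]
        ring

/-- If the probability that the nearest obstacle is far away decays fast enough, the annealed
expected crossing time is at most proportional to the expected number of visited sites. -/
lemma tsum_crossMass_mul_le (hV : IsIIDField μ V) {v₀ : ℝ≥0∞} (hq : μ {ω | V 0 ω < v₀} < 1)
    {Γ θ : ℕ → ℝ≥0∞}
    (hΓ : ∀ (y z : Fin d → ℤ) (k : ℕ) (v : (Fin d → ℤ) → ℝ≥0∞),
      (∃ w ∈ latticeBox z k, v₀ ≤ v w) → ∀ b ∈ latticeBox z k,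
      ∀ x, green {y}ᶜ v (Pi.single b 1) x ≤ Γ k)
    (hθ0 : ∀ k, θ k ≠ 0)
    (hθ : ∀ (z : Fin d → ℤ) (k : ℕ), ∀ a ∈ latticeBox z k, ∀ b ∈ latticeBox z k, θ k ≤ ∫⁻ ω,
      green ((latticeBox z k : Set (Fin d → ℤ)) \ {b}) (fun z => V z ω) (Pi.single b 1) a *
        expNeg (V b ω) ∂μ) (y : Fin d → ℤ) :
    ∑' n : ℕ, crossMass μ V y n * n ≤
      (∑' k : ℕ, Γ k ^ 2 * μ {ω | V 0 ω < v₀} ^ ((2 * k - 1) ^ d) * (θ k)⁻¹ *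
        ((2 * k + 1) ^ d) ^ 2) * ∑' a, visitMass μ V y a := by
  set c : ℕ → ℝ≥0∞ := fun k =>
    Γ k ^ 2 * μ {ω | V 0 ω < v₀} ^ ((2 * k - 1) ^ d) * (θ k)⁻¹ * (2 * k + 1) ^ d with hc
  let T : (Fin d → ℤ) → Ω → ℝ≥0∞ := fun z ω => if z = y then 0 else
    green {y}ᶜ (fun z => V z ω) (Pi.single z 1) 0 * green {y}ᶜ (fun z => V z ω) (Pi.single y 1) z
  have hGm : ∀ z x, Measurable fun ω => green {y}ᶜ (fun z => V z ω) (Pi.single z 1) x :=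
    fun z x => measurable_green (fun z _ => hV.meas z) _ x
  have hTm : ∀ z, Measurable (T z) := fun z => by
    by_cases h : z = y
    · simp only [T, h, if_true]; exact measurable_const
    · simp only [T, h, if_false]
      exact (hGm z 0).mul (hGm y z)
  -- Almost surely some obstacle exists, so `T z` is dominated by the sum over k of its restrictions
  -- to the events `firstObstacle`.
  have hT : ∀ z, ∫⁻ ω, T z ω ∂μ ≤ ∑' k, c k * ∑ a ∈ latticeBox z k, visitMass μ V y a := by
    intro z
    by_cases hzy : z = y
    · simp [T, hzy]
    · have hFm : ∀ k, MeasurableSet (firstObstacle V v₀ z k) := fun k =>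
        hV.sitesAlgebra_le _ _ (measurableSet_firstObstacle v₀ z k)
      calc _ ≤ ∫⁻ ω, ∑' k, (firstObstacle V v₀ z k).indicator (T z) ω ∂μ := by
            refine lintegral_mono_ae ?_
            filter_upwards [ae_exists_le hV hq] with ω hω
            obtain ⟨k, hk⟩ := exists_firstObstacle hω z
            refine le_trans ?_ (ENNReal.le_tsum k)
            rw [Set.indicator_of_mem hk]
        _ = ∑' k, ∫⁻ ω, (firstObstacle V v₀ z k).indicator (T z) ω ∂μ :=
            lintegral_tsum fun k => ((hTm z).indicator (hFm k)).aemeasurable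
        _ ≤ _ := by
            refine ENNReal.tsum_le_tsum fun k => ?_
            have h := lintegral_firstObstacle_le hV hzy k (hΓ y z k) (hθ0 k) (hθ z k)
            simpa only [T, hzy, if_false] using h
  calc ∑' n : ℕ, crossMass μ V y n * n
      = ∫⁻ ω, ∑' n : ℕ, (killedStep {y}ᶜ fun z => V z ω)^[n] (Pi.single y 1) 0 * n ∂μ := by
        have hm : ∀ n, Measurable fun ω =>
            (killedStep {y}ᶜ fun z => V z ω)^[n] (Pi.single y 1) 0 := fun n =>
          measurable_killedStep_iterate (fun z _ => hV.meas z) _ n 0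
        rw [lintegral_tsum fun n => ((hm n).mul_const _).aemeasurable]
        congr 1; ext n
        rw [lintegral_mul_const _ (hm n)]
        rfl
    _ ≤ ∫⁻ ω, ∑' z, T z ω ∂μ :=
        lintegral_mono fun ω => tsum_hit_mul_natCast_le _ 0 y
    _ = ∑' z, ∫⁻ ω, T z ω ∂μ := lintegral_tsum fun z => (hTm z).aemeasurable
    _ ≤ ∑' z, ∑' k, c k * ∑ a ∈ latticeBox z k, visitMass μ V y a := ENNReal.tsum_le_tsum hT
    _ = ∑' k, c k * ((2 * k + 1) ^ d * ∑' a, visitMass μ V y a) := by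
        rw [ENNReal.tsum_comm]
        congr 1; ext k
        rw [ENNReal.tsum_mul_left]
        congr 1
        -- After exchanging the sums over z and a, each a is counted once for each of the (2k+1)^d
        -- sites z whose box contains it; this gives the second volume factor.
        have h1 : ∀ z : Fin d → ℤ, ∑ a ∈ latticeBox z k, visitMass μ V y a =
            ∑' a, if z ∈ latticeBox a k then visitMass μ V y a else 0 := fun z => by
          rw [tsum_eq_sum (s := latticeBox z k)
            fun a ha => if_neg fun h => ha (mem_latticeBox_comm.1 h)]
          exact Finset.sum_congr rfl fun a ha => (if_pos (mem_latticeBox_comm.1 ha)).symm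
        simp only [h1]
        rw [ENNReal.tsum_comm, ← ENNReal.tsum_mul_left]
        congr 1; ext a
        rw [tsum_eq_sum (s := latticeBox a k) fun z hz => if_neg hz,
          Finset.sum_congr rfl fun z hz => if_pos hz, Finset.sum_const, nsmul_eq_mul,
          card_latticeBox]
        have : (2 * (k : ℤ) + 1).toNat = 2 * k + 1 := by omega
        rw [this]; push_cast; rfl
    _ = _ := by
        rw [← ENNReal.tsum_mul_right]
        congr 1; ext k
        simp only [hc]
        ring

end Comparison

/-! ### Dimension at least two -/

section Barrier

lemma obstacle_pos {v₀ : ℝ≥0∞} (hv₀ : v₀ ≠ 0) : 1 - expNeg v₀ ≠ 0 :=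
  (tsub_pos_of_lt (expNeg_lt_one hv₀)).ne'

/-- In any dimension an obstacle at `w` bounds the Green function exponentially in the distance. -/
lemma green_single_le_of_obstacle [NeZero d] {A : Set (Fin d → ℤ)} {v : (Fin d → ℤ) → ℝ≥0∞}
    {v₀ : ℝ≥0∞} (hv₀ : v₀ ≠ 0) {w : Fin d → ℤ} (hw : v₀ ≤ v w) (b x : Fin d → ℤ) :
    green A v (Pi.single b 1) x ≤
      ((1 - expNeg v₀) * (2 * d : ℝ≥0∞)⁻¹ ^ latticeDist b w)⁻¹ := by
  set ε := 1 - expNeg v₀ with hε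
  have hεw : ε ≤ 1 - expNeg (v w) := tsub_le_tsub_left (expNeg_antitone hw) 1
  set ι := (2 * d : ℝ≥0∞)⁻¹ with hι
  have hι0 : ι ≠ 0 := ENNReal.inv_ne_zero.2 (ENNReal.mul_ne_top (by simp) (by simp))
  -- The barrier loses a factor 2d per step away from w, so one neighbour closer to w already
  -- accounts for ψ(x) in the average. It is cut off at the distance of b to vanish there; at w
  -- itself the killing takes over.
  let ψ : (Fin d → ℤ) → ℝ≥0∞ := fun x =>
    if latticeDist x w < latticeDist b w then ε * ι ^ latticeDist x w else 0
  have hstep : ∀ x, x ≠ w → latticeDist x w ≤ latticeDist b w →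
      ε * ι ^ latticeDist x w ≤ nbrAvg ψ x := by
    intro x hx hxb
    obtain ⟨p, hp, -, -⟩ := exists_unitStep_closer hx
    refine le_trans (le_of_eq ?_) (le_nbrAvg ψ x p)
    simp only [ψ]
    rw [if_pos (by omega), ← hp, pow_succ]
    ring
  refine green_single_le_of_barrier (mul_ne_zero (obstacle_pos hv₀) (pow_ne_zero _ hι0)) ψ
    (fun x => ?_) (by simp [ψ]) (fun x _ => ?_) ?_ x
  · simp only [ψ]
    split_ifs
    · exact mul_le_one' tsub_le_self (pow_le_one₀ zero_le two_mul_inv_le_one)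
    · exact zero_le
  · by_cases hx : latticeDist x w < latticeDist b w
    · have hψx : ψ x = ε * ι ^ latticeDist x w := if_pos hx
      rw [hψx]
      by_cases hxw : x = w
      · subst hxw
        right
        simpa [latticeDist_self] using hεw
      · left
        exact hstep x hxw hx.le
    · left
      have hψx : ψ x = 0 := if_neg hx
      rw [hψx]; exact zero_le
  · by_cases hbw : b = w
    · subst hbw
      right
      rw [latticeDist_self, pow_zero, mul_one]
      exact hεw
    · left
      exact hstep b hbw le_rfl

end Barrier

section Series

lemma two_mul_add_one_le_three_pow (k : ℕ) : 2 * k + 1 ≤ 3 ^ k := by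
  induction k with
  | zero => simp
  | succ k ih => rw [pow_succ]; omega

/-- The k-th term is (M q^k)^k and M q^k tends to 0, so eventually the terms are below 2^{-k}. -/
lemma tsum_pow_mul_pow_sq_ne_top {M q : ℝ≥0∞} (hM : M ≠ ⊤) (hq : q < 1) :
    ∑' k : ℕ, M ^ k * q ^ (k ^ 2) ≠ ⊤ := by
  have hlim : Tendsto (fun k : ℕ => M * q ^ k) atTop (𝓝 (M * 0)) :=
    ENNReal.Tendsto.const_mul (ENNReal.tendsto_pow_atTop_nhds_zero_of_lt_one hq) (Or.inr hM)
  rw [mul_zero] at hlim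
  obtain ⟨N, hN⟩ := eventually_atTop.1
    (hlim.eventually_le_const (u := (2 : ℝ≥0∞)⁻¹) (by simp))
  have hle : ∀ k : ℕ, M ^ k * q ^ (k ^ 2) ≤
      (if k ∈ Finset.range N then M ^ k * q ^ (k ^ 2) else 0) + (2 : ℝ≥0∞)⁻¹ ^ k := by
    intro k
    split_ifs with hk
    · exact le_self_add
    · rw [zero_add, sq, pow_mul, ← mul_pow]
      exact pow_le_pow_left₀ zero_le (hN k (by simpa using hk)) k
  refine ne_top_of_le_ne_top ?_ (ENNReal.tsum_le_tsum hle)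
  rw [ENNReal.tsum_add]
  refine ENNReal.add_ne_top.2 ⟨?_, ?_⟩
  · rw [tsum_eq_sum (s := Finset.range N) fun k hk => if_neg hk]
    refine ENNReal.sum_ne_top.2 fun k hk => ?_
    rw [if_pos hk]
    exact ENNReal.mul_ne_top (ENNReal.pow_ne_top hM) (ENNReal.pow_ne_top hq.ne_top)
  · rw [ENNReal.tsum_geometric, ENNReal.one_sub_inv_two, inv_inv]
    simp

end Series

section Threshold

variable {Ω : Type*} [MeasurableSpace Ω] {μ : Measure Ω} [IsProbabilityMeasure μ]

/-- The events X < 1/n decrease to X = 0; continuity from above yields a threshold. -/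
lemma exists_measure_lt_lt {X : Ω → ℝ≥0∞} (hX : Measurable X) {ρ : ℝ≥0∞}
    (hρ : μ {ω | X ω = 0} < ρ) : ∃ v₀ : ℝ≥0∞, v₀ ≠ 0 ∧ μ {ω | X ω < v₀} < ρ := by
  have hanti : Antitone fun n : ℕ => {ω | X ω < (n : ℝ≥0∞)⁻¹} := by
    intro m n hmn ω hω
    exact lt_of_lt_of_le hω (ENNReal.inv_le_inv.2 (by exact_mod_cast hmn))
  have hmeas : ∀ n : ℕ, NullMeasurableSet {ω | X ω < (n : ℝ≥0∞)⁻¹} μ := fun n =>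
    (measurableSet_lt hX measurable_const).nullMeasurableSet
  have hinter : ⋂ n : ℕ, {ω | X ω < (n : ℝ≥0∞)⁻¹} = {ω | X ω = 0} := by
    ext ω
    simp only [Set.mem_iInter, Set.mem_ofPred_eq]
    constructor
    · intro h
      by_contra h0
      obtain ⟨n, hn⟩ := ENNReal.exists_inv_nat_lt h0
      exact lt_asymm hn (h n)
    · intro h n
      rw [h]
      simp
  have hlim := tendsto_measure_iInter_atTop hmeas hanti ⟨0, measure_ne_top μ _⟩
  rw [hinter] at hlim
  obtain ⟨n, hn⟩ := (hlim.eventually_lt_const hρ).exists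
  exact ⟨(n : ℝ≥0∞)⁻¹, by simp, hn⟩

end Threshold

section HighDim

variable [NeZero d] {Ω : Type*} [MeasurableSpace Ω] {μ : Measure Ω} [IsProbabilityMeasure μ]
  {V : (Fin d → ℤ) → Ω → ℝ≥0∞}

/-- Since (2k-1)^d ≥ k² for d ≥ 2 and k ≥ 1, the obstacle-free probability is superexponentially
small and absorbs exponential losses from the Green functions, the crossings and the volumes. -/
lemma exists_tsum_crossMass_mul_le_of_two_le (hd : 2 ≤ d) (hV : IsIIDField μ V)
    (h0 : meanExp μ V ≠ 0) (hnz : μ {ω | V 0 ω = 0} < 1) :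
    ∃ C : ℝ≥0∞, C ≠ ⊤ ∧ ∀ y, ∑' n : ℕ, crossMass μ V y n * n ≤ C * ∑' a, visitMass μ V y a := by
  obtain ⟨v₀, hv₀, hq⟩ := exists_measure_lt_lt (hV.meas 0) hnz
  set q := μ {ω | V 0 ω < v₀} with hqdef
  set ε := 1 - expNeg v₀ with hε
  have hε0 : ε ≠ 0 := obstacle_pos hv₀
  set ι := (2 * d : ℝ≥0∞)⁻¹ with hι
  have hι0 : ι ≠ 0 := ENNReal.inv_ne_zero.2 (ENNReal.mul_ne_top (by simp) (by simp))
  have hι1 : ι ≤ 1 := two_mul_inv_le_one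
  set κ := ι * meanExp μ V with hκ
  have hκ0 : κ ≠ 0 := stepMass_ne_zero h0
  have hκ1 : κ ≤ 1 := stepMass_le_one
  refine ⟨_, ?_, tsum_crossMass_mul_le hV hq
    (Γ := fun k => (ε * ι ^ (d * (2 * k)))⁻¹) (θ := fun k => κ ^ (d * (2 * k) + 1)) ?_
    (fun k => pow_ne_zero _ hκ0) ?_⟩
  -- M collects the rates per unit of k: from Γ², from θ⁻¹, and from the squared volume through 2k +
  -- 1 ≤ 3^k.
  · set M : ℝ≥0∞ := ((ι⁻¹) ^ (2 * d)) ^ 2 * (κ⁻¹) ^ (2 * d) * (3 ^ d) ^ 2 with hM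
    have hMtop : M ≠ ⊤ := by
      refine ENNReal.mul_ne_top (ENNReal.mul_ne_top ?_ ?_) ?_
      · exact ENNReal.pow_ne_top (ENNReal.pow_ne_top (ENNReal.inv_ne_top.2 hι0))
      · exact ENNReal.pow_ne_top (ENNReal.inv_ne_top.2 hκ0)
      · exact ENNReal.pow_ne_top (ENNReal.pow_ne_top (by simp))
    have hle : ∀ k : ℕ, (ε * ι ^ (d * (2 * k)))⁻¹ ^ 2 * q ^ ((2 * k - 1) ^ d) *
        (κ ^ (d * (2 * k) + 1))⁻¹ * ((2 * k + 1) ^ d) ^ 2 ≤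
        (ε⁻¹ ^ 2 * κ⁻¹) * (M ^ k * q ^ (k ^ 2)) := by
      intro k
      have h1 : (ε * ι ^ (d * (2 * k)))⁻¹ = ε⁻¹ * ((ι⁻¹) ^ (2 * d)) ^ k := by
        rw [ENNReal.mul_inv (Or.inl hε0) (Or.inr (pow_ne_zero _ hι0)), ENNReal.inv_pow,
          ← pow_mul]
        congr 2; ring
      have h2 : (κ ^ (d * (2 * k) + 1))⁻¹ = κ⁻¹ * ((κ⁻¹) ^ (2 * d)) ^ k := by
        rw [ENNReal.inv_pow, ← pow_mul, ← pow_succ']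
        congr 1; ring
      have h3 : q ^ ((2 * k - 1) ^ d) ≤ q ^ (k ^ 2) := by
        refine pow_le_pow_of_le_one zero_le hq.le ?_
        rcases Nat.eq_zero_or_pos k with rfl | hk
        · simp
        · calc k ^ 2 ≤ (2 * k - 1) ^ 2 := Nat.pow_le_pow_left (by omega) 2
            _ ≤ (2 * k - 1) ^ d := Nat.pow_le_pow_right (by omega) hd
      have h4 : (2 * k + 1 : ℝ≥0∞) ≤ 3 ^ k := by
        exact_mod_cast two_mul_add_one_le_three_pow k
      rw [h1, h2]
      calc _ ≤ (ε⁻¹ * ((ι⁻¹) ^ (2 * d)) ^ k) ^ 2 * q ^ (k ^ 2) * (κ⁻¹ * ((κ⁻¹) ^ (2 * d)) ^ k) *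
            ((3 ^ k) ^ d) ^ 2 := by gcongr
        _ = _ := by
            rw [hM]
            ring
    refine ne_top_of_le_ne_top ?_ (ENNReal.tsum_le_tsum hle)
    rw [ENNReal.tsum_mul_left]
    exact ENNReal.mul_ne_top (ENNReal.mul_ne_top (ENNReal.pow_ne_top (ENNReal.inv_ne_top.2 hε0))
      (ENNReal.inv_ne_top.2 hκ0)) (tsum_pow_mul_pow_sq_ne_top hMtop hq)
  · rintro y z k v ⟨w, hw, hvw⟩ b hb x
    refine (green_single_le_of_obstacle hv₀ hvw b x).trans ?_
    rw [ENNReal.inv_le_inv]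
    gcongr 1
    exact pow_le_pow_of_le_one zero_le hι1 (latticeDist_le_of_mem_latticeBox hb hw)
  · intro z k a ha b hb
    have h := pow_le_lintegral_green hV (Finset.mem_Icc.1 ha) (Finset.mem_Icc.1 hb)
    rw [← Finset.coe_Icc] at h
    refine le_trans ?_ h
    exact pow_le_pow_of_le_one zero_le hκ1
      (Nat.succ_le_succ (latticeDist_le_of_mem_latticeBox ha hb))

end HighDim

/-! ### Dimension one -/

section Line

/-- The site of `ℤ^1` with coordinate `n`. -/
def site (n : ℤ) : Fin 1 → ℤ := fun _ => n

lemma site_apply (n : ℤ) (i : Fin 1) : site n i = n := rfl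

lemma site_coord (x : Fin 1 → ℤ) : site (x 0) = x := by
  ext i; rw [site_apply, Subsingleton.elim i 0]

lemma site_injective : Function.Injective site := fun _ _ h => congrFun h 0

lemma latticeDist_line (a b : Fin 1 → ℤ) : latticeDist a b = (a 0 - b 0).natAbs := by
  simp [latticeDist]

/-- The two neighbours of a site, in the order given by an orientation `s`. -/
lemma nbrAvg_site (f : (Fin 1 → ℤ) → ℝ≥0∞) {s : ℤ} (hs : s = 1 ∨ s = -1) (n : ℤ) :
    nbrAvg f (site n) = 2⁻¹ * f (site (n + s)) + 2⁻¹ * f (site (n - s)) := by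
  have h1 : site n + unitStep (0, true) = site (n + 1) := by
    ext i; simp [site, unitStep, Subsingleton.elim i 0]
  have h2 : site n + unitStep (0, false) = site (n - 1) := by
    ext i; simp [site, unitStep, Subsingleton.elim i 0, sub_eq_add_neg]
  have h : nbrAvg f (site n) = 2⁻¹ * f (site (n + 1)) + 2⁻¹ * f (site (n - 1)) := by
    unfold nbrAvg
    rw [Fintype.sum_prod_type]
    simp [h1, h2]
  rcases hs with rfl | rfl
  · exact h
  · rw [h, add_comm, sub_neg_eq_add, ← sub_eq_add_neg]

/-- In dimension one an obstacle at `w` bounds the Green function linearly in the distance. -/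
lemma green_single_le_of_obstacle_line {A : Set (Fin 1 → ℤ)} {v : (Fin 1 → ℤ) → ℝ≥0∞}
    {v₀ : ℝ≥0∞} (hv₀ : v₀ ≠ 0) {w : Fin 1 → ℤ} (hw : v₀ ≤ v w) (b x : Fin 1 → ℤ) {r : ℕ}
    (hr : latticeDist b w ≤ r) :
    green A v (Pi.single b 1) x ≤ ((1 - expNeg v₀) * (2⁻¹ * (r + 1 : ℝ≥0∞)⁻¹))⁻¹ := by
  set ε := 1 - expNeg v₀ with hε
  have hε0 : ε ≠ 0 := obstacle_pos hv₀
  have hεw : ε ≤ 1 - expNeg (v w) := tsub_le_tsub_left (expNeg_antitone hw) 1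
  have hr1 : (r + 1 : ℝ≥0∞)⁻¹ ≤ 1 := by rw [ENNReal.inv_le_one]; exact le_add_self
  have hδ0 : ε * (2⁻¹ * (r + 1 : ℝ≥0∞)⁻¹) ≠ 0 :=
    mul_ne_zero hε0 (mul_ne_zero (by simp) (ENNReal.inv_ne_zero.2 (by simp)))
  -- If the pole is the obstacle, killing at b alone gives the escape weight and the zero barrier is
  -- enough.
  by_cases hbw : b = w
  · subst hbw
    refine green_single_le_of_barrier hδ0 (fun _ => 0) (fun _ => zero_le) rfl
      (fun x _ => Or.inl zero_le) (Or.inr (le_trans ?_ hεw)) x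
    exact mul_le_of_le_one_right zero_le (mul_le_one' (by simp) hr1)
  obtain ⟨s, hs, ρ, hρ, hwb⟩ : ∃ s : ℤ, (s = 1 ∨ s = -1) ∧ ∃ ρ : ℕ, 0 < ρ ∧ w 0 = b 0 + s * ρ := by
    have hne : b 0 ≠ w 0 := fun h => hbw (by rw [← site_coord b, ← site_coord w, h])
    rcases lt_or_gt_of_ne hne with h | h
    · exact ⟨1, Or.inl rfl, (w 0 - b 0).toNat, by omega, by omega⟩
    · exact ⟨-1, Or.inr rfl, (b 0 - w 0).toNat, by omega, by omega⟩
  have hss : s * s = 1 := by rcases hs with rfl | rfl <;> rfl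
  have hρr : ρ ≤ r := by
    rw [latticeDist_line] at hr
    rcases hs with rfl | rfl <;> omega
  have hρ0 : (ρ : ℝ≥0∞) ≠ 0 := by exact_mod_cast hρ.ne'
  -- The barrier is 0 behind b, rises linearly from b to w and is constant beyond w. Its only
  -- concave kink is at w, where the killing compensates.
  let T : ℤ → ℕ := fun n => min (s * (n - b 0)).toNat ρ
  let ψ : (Fin 1 → ℤ) → ℝ≥0∞ := fun x => ε * ((ρ : ℝ≥0∞)⁻¹ * T (x 0))
  have hT1 : ∀ n, s * (n + s - b 0) = s * (n - b 0) + 1 := fun n => by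
    rw [← hss]; ring
  have hT2 : ∀ n, s * (n - s - b 0) = s * (n - b 0) - 1 := fun n => by
    rw [← hss]; ring
  have havg : ∀ n : ℤ, nbrAvg ψ (site n) =
      ε * ((ρ : ℝ≥0∞)⁻¹ * (2⁻¹ * ((T (n + s) + T (n - s) : ℕ) : ℝ≥0∞))) := fun n => by
    rw [nbrAvg_site ψ hs]
    simp only [ψ, site_apply]
    push_cast
    ring
  refine green_single_le_of_barrier hδ0 ψ (fun x => ?_) (by simp [ψ, T]) (fun x hx => ?_) ?_ x
  · refine mul_le_one' tsub_le_self ?_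
    rw [mul_comm, ← div_eq_mul_inv]
    refine ENNReal.div_le_of_le_mul ?_
    rw [one_mul]
    exact_mod_cast min_le_right _ _
  · by_cases hxw : x = w
    · right
      refine le_trans (mul_le_of_le_one_right zero_le ?_) (hxw ▸ hεw)
      rw [mul_comm, ← div_eq_mul_inv]
      refine ENNReal.div_le_of_le_mul ?_
      rw [one_mul]
      exact_mod_cast min_le_right _ _
    · left
      have hx0 : s * (x 0 - b 0) ≠ 0 := fun h => hx (by
        rw [← site_coord x, ← site_coord b]
        congr 1
        rcases hs with rfl | rfl <;> omega)
      have hxρ : s * (x 0 - b 0) ≠ ρ := fun h => hxw (by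
        rw [← site_coord x, ← site_coord w]
        congr 1
        rcases hs with rfl | rfl <;> omega)
      rw [← site_coord x, havg]
      have hle : 2 * T (x 0) ≤ T (x 0 + s) + T (x 0 - s) := by
        simp only [T, hT1, hT2]
        omega
      have hle' : (2 : ℝ≥0∞) * T (x 0) ≤ ((T (x 0 + s) + T (x 0 - s) : ℕ) : ℝ≥0∞) := by
        exact_mod_cast hle
      simp only [ψ, site_apply]
      gcongr
      calc (T (x 0) : ℝ≥0∞) = 2⁻¹ * (2 * T (x 0)) := by
            rw [← mul_assoc, ENNReal.inv_mul_cancel (by simp) (by simp), one_mul]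
        _ ≤ _ := by gcongr
  · left
    rw [← site_coord b, havg]
    have hT : 1 ≤ T (b 0 + s) + T (b 0 - s) := by
      simp only [T, hT1, hT2, sub_self, mul_zero]
      omega
    rw [mul_left_comm ((ρ : ℝ≥0∞)⁻¹)]
    gcongr ε * (2⁻¹ * ?_)
    calc (r + 1 : ℝ≥0∞)⁻¹ ≤ (ρ : ℝ≥0∞)⁻¹ * 1 := by
          rw [mul_one, ENNReal.inv_le_inv]
          exact_mod_cast hρr.trans (Nat.le_succ r)
      _ ≤ _ := by gcongr; exact_mod_cast hT

/-- The sites `a, a + s, …, a + (m - 1) s`. -/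
def segment (a s : ℤ) (m : ℕ) : Set (Fin 1 → ℤ) := {x | ∃ j : ℕ, j < m ∧ x = site (a + s * j)}

lemma site_mem_segment {a s : ℤ} (hs : s = 1 ∨ s = -1) {m : ℕ} {j : ℤ} :
    site (a + s * j) ∈ segment a s m ↔ 0 ≤ j ∧ j < m := by
  constructor
  · rintro ⟨i, hi, h⟩
    have h := site_injective h
    have : j = i := by rcases hs with rfl | rfl <;> omega
    omega
  · rintro ⟨h0, h⟩
    refine ⟨j.toNat, by omega, ?_⟩
    rw [Int.toNat_of_nonneg h0]

/-- The gambler ruin probability. -/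
lemma green_segment_of_zero {a s : ℤ} (hs : s = 1 ∨ s = -1) (n : ℕ)
    {v : (Fin 1 → ℤ) → ℝ≥0∞} (hv : ∀ x ∈ segment a s n, v x = 0) :
    green (segment a s n) v (Pi.single (site (a + s * n)) 1) (site a) = (n + 1 : ℝ≥0∞)⁻¹ := by
  set u := green (segment a s n) v (Pi.single (site (a + s * n)) 1) with hu
  have hend : site (a + s * n) ∉ segment a s n := by
    rw [site_mem_segment hs]; omega
  have hu1 : ∀ x, u x ≠ ⊤ := fun x =>
    ne_top_of_le_ne_top ENNReal.one_ne_top (hit_le_one hend x)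
  let h : ℤ → ℝ := fun j => (u (site (a + s * j))).toReal
  -- The site just before the start is already outside the segment. Thus h is harmonic, hence
  -- affine, with value 0 at -1 and 1 at n, and h 0 = 1/(n+1).
  have hneg : h (-1) = 0 := by
    have hne : site (a + s * (-1)) ≠ site (a + s * n) := fun h => by
      have := site_injective h
      rcases hs with rfl | rfl <;> omega
    have hnot : site (a + s * (-1)) ∉ segment a s n := by
      rw [site_mem_segment hs]; omega
    simp only [h, hu]
    rw [green_of_notMem hnot, Pi.single_eq_of_ne hne, ENNReal.toReal_zero]
  have hn : h n = 1 := by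
    simp only [h, hu]
    rw [hit_self hend, ENNReal.toReal_one]
  have hrec : ∀ j : ℕ, j < n → 2 * h j = h (j + 1) + h (j - 1) := by
    intro j hj
    have hmem : site (a + s * (j : ℤ)) ∈ segment a s n := (site_mem_segment hs).2 (by omega)
    have hne : site (a + s * (j : ℤ)) ≠ site (a + s * n) := fun h => by
      have := site_injective h
      rcases hs with rfl | rfl <;> omega
    have heq : u (site (a + s * j)) =
        2⁻¹ * u (site (a + s * (j + 1))) + 2⁻¹ * u (site (a + s * (j - 1))) := by
      conv_lhs => rw [hu, green_eq, Pi.single_eq_of_ne hne, zero_add, killedStep_of_mem hmem,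
        hv _ hmem, expNeg_zero, one_mul, nbrAvg_site _ hs]
      congr 4 <;> ring
    simp only [h]
    rw [heq, ENNReal.toReal_add (ENNReal.mul_ne_top (by simp) (hu1 _))
      (ENNReal.mul_ne_top (by simp) (hu1 _)), ENNReal.toReal_mul, ENNReal.toReal_mul]
    simp
    ring
  have hlin : ∀ j : ℕ, j ≤ n → h j = (j + 1) * h 0 ∧ h (j - 1) = j * h 0 := by
    intro j hj
    induction j with
    | zero => simpa using hneg
    | succ j ih =>
      obtain ⟨h1, h2⟩ := ih (by omega)
      have h3 := hrec j (by omega)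
      push_cast
      rw [add_sub_cancel_right]
      constructor <;> linarith
  have hfin := (hlin n le_rfl).1
  rw [hn] at hfin
  have h0 : h 0 = (n + 1 : ℝ)⁻¹ := by
    exact eq_inv_of_mul_eq_one_left (by linarith)
  have h00 : (u (site a)).toReal = (n + 1 : ℝ)⁻¹ := by
    rw [← h0]; simp [h]
  rw [← ENNReal.ofReal_toReal (hu1 (site a)), h00, ENNReal.ofReal_inv_of_pos (by positivity)]
  congr 1
  rw [ENNReal.ofReal_add (by positivity) zero_le_one, ENNReal.ofReal_natCast, ENNReal.ofReal_one]

/-- Lower bound for crossing a segment whose first `g + 1` sites are free, except the last one. -/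
lemma le_green_segment {a s : ℤ} (hs : s = 1 ∨ s = -1) {m g : ℕ} (hg : g < m)
    {v : (Fin 1 → ℤ) → ℝ≥0∞} (hv : ∀ x ∈ segment a s g, v x = 0) :
    (g + 1 : ℝ≥0∞)⁻¹ * (expNeg (v (site (a + s * g))) * 2⁻¹) *
        green (segment (a + s * (g + 1)) s (m - 1 - g)) v (Pi.single (site (a + s * m)) 1)
          (site (a + s * (g + 1))) ≤
      green (segment a s m) v (Pi.single (site (a + s * m)) 1) (site a) := by
  set u := green (segment a s m) v (Pi.single (site (a + s * m)) 1) with hu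
  have hsup : ∀ x ∈ segment a s m, expNeg (v x) * nbrAvg u x ≤ u x := fun x hx => by
    conv_rhs => rw [hu, green_eq, killedStep_of_mem hx]
    exact le_add_self
  have hsub : segment a s g ⊆ segment a s m := by
    rintro x ⟨j, hj, rfl⟩; exact ⟨j, by omega, rfl⟩
  have hsub' : segment (a + s * (g + 1)) s (m - 1 - g) ⊆ segment a s m := by
    rintro x ⟨j, hj, rfl⟩
    refine ⟨g + 1 + j, by omega, ?_⟩
    congr 1; push_cast; ring
  -- Gambler's ruin carries the walk over the g free sites. One step forward, with factor exp(-v)/2,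
  -- then leads past site g into the remaining segment.
  have h1 := hit_mul_le (v := v) (A := segment a s g) (b := site (a + s * g))
    (by rw [site_mem_segment hs]; omega) (fun x hx => hsup x (hsub hx)) (site a)
  rw [green_segment_of_zero hs g hv] at h1
  refine le_trans ?_ h1
  rw [mul_assoc]
  gcongr
  refine le_trans ?_ (hsup _ ((site_mem_segment hs).2 ⟨by omega, by omega⟩))
  rw [mul_assoc]
  gcongr
  rw [nbrAvg_site u hs]
  refine le_trans ?_ le_self_add
  rw [show a + s * (g : ℤ) + s = a + s * (g + 1) by ring]
  gcongr
  exact green_mono_set hsub' _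

end Line

/-! ### A supercritical renewal inequality -/

section Renewal

/-- The harmonic series makes the renewal equation supercritical at `p₀`. -/
lemma exists_supercritical {p₀ s : ℝ} (hp0 : 0 ≤ p₀) (hp1 : p₀ < 1) (hs : 0 < s) :
    ∃ ρ : ℝ, p₀ < ρ ∧ ρ ≤ 1 ∧ ∃ N : ℕ, 0 < N ∧
      1 ≤ ∑ g ∈ Finset.range N, s * p₀ ^ g / (g + 1) * (ρ⁻¹) ^ (g + 1) := by
  rcases hp0.eq_or_lt with h0 | h0
  · subst h0
    -- For p₀ = 0 only the term g = 0 survives, and it equals s / ρ.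
    refine ⟨min s 1, lt_min hs one_pos, min_le_right _ _, 1, one_pos, ?_⟩
    have hm : 0 < min s 1 := lt_min hs one_pos
    simp only [Finset.range_one, Finset.sum_singleton, pow_zero, mul_one, Nat.cast_zero, zero_add,
      div_one, pow_one]
    rw [← div_eq_mul_inv, one_le_div hm]
    exact min_le_left _ _
  -- At ρ = p₀ the g-th term is s / (p₀ (g+1)), so some partial sum exceeds 1 by divergence of the
  -- harmonic series; by continuity the same finite sum exceeds 1 for some ρ slightly above p₀.
  · have hdiv : Tendsto (fun N : ℕ => s / p₀ * ∑ g ∈ Finset.range N, (1 / ((g : ℝ) + 1))) atTop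
        atTop :=
      Real.tendsto_sum_range_one_div_nat_succ_atTop.const_mul_atTop (by positivity)
    obtain ⟨N, hN, hN0⟩ := ((hdiv.eventually_gt_atTop 1).and (eventually_gt_atTop 0)).exists
    let F : ℝ → ℝ := fun ρ => ∑ g ∈ Finset.range N, s * p₀ ^ g / (g + 1) * (ρ⁻¹) ^ (g + 1)
    have hF : F p₀ = s / p₀ * ∑ g ∈ Finset.range N, (1 / ((g : ℝ) + 1)) := by
      simp only [F, Finset.mul_sum]
      refine Finset.sum_congr rfl fun g _ => ?_
      rw [inv_pow, pow_succ]
      field_simp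
    have hcont : ContinuousAt F p₀ := by
      refine tendsto_finsetSum _ fun g _ => ?_
      exact ((continuousAt_inv₀ h0.ne').pow _).const_mul _
    have hev : ∀ᶠ ρ in 𝓝[>] p₀, 1 < F ρ :=
      (hcont.eventually (lt_mem_nhds (by rw [hF]; exact hN))).filter_mono nhdsWithin_le_nhds
    obtain ⟨ρ, hρF, hρ1, hρ2⟩ := (hev.and (Ioo_mem_nhdsGT hp1)).exists
    exact ⟨ρ, hρ1, hρ2.le, N, hN0, hρF.le⟩

/-- For m ≥ N, supercriticality makes c ρ^m a subsolution of the renewal inequality, so strong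
induction applies. For m < N the bound L m ≥ s^m, from the terms g = 0 alone, suffices if c is
small. -/
lemma exists_renewal_lower_bound {p₀ s : ℝ} (hp0 : 0 ≤ p₀) (hp1 : p₀ < 1) (hs : 0 < s) :
    ∃ ρ c : ℝ, p₀ < ρ ∧ ρ ≤ 1 ∧ 0 < c ∧ ∀ L : ℕ → ℝ≥0∞, 1 ≤ L 0 →
      (∀ m, ∑ g ∈ Finset.range m, ENNReal.ofReal (s * p₀ ^ g / (g + 1)) * L (m - 1 - g) ≤ L m) →
      ∀ m, ENNReal.ofReal (c * ρ ^ m) ≤ L m := by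
  obtain ⟨ρ, hρ, hρ1, N, hN, hsum⟩ := exists_supercritical hp0 hp1 hs
  have hρ0 : 0 < ρ := hp0.trans_lt hρ
  -- This choice gives tρ ≤ s and t ≤ 1, hence t^N ρ^m ≤ s^m for all m < N.
  set t := min 1 (s / ρ) with ht
  have ht0 : 0 < t := lt_min one_pos (by positivity)
  have ht1 : t ≤ 1 := min_le_left _ _
  refine ⟨ρ, t ^ N, hρ, hρ1, by positivity, fun L hL0 hL m => ?_⟩
  have hpow : ∀ m, ENNReal.ofReal (s ^ m) ≤ L m := by
    intro m
    induction m with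
    | zero => simpa using hL0
    | succ m ih =>
      refine le_trans ?_ ((Finset.single_le_sum (f := fun g : ℕ =>
        ENNReal.ofReal (s * p₀ ^ g / (g + 1)) * L (m + 1 - 1 - g)) (fun _ _ => zero_le)
        (Finset.mem_range.2 (Nat.succ_pos m))).trans (hL (m + 1)))
      simp only [pow_zero, mul_one, Nat.cast_zero, zero_add, div_one, Nat.add_sub_cancel,
        Nat.sub_zero]
      rw [pow_succ, mul_comm, ENNReal.ofReal_mul hs.le]
      gcongr
  induction m using Nat.strong_induction_on with
  | _ m ih =>
    rcases lt_or_ge m N with hm | hm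
    · refine le_trans (ENNReal.ofReal_le_ofReal ?_) (hpow m)
      calc t ^ N * ρ ^ m ≤ t ^ m * ρ ^ m :=
            mul_le_mul_of_nonneg_right (pow_le_pow_of_le_one ht0.le ht1 hm.le) (by positivity)
        _ = (t * ρ) ^ m := (mul_pow _ _ _).symm
        _ ≤ s ^ m := by
            gcongr
            calc t * ρ ≤ s / ρ * ρ := by gcongr; exact min_le_right _ _
              _ = s := div_mul_cancel₀ _ hρ0.ne'
    · have hterm : ∀ g ∈ Finset.range N, s * p₀ ^ g / (g + 1) * (ρ⁻¹) ^ (g + 1) *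
          (t ^ N * ρ ^ m) = s * p₀ ^ g / (g + 1) * (t ^ N * ρ ^ (m - 1 - g)) := by
        intro g hg
        have hg := Finset.mem_range.1 hg
        have : ρ ^ m = ρ ^ (m - 1 - g) * ρ ^ (g + 1) := by
          rw [← pow_add]; congr 1; omega
        rw [this, inv_pow]
        field_simp
      calc ENNReal.ofReal (t ^ N * ρ ^ m)
          ≤ ENNReal.ofReal (∑ g ∈ Finset.range N,
            s * p₀ ^ g / (g + 1) * (t ^ N * ρ ^ (m - 1 - g))) := by
            refine ENNReal.ofReal_le_ofReal ?_
            rw [← Finset.sum_congr rfl hterm, ← Finset.sum_mul]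
            exact le_mul_of_one_le_left (by positivity) hsum
        _ = ∑ g ∈ Finset.range N, ENNReal.ofReal (s * p₀ ^ g / (g + 1)) *
            ENNReal.ofReal (t ^ N * ρ ^ (m - 1 - g)) := by
            rw [ENNReal.ofReal_sum_of_nonneg fun g _ => by positivity]
            exact Finset.sum_congr rfl fun g _ => ENNReal.ofReal_mul (by positivity)
        _ ≤ ∑ g ∈ Finset.range N, ENNReal.ofReal (s * p₀ ^ g / (g + 1)) * L (m - 1 - g) := by
            gcongr with g hg
            exact ih _ (by have := Finset.mem_range.1 hg; omega)
        _ ≤ ∑ g ∈ Finset.range m, ENNReal.ofReal (s * p₀ ^ g / (g + 1)) * L (m - 1 - g) :=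
            Finset.sum_le_sum_of_subset (Finset.range_subset_range.2 hm)
        _ ≤ L m := hL m

end Renewal

/-! ### Annealed crossing of segments of the line -/

section AnnealedLine

variable {Ω : Type*} {V : (Fin 1 → ℤ) → Ω → ℝ≥0∞}

/-- The indicator of the event that the first site of the segment `a, a + s, …` where the potential
does not vanish is `a + s g`, and that the potential is at most `M` there. -/
def firstPositive (V : (Fin 1 → ℤ) → Ω → ℝ≥0∞) (M : ℝ≥0∞) (a s : ℤ) (g : ℕ) (ω : Ω) : ℝ≥0∞ :=
  (∏ j ∈ Finset.range g, ({0} : Set ℝ≥0∞).indicator 1 (V (site (a + s * j)) ω)) *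
    (Set.Ioc 0 M).indicator 1 (V (site (a + s * g)) ω)

lemma indicator_one_le_one {α : Type*} (S : Set α) (x : α) :
    S.indicator (1 : α → ℝ≥0∞) x ≤ 1 := by
  by_cases h : x ∈ S <;> simp [h]

lemma firstPositive_le_one (M : ℝ≥0∞) (a s : ℤ) (g : ℕ) (ω : Ω) : firstPositive V M a s g ω ≤ 1 :=
  mul_le_one' (Finset.prod_le_one' fun _ _ => indicator_one_le_one _ _) (indicator_one_le_one _ _)

lemma of_firstPositive_ne_zero {M : ℝ≥0∞} {a s : ℤ} {g : ℕ} {ω : Ω}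
    (h : firstPositive V M a s g ω ≠ 0) :
    (∀ j < g, V (site (a + s * j)) ω = 0) ∧ 0 < V (site (a + s * g)) ω ∧
      V (site (a + s * g)) ω ≤ M := by
  have h1 := left_ne_zero_of_mul h
  have h2 := right_ne_zero_of_mul h
  rw [Finset.prod_ne_zero_iff] at h1
  refine ⟨fun j hj => ?_, ?_⟩
  · by_contra hne
    exact h1 j (Finset.mem_range.2 hj) (Set.indicator_of_notMem (by simpa using hne) _)
  · by_contra hne
    exact h2 (Set.indicator_of_notMem (fun hm => hne (Set.mem_Ioc.1 hm)) _)

lemma measurable_firstPositive (M : ℝ≥0∞) {a s : ℤ} (hs : s = 1 ∨ s = -1) (g : ℕ) :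
    Measurable[sitesAlgebra V (segment a s (g + 1))] (firstPositive V M a s g) := by
  have h : ∀ j : ℕ, j ≤ g → Measurable[sitesAlgebra V (segment a s (g + 1))]
      (V (site (a + s * j))) := fun j hj =>
    measurable_sitesAlgebra ((site_mem_segment hs).2 ⟨by omega, by push_cast; omega⟩)
  refine Measurable.mul (Finset.measurable_fun_prod _ fun j hj => ?_) ?_
  · exact (measurable_one.indicator (measurableSet_singleton 0)).comp
      (h j (Finset.mem_range.1 hj).le)
  · exact (measurable_one.indicator measurableSet_Ioc).comp (h g le_rfl)

variable [MeasurableSpace Ω] {μ : Measure Ω}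

/-- The annealed weight of crossing a segment of `m` sites without leaving it. -/
def segmentMass (μ : Measure Ω) (V : (Fin 1 → ℤ) → Ω → ℝ≥0∞) (a s : ℤ) (m : ℕ) : ℝ≥0∞ :=
  ∫⁻ ω, green (segment a s m) (fun z => V z ω) (Pi.single (site (a + s * m)) 1) (site a) ∂μ

lemma exists_measure_pos_le {X : Ω → ℝ≥0∞} (h : 0 < μ {ω | 0 < X ω ∧ X ω < ⊤}) :
    ∃ M : ℕ, 0 < μ {ω | 0 < X ω ∧ X ω ≤ M} := by
  by_contra! hcon
  have hsub : {ω | 0 < X ω ∧ X ω < ⊤} ⊆ ⋃ M : ℕ, {ω | 0 < X ω ∧ X ω ≤ M} := by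
    rintro ω ⟨h1, h2⟩
    obtain ⟨n, hn⟩ := ENNReal.exists_nat_gt h2.ne
    exact Set.mem_iUnion.2 ⟨n, h1, hn.le⟩
  have : μ {ω | 0 < X ω ∧ X ω < ⊤} = 0 :=
    measure_mono_null hsub (measure_iUnion_null fun M => le_antisymm (hcon M) zero_le)
  exact h.ne' this

/-- A crossing from a to b can run along the segment between them, which has at most 2k sites and
omits b; hence its weight is independent of V b. -/
lemma le_lintegral_green_latticeBox (hV : IsIIDField μ V) {ρ c : ℝ} (hρ0 : 0 ≤ ρ) (hρ1 : ρ ≤ 1)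
    (hc : 0 < c) (hseg : ∀ (a s : ℤ) (_ : s = 1 ∨ s = -1) (m : ℕ),
        ENNReal.ofReal (c * ρ ^ m) ≤ segmentMass μ V a s m)
    {z a b : Fin 1 → ℤ} {k : ℕ} (ha : a ∈ latticeBox z k) (hb : b ∈ latticeBox z k) :
    ENNReal.ofReal (c * ρ ^ (2 * k)) * meanExp μ V ≤ ∫⁻ ω,
      green ((latticeBox z k : Set (Fin 1 → ℤ)) \ {b}) (fun z => V z ω) (Pi.single b 1) a *
        expNeg (V b ω) ∂μ := by
  have ha0 := mem_latticeBox.1 ha 0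
  have hb0 := mem_latticeBox.1 hb 0
  obtain ⟨s, hs, m, hm⟩ : ∃ s : ℤ, (s = 1 ∨ s = -1) ∧ ∃ m : ℕ, b 0 = a 0 + s * m := by
    rcases le_total (a 0) (b 0) with h | h
    · exact ⟨1, Or.inl rfl, (b 0 - a 0).toNat, by omega⟩
    · exact ⟨-1, Or.inr rfl, (a 0 - b 0).toNat, by omega⟩
  have hbs : b = site (a 0 + s * m) := by rw [← hm, site_coord]
  have hmk : m ≤ 2 * k := by rcases hs with rfl | rfl <;> omega
  have hbn : b ∉ segment (a 0) s m := by
    rw [hbs, site_mem_segment hs]; omega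
  have hsub : segment (a 0) s m ⊆ (latticeBox z k : Set (Fin 1 → ℤ)) \ {b} := by
    rintro x ⟨j, hj, rfl⟩
    refine ⟨?_, ?_⟩
    · rw [Finset.mem_coe, mem_latticeBox]
      intro i
      rw [Subsingleton.elim i 0, site_apply]
      rcases hs with rfl | rfl <;> omega
    · intro h
      rw [Set.mem_singleton_iff, hbs] at h
      have := site_injective h
      rcases hs with rfl | rfl <;> omega
  calc _ ≤ segmentMass μ V (a 0) s m * meanExp μ V := by
        gcongr
        refine le_trans (ENNReal.ofReal_le_ofReal ?_) (hseg (a 0) s hs m)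
        exact mul_le_mul_of_nonneg_left (pow_le_pow_of_le_one hρ0 hρ1 hmk) hc.le
    _ = (∫⁻ ω, green (segment (a 0) s m) (fun z => V z ω) (Pi.single b 1) a ∂μ) *
        ∫⁻ ω, expNeg (V b ω) ∂μ := by
        rw [hV.lintegral_comp measurable_expNeg b, segmentMass, ← hbs, site_coord]
        rfl
    _ = ∫⁻ ω, green (segment (a 0) s m) (fun z => V z ω) (Pi.single b 1) a *
        expNeg (V b ω) ∂μ := by
        refine (hV.lintegral_mul (S := segment (a 0) s m) (T := {b}) (by simpa using hbn)
          (measurable_green (fun z hz => measurable_sitesAlgebra hz) _ _)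
          (measurable_expNeg.comp (measurable_sitesAlgebra rfl))).symm
    _ ≤ _ := by
        refine lintegral_mono fun ω => ?_
        gcongr
        exact green_mono_set hsub a

variable [IsProbabilityMeasure μ]

lemma lintegral_firstPositive (hV : IsIIDField μ V) (M : ℝ≥0∞) {a s : ℤ}
    (hs : s = 1 ∨ s = -1) (g : ℕ) :
    ∫⁻ ω, firstPositive V M a s g ω ∂μ =
      μ {ω | V 0 ω = 0} ^ g * μ {ω | 0 < V 0 ω ∧ V 0 ω ≤ M} := by
  classical
  have hinj : Set.InjOn (fun j : ℕ => site (a + s * j)) (Finset.range (g + 1)) := by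
    intro i _ j _ h
    have := site_injective h
    rcases hs with rfl | rfl <;> omega
  have hm1 : Measurable (({0} : Set ℝ≥0∞).indicator (1 : ℝ≥0∞ → ℝ≥0∞)) :=
    measurable_one.indicator (measurableSet_singleton 0)
  have hm2 : Measurable ((Set.Ioc 0 M).indicator (1 : ℝ≥0∞ → ℝ≥0∞)) :=
    measurable_one.indicator measurableSet_Ioc
  have e1 : ∫⁻ ω, ({0} : Set ℝ≥0∞).indicator (1 : ℝ≥0∞ → ℝ≥0∞) (V 0 ω) ∂μ =
      μ {ω | V 0 ω = 0} := by
    rw [← lintegral_indicator_one (measurableSet_eq_fun (hV.meas 0) measurable_const)]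
    exact lintegral_congr fun ω => by by_cases h : V 0 ω = 0 <;> simp [h]
  have e2 : ∫⁻ ω, (Set.Ioc 0 M).indicator (1 : ℝ≥0∞ → ℝ≥0∞) (V 0 ω) ∂μ =
      μ {ω | 0 < V 0 ω ∧ V 0 ω ≤ M} := by
    have hset : MeasurableSet {ω | 0 < V 0 ω ∧ V 0 ω ≤ M} :=
      (measurableSet_lt measurable_const (hV.meas 0)).inter
        (measurableSet_le (hV.meas 0) measurable_const)
    rw [← lintegral_indicator_one hset]
    exact lintegral_congr fun ω => by
      by_cases h : 0 < V 0 ω ∧ V 0 ω ≤ M <;> simp [Set.indicator, h]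
  let G : (Fin 1 → ℤ) → ℝ≥0∞ → ℝ≥0∞ := fun z =>
    if z = site (a + s * g) then (Set.Ioc 0 M).indicator 1 else ({0} : Set ℝ≥0∞).indicator 1
  have hG : ∀ z, Measurable (G z) := fun z => by
    simp only [G]; split_ifs
    · exact hm2
    · exact hm1
  have hGj : ∀ j ∈ Finset.range g, G (site (a + s * j)) = ({0} : Set ℝ≥0∞).indicator 1 := by
    intro j hj
    refine if_neg fun h => ?_
    have hj := Finset.mem_range.1 hj
    have := site_injective h
    rcases hs with rfl | rfl <;> omega
  have hGg : G (site (a + s * g)) = (Set.Ioc 0 M).indicator 1 := if_pos rfl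
  have hprod := hV.lintegral_prod ((Finset.range (g + 1)).image fun j : ℕ => site (a + s * j)) hG
  rw [Finset.prod_image hinj, Finset.prod_range_succ,
    Finset.prod_congr rfl fun j hj => by rw [hGj j hj, e1], hGg, e2, Finset.prod_const,
    Finset.card_range] at hprod
  rw [← hprod]
  refine lintegral_congr fun ω => ?_
  rw [Finset.prod_image hinj, Finset.prod_range_succ, hGg,
    Finset.prod_congr rfl fun j hj => by rw [hGj j hj]]
  rfl

/-- Decompose at the first site a + sg with nonzero potential, kept only if the potential there is
at most M. The g free sites cost 1/(g+1), the obstacle at most a fixed factor, and the rest of the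
segment is independent. -/
lemma segmentMass_renewal (hV : IsIIDField μ V) (M : ℝ≥0∞) {a s : ℤ} (hs : s = 1 ∨ s = -1)
    (m : ℕ) :
    ∑ g ∈ Finset.range m, μ {ω | V 0 ω = 0} ^ g * μ {ω | 0 < V 0 ω ∧ V 0 ω ≤ M} *
        ((g + 1 : ℝ≥0∞)⁻¹ * (expNeg M * 2⁻¹)) * segmentMass μ V (a + s * (g + 1)) s (m - 1 - g) ≤
      segmentMass μ V a s m := by
  let tail : ℕ → Ω → ℝ≥0∞ := fun g ω =>
    green (segment (a + s * (g + 1)) s (m - 1 - g)) (fun z => V z ω)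
      (Pi.single (site (a + s * m)) 1) (site (a + s * (g + 1)))
  have htail : ∀ g ∈ Finset.range m,
      ∫⁻ ω, tail g ω ∂μ = segmentMass μ V (a + s * (g + 1)) s (m - 1 - g) := by
    intro g hg
    have hg := Finset.mem_range.1 hg
    have : a + s * (g + 1) + s * ((m - 1 - g : ℕ) : ℤ) = a + s * m := by
      rw [Nat.cast_sub (by omega), Nat.cast_sub (by omega)]; push_cast; ring
    simp only [tail, segmentMass, this]
  have hdisj : ∀ g, Disjoint (segment a s (g + 1)) (segment (a + s * (g + 1)) s (m - 1 - g)) := by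
    intro g
    rw [Set.disjoint_left]
    rintro x ⟨j, hj, rfl⟩ ⟨i, hi, h⟩
    have := site_injective h
    rcases hs with rfl | rfl <;> omega
  have hpt : ∀ ω, ∑ g ∈ Finset.range m, ((g + 1 : ℝ≥0∞)⁻¹ * (expNeg M * 2⁻¹)) *
      (firstPositive V M a s g ω * tail g ω) ≤
      green (segment a s m) (fun z => V z ω) (Pi.single (site (a + s * m)) 1) (site a) := by
    intro ω
    -- The events for different g are disjoint, so at most one term of the sum is nonzero.
    by_cases hex : ∃ g ∈ Finset.range m, firstPositive V M a s g ω ≠ 0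
    · obtain ⟨g, hg, hne⟩ := hex
      obtain ⟨h1, h2, h3⟩ := of_firstPositive_ne_zero hne
      rw [Finset.sum_eq_single_of_mem g hg]
      · refine le_trans ?_ (le_green_segment hs (Finset.mem_range.1 hg) (v := fun z => V z ω) ?_)
        · calc _ ≤ ((g + 1 : ℝ≥0∞)⁻¹ * (expNeg M * 2⁻¹)) * (1 * tail g ω) := by
                gcongr; exact firstPositive_le_one M a s g ω
            _ ≤ _ := by
                rw [one_mul]
                gcongr
                exact expNeg_antitone h3
        · rintro x ⟨j, hj, rfl⟩
          exact h1 j hj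
      · intro g' _ hne'
        have : firstPositive V M a s g' ω = 0 := by
          by_contra h
          obtain ⟨h1', h2', -⟩ := of_firstPositive_ne_zero h
          rcases lt_or_gt_of_ne hne' with hlt | hlt
          · exact h2'.ne' (h1 g' hlt)
          · exact h2.ne' (h1' g hlt)
        rw [this, zero_mul, mul_zero]
    · push Not at hex
      rw [Finset.sum_eq_zero fun g hg => by rw [hex g hg, zero_mul, mul_zero]]
      exact zero_le
  have hFm : ∀ g, Measurable (firstPositive V M a s g) := fun g =>
    (measurable_firstPositive M hs g).mono (hV.sitesAlgebra_le _) le_rfl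
  have htm : ∀ g, Measurable (tail g) := fun g => measurable_green (fun z _ => hV.meas z) _ _
  have hm : ∀ g, Measurable fun ω => firstPositive V M a s g ω * tail g ω := fun g =>
    (hFm g).mul (htm g)
  refine le_trans (le_of_eq ?_) (lintegral_mono hpt)
  rw [lintegral_finsetSum _ fun g _ => (hm g).const_mul _]
  refine Finset.sum_congr rfl fun g hg => ?_
  rw [lintegral_const_mul _ (hm g), hV.lintegral_mul (hdisj g) (measurable_firstPositive M hs g)
    (measurable_green (fun z hz => measurable_sitesAlgebra hz) _ _),
    lintegral_firstPositive hV M hs]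
  change _ = _ * (_ * ∫⁻ ω, tail g ω ∂μ)
  rw [htail g hg]
  ring

lemma exists_segmentMass_lower_bound (hV : IsIIDField μ V) (hnz : μ {ω | V 0 ω = 0} < 1)
    (hpos : 0 < μ {ω | 0 < V 0 ω ∧ V 0 ω < ⊤}) :
    ∃ ρ c : ℝ, μ {ω | V 0 ω = 0} < ENNReal.ofReal ρ ∧ ρ ≤ 1 ∧ 0 < c ∧
      ∀ (a s : ℤ) (_ : s = 1 ∨ s = -1) (m : ℕ),
        ENNReal.ofReal (c * ρ ^ m) ≤ segmentMass μ V a s m := by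
  obtain ⟨M, hM⟩ := exists_measure_pos_le hpos
  set p := μ {ω | V 0 ω = 0} with hp
  set p' := μ {ω | 0 < V 0 ω ∧ V 0 ω ≤ (M : ℝ≥0∞)} with hp'
  have hptop : p ≠ ⊤ := measure_ne_top μ _
  have hp'top : p' ≠ ⊤ := measure_ne_top μ _
  set κ := expNeg M * 2⁻¹ with hκ
  have hκtop : κ ≠ ⊤ := ENNReal.mul_ne_top (expNeg_ne_top _) (by simp)
  have hκ0 : κ ≠ 0 := mul_ne_zero (expNeg_pos (by simp)).ne' (by simp)
  have hp1 : p.toReal < 1 := by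
    rw [← ENNReal.toReal_one]
    exact (ENNReal.toReal_lt_toReal hptop ENNReal.one_ne_top).2 hnz
  have hs0 : 0 < (p' * κ).toReal :=
    ENNReal.toReal_pos (mul_ne_zero hM.ne' hκ0) (ENNReal.mul_ne_top hp'top hκtop)
  obtain ⟨ρ, c, hρ, hρ1, hc, hL⟩ := exists_renewal_lower_bound ENNReal.toReal_nonneg hp1 hs0
  refine ⟨ρ, c, ?_, hρ1, hc, fun a s hs m => ?_⟩
  · rwa [← ENNReal.ofReal_toReal hptop,
      ENNReal.ofReal_lt_ofReal_iff (ENNReal.toReal_nonneg.trans_lt hρ)]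
  -- The infimum over starting points and orientations is taken as the renewal sequence, which
  -- avoids proving translation and reflection invariance of the mass.
  · refine (hL (fun m => ⨅ (a : ℤ) (s : ℤ) (_ : s = 1 ∨ s = -1), segmentMass μ V a s m) ?_ ?_
      m).trans (iInf_le_of_le a (iInf₂_le s hs))
    · refine le_iInf fun a => le_iInf₂ fun s hs => ?_
      have h0 : ∀ ω, green (segment a s 0) (fun z => V z ω) (Pi.single (site (a + s * (0 : ℕ))) 1)
          (site a) = 1 := fun ω => by
        have hn : site a ∉ segment a s 0 := by rintro ⟨j, hj, -⟩; omega
        rw [green_of_notMem hn]; simp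
      simp only [segmentMass, h0]
      simp
    · intro m
      refine le_iInf fun a => le_iInf₂ fun s hs => ?_
      refine le_trans (Finset.sum_le_sum fun g hg => ?_) (segmentMass_renewal hV M hs m)
      have hcoef : ENNReal.ofReal ((p' * κ).toReal * p.toReal ^ g / (g + 1)) =
          p ^ g * p' * ((g + 1 : ℝ≥0∞)⁻¹ * κ) := by
        rw [div_eq_mul_inv, ENNReal.ofReal_mul (by positivity), ENNReal.ofReal_mul
          ENNReal.toReal_nonneg, ENNReal.ofReal_pow ENNReal.toReal_nonneg,
          ENNReal.ofReal_toReal hptop, ENNReal.ofReal_toReal (ENNReal.mul_ne_top hp'top hκtop),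
          ENNReal.ofReal_inv_of_pos (by positivity), ENNReal.ofReal_add (by positivity) zero_le_one,
          ENNReal.ofReal_natCast, ENNReal.ofReal_one]
        ring
      rw [hcoef]
      gcongr
      exact iInf_le_of_le _ (iInf₂_le s hs)

lemma tsum_pow_four_mul_geometric_ne_top {t : ℝ} (ht0 : 0 ≤ t) (ht1 : t < 1) :
    ∑' k : ℕ, ENNReal.ofReal ((2 * k + 1) ^ 4 * t ^ k) ≠ ⊤ := by
  have h1 : Summable fun k : ℕ => (k : ℝ) ^ 4 * t ^ k :=
    summable_pow_mul_geometric_of_norm_lt_one 4 (by rwa [Real.norm_of_nonneg ht0])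
  have h2 : Summable fun k : ℕ => 81 * ((k : ℝ) ^ 4 * t ^ k + t ^ k) :=
    (h1.add (summable_geometric_of_lt_one ht0 ht1)).mul_left 81
  have h3 : Summable fun k : ℕ => (2 * (k : ℝ) + 1) ^ 4 * t ^ k := by
    refine Summable.of_nonneg_of_le (fun k => by positivity) (fun k => ?_) h2
    have h4 : (2 * (k : ℝ) + 1) ^ 4 ≤ 81 * (k ^ 4 + 1) := by
      rcases Nat.eq_zero_or_pos k with rfl | hk
      · norm_num
      · have hk1 : (1 : ℝ) ≤ k := by exact_mod_cast hk
        calc (2 * (k : ℝ) + 1) ^ 4 ≤ (3 * k) ^ 4 := by gcongr; linarith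
          _ ≤ _ := by nlinarith
    calc _ ≤ 81 * ((k : ℝ) ^ 4 + 1) * t ^ k := by gcongr
      _ = _ := by ring
  exact h3.tsum_ofReal_ne_top

/-- On the line obstacle and crossing probabilities decay at comparable exponential rates. The
threshold v₀ is therefore chosen after ρ, with q < ρ; the linear bound on Γ then leaves only the
polynomial factor (2k+1)^4. -/
lemma exists_tsum_crossMass_mul_le_of_line (hV : IsIIDField μ V) (h0 : meanExp μ V ≠ 0)
    (hnz : μ {ω | V 0 ω = 0} < 1) (hpos : 0 < μ {ω | 0 < V 0 ω ∧ V 0 ω < ⊤}) :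
    ∃ C : ℝ≥0∞, C ≠ ⊤ ∧ ∀ y, ∑' n : ℕ, crossMass μ V y n * n ≤ C * ∑' a, visitMass μ V y a := by
  obtain ⟨ρ, c, hρ, hρ1, hc, hseg⟩ := exists_segmentMass_lower_bound hV hnz hpos
  have hρ0 : 0 < ρ := by
    by_contra h
    rw [ENNReal.ofReal_of_nonpos (not_lt.1 h)] at hρ
    exact absurd hρ (not_lt.2 zero_le)
  obtain ⟨v₀, hv₀, hq⟩ := exists_measure_lt_lt (hV.meas 0) hρ
  set q := μ {ω | V 0 ω < v₀} with hqdef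
  have hqtop : q ≠ ⊤ := measure_ne_top μ _
  have hqρ : q.toReal < ρ := by
    rwa [← ENNReal.ofReal_toReal hqtop, ENNReal.ofReal_lt_ofReal_iff hρ0] at hq
  have hq1 : q < 1 := hq.trans_le (by simpa using hρ1)
  set ε := 1 - expNeg v₀ with hε
  have hε0 : ε ≠ 0 := obstacle_pos hv₀
  set φ := meanExp μ V with hφ
  -- The intermediate r is positive even when q = 0, so r⁻¹ can absorb the shift in the exponent 2k
  -- - 1, including its truncation at k = 0.
  obtain ⟨r, hqr, hrρ⟩ := exists_between hqρ
  have hr0 : 0 < r := ENNReal.toReal_nonneg.trans_lt hqr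
  refine ⟨_, ?_, tsum_crossMass_mul_le hV hq1
    (Γ := fun k => (ε * (2⁻¹ * ((2 * k : ℕ) + 1 : ℝ≥0∞)⁻¹))⁻¹)
    (θ := fun k => ENNReal.ofReal (c * ρ ^ (2 * k)) * φ) ?_ ?_ ?_⟩
  · set t := (r / ρ) ^ 2 with ht
    have ht1 : t < 1 := pow_lt_one₀ (by positivity) ((div_lt_one hρ0).2 hrρ) two_ne_zero
    set K := (ε⁻¹ * 2) ^ 2 * (ENNReal.ofReal (r * c))⁻¹ * φ⁻¹ with hK
    have hKtop : K ≠ ⊤ := by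
      refine ENNReal.mul_ne_top (ENNReal.mul_ne_top (ENNReal.pow_ne_top
        (ENNReal.mul_ne_top (ENNReal.inv_ne_top.2 hε0) (by simp))) ?_) (ENNReal.inv_ne_top.2 h0)
      exact ENNReal.inv_ne_top.2 (ENNReal.ofReal_pos.2 (by positivity)).ne'
    have hle : ∀ k : ℕ, (ε * (2⁻¹ * ((2 * k : ℕ) + 1 : ℝ≥0∞)⁻¹))⁻¹ ^ 2 *
        q ^ ((2 * k - 1) ^ 1) * (ENNReal.ofReal (c * ρ ^ (2 * k)) * φ)⁻¹ *
        ((2 * k + 1) ^ 1) ^ 2 ≤ K * ENNReal.ofReal ((2 * k + 1) ^ 4 * t ^ k) := by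
      intro k
      have e1 : (ε * (2⁻¹ * ((2 * k : ℕ) + 1 : ℝ≥0∞)⁻¹))⁻¹ = ε⁻¹ * 2 * (2 * k + 1) := by
        rw [ENNReal.mul_inv (Or.inl hε0)
          (Or.inr (mul_ne_zero (by simp) (ENNReal.inv_ne_zero.2
            (ENNReal.add_ne_top.2 ⟨ENNReal.natCast_ne_top _, ENNReal.one_ne_top⟩)))),
          ENNReal.mul_inv (Or.inl (by simp)) (Or.inl (by simp)), inv_inv, inv_inv]
        push_cast; ring
      have hφtop : φ ≠ ⊤ := ne_top_of_le_ne_top ENNReal.one_ne_top meanExp_le_one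
      have e2 : (ENNReal.ofReal (c * ρ ^ (2 * k)) * φ)⁻¹ =
          (ENNReal.ofReal (c * ρ ^ (2 * k)))⁻¹ * φ⁻¹ :=
        ENNReal.mul_inv (Or.inr hφtop) (Or.inl ENNReal.ofReal_ne_top)
      have e3 : q ^ ((2 * k - 1) ^ 1) ≤ ENNReal.ofReal (r⁻¹ * r ^ (2 * k)) := by
        rw [pow_one]
        calc q ^ (2 * k - 1) ≤ ENNReal.ofReal r ^ (2 * k - 1) := by
              gcongr
              rw [← ENNReal.ofReal_toReal hqtop]
              exact ENNReal.ofReal_le_ofReal hqr.le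
          _ = ENNReal.ofReal (r ^ (2 * k - 1)) := (ENNReal.ofReal_pow hr0.le _).symm
          _ ≤ _ := by
              refine ENNReal.ofReal_le_ofReal ?_
              rcases Nat.eq_zero_or_pos k with rfl | hk
              · simpa using one_le_inv_iff₀.2 ⟨hr0, hrρ.le.trans hρ1⟩
              · have : r ^ (2 * k) = r ^ (2 * k - 1) * r := by
                  rw [← pow_succ]; congr 1; omega
                rw [this]
                exact le_of_eq (by field_simp)
      have e4 : ((2 * k + 1 : ℝ≥0∞)) = ENNReal.ofReal (2 * k + 1) := by
        rw [ENNReal.ofReal_add (by positivity) zero_le_one, ENNReal.ofReal_mul zero_le_two,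
          ENNReal.ofReal_natCast, ENNReal.ofReal_one, ENNReal.ofReal_ofNat]
      have e5 : ENNReal.ofReal (r⁻¹ * r ^ (2 * k)) * (ENNReal.ofReal (c * ρ ^ (2 * k)))⁻¹ =
          (ENNReal.ofReal (r * c))⁻¹ * ENNReal.ofReal (t ^ k) := by
        rw [← ENNReal.ofReal_inv_of_pos (by positivity),
          ← ENNReal.ofReal_inv_of_pos (by positivity),
          ← ENNReal.ofReal_mul (by positivity), ← ENNReal.ofReal_mul (by positivity)]
        congr 1
        rw [ht, ← pow_mul, div_pow]
        field_simp
      rw [e1, e2]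
      calc _ ≤ (ε⁻¹ * 2 * (2 * k + 1)) ^ 2 * ENNReal.ofReal (r⁻¹ * r ^ (2 * k)) *
            ((ENNReal.ofReal (c * ρ ^ (2 * k)))⁻¹ * φ⁻¹) * ((2 * k + 1) ^ 1) ^ 2 := by gcongr
        _ = (ε⁻¹ * 2) ^ 2 * φ⁻¹ * (2 * k + 1) ^ 4 * (ENNReal.ofReal (r⁻¹ * r ^ (2 * k)) *
            (ENNReal.ofReal (c * ρ ^ (2 * k)))⁻¹) := by ring
        _ = K * ((2 * k + 1) ^ 4 * ENNReal.ofReal (t ^ k)) := by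
            rw [e5, hK]; ring
        _ = _ := by
            rw [ENNReal.ofReal_mul (by positivity),
              ENNReal.ofReal_pow (p := 2 * (k : ℝ) + 1) (by positivity), ← e4]
    refine ne_top_of_le_ne_top ?_ (ENNReal.tsum_le_tsum hle)
    rw [ENNReal.tsum_mul_left]
    exact ENNReal.mul_ne_top hKtop (tsum_pow_four_mul_geometric_ne_top (by positivity) ht1)
  · rintro y z k v ⟨w, hw, hvw⟩ b hb x
    refine green_single_le_of_obstacle_line hv₀ hvw b x ?_
    simpa using latticeDist_le_of_mem_latticeBox hb hw
  · intro k
    exact mul_ne_zero (ENNReal.ofReal_pos.2 (by positivity)).ne' h0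
  · intro z k a ha b hb
    exact le_lintegral_green_latticeBox hV hρ0.le hρ1 hc hseg ha hb

end AnnealedLine

/-! ### The right derivative of the Lyapunov exponents -/

section ExponentialTilt

variable {a : ℕ → ℝ} {t : ℝ}

lemma summable_exp_neg_mul (ha : ∀ n, 0 ≤ a n) (hs : Summable a) (ht : 0 ≤ t) :
    Summable fun n : ℕ => Real.exp (-(t * n)) * a n := by
  refine Summable.of_nonneg_of_le (fun n => mul_nonneg (Real.exp_nonneg _) (ha n)) (fun n => ?_) hs
  exact mul_le_of_le_one_left (ha n) (Real.exp_le_one_iff.2 (by simp; positivity))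

lemma tsum_exp_neg_mul_pos (ha : ∀ n, 0 ≤ a n) (hs : Summable a) (hpos : 0 < ∑' n, a n)
    (ht : 0 ≤ t) : 0 < ∑' n : ℕ, Real.exp (-(t * n)) * a n := by
  obtain ⟨n, hn⟩ : ∃ n, a n ≠ 0 := by
    by_contra! h
    simp [h] at hpos
  exact (summable_exp_neg_mul ha hs ht).tsum_pos
    (fun n => mul_nonneg (Real.exp_nonneg _) (ha n)) n
    (mul_pos (Real.exp_pos _) ((ha n).lt_of_ne' hn))

/-- The logarithm of a Laplace transform is convex. -/
lemma log_tsum_exp_neg_mul_le (ha : ∀ n, 0 ≤ a n) (hs : Summable a) (hpos : 0 < ∑' n, a n)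
    (ht : 0 ≤ t) {θ : ℝ} (hθ0 : 0 ≤ θ) (hθ1 : θ ≤ 1) :
    Real.log (∑' n : ℕ, Real.exp (-(θ * t * n)) * a n) ≤
      (1 - θ) * Real.log (∑' n, a n) + θ * Real.log (∑' n : ℕ, Real.exp (-(t * n)) * a n) := by
  have hZt := tsum_exp_neg_mul_pos ha hs hpos ht
  have hst := summable_exp_neg_mul ha hs ht
  set Z := ∑' n, a n with hZ
  set Zt := ∑' n : ℕ, Real.exp (-(t * n)) * a n with hZt'
  -- Factoring out exp(θm) normalizes the tilted sequence to total mass Z; convexity of exp between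
  -- 0 and -(tn) - m then gives the estimate term by term.
  set m := Real.log Zt - Real.log Z with hm
  have hem : Real.exp (-m) * Zt = Z := by
    rw [hm, neg_sub, Real.exp_sub, Real.exp_log hpos, Real.exp_log hZt]
    field_simp
  have hpt : ∀ n : ℕ, Real.exp (-(θ * t * n)) * a n ≤
      Real.exp (θ * m) * ((1 - θ) * a n + θ * (Real.exp (-m) * (Real.exp (-(t * n)) * a n))) := by
    intro n
    have hconv := convexOn_exp.2 (Set.mem_univ (0 : ℝ)) (Set.mem_univ (-(t * n) - m))
      (sub_nonneg.2 hθ1) hθ0 (by ring)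
    simp only [smul_eq_mul, mul_zero, zero_add, Real.exp_zero, mul_one] at hconv
    have e1 : Real.exp (-(θ * t * n)) = Real.exp (θ * m) * Real.exp (θ * (-(t * n) - m)) := by
      rw [← Real.exp_add]; congr 1; ring
    have e2 : Real.exp (-(t * n) - m) = Real.exp (-m) * Real.exp (-(t * n)) := by
      rw [← Real.exp_add]; congr 1; ring
    rw [e1, mul_assoc]
    refine mul_le_mul_of_nonneg_left ?_ (Real.exp_nonneg _)
    calc _ ≤ (1 - θ + θ * Real.exp (-(t * n) - m)) * a n :=
          mul_le_mul_of_nonneg_right hconv (ha n)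
      _ = _ := by rw [e2]; ring
  have hrhs : HasSum (fun n : ℕ => Real.exp (θ * m) *
      ((1 - θ) * a n + θ * (Real.exp (-m) * (Real.exp (-(t * n)) * a n))))
      (Real.exp (θ * m) * ((1 - θ) * Z + θ * (Real.exp (-m) * Zt))) :=
    ((hs.hasSum.mul_left _).add ((hst.hasSum.mul_left _).mul_left _)).mul_left _
  have hθt : 0 ≤ θ * t := mul_nonneg hθ0 ht
  have hle := hasSum_le hpt (summable_exp_neg_mul ha hs hθt).hasSum hrhs
  rw [hem] at hle
  calc _ ≤ Real.log (Real.exp (θ * m) * ((1 - θ) * Z + θ * Z)) :=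
        Real.log_le_log (tsum_exp_neg_mul_pos ha hs hpos hθt) hle
    _ = θ * m + Real.log Z := by
        rw [show (1 - θ) * Z + θ * Z = Z by ring, Real.log_mul (Real.exp_ne_zero _) hpos.ne',
          Real.log_exp]
    _ = _ := by rw [hm]; ring

/-- Jensen's inequality for the weights a n / Z, obtained from 1 + x ≤ exp x at x = t(m - n), where
m is the mean of n. -/
lemma log_tsum_sub_le_log_tsum_exp_neg_mul (ha : ∀ n, 0 ≤ a n) (hs : Summable a)
    (hpos : 0 < ∑' n, a n) (hs1 : Summable fun n : ℕ => a n * n) (ht : 0 ≤ t) :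
    Real.log (∑' n, a n) - t * ((∑' n, a n)⁻¹ * ∑' n : ℕ, a n * n) ≤
      Real.log (∑' n : ℕ, Real.exp (-(t * n)) * a n) := by
  set Z := ∑' n, a n with hZ
  set m := Z⁻¹ * ∑' n : ℕ, a n * n with hm
  have hmZ : ∑' n : ℕ, a n * n = m * Z := by rw [hm]; field_simp
  have hpt : ∀ n : ℕ, Real.exp (-(t * m)) * ((1 + t * m) * a n - t * (a n * n)) ≤
      Real.exp (-(t * n)) * a n := by
    intro n
    have e1 : Real.exp (-(t * n)) = Real.exp (-(t * m)) * Real.exp (t * m - t * n) := by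
      rw [← Real.exp_add]; congr 1; ring
    rw [e1, mul_assoc]
    refine mul_le_mul_of_nonneg_left ?_ (Real.exp_nonneg _)
    calc _ = (t * m - t * n + 1) * a n := by ring
      _ ≤ _ := mul_le_mul_of_nonneg_right (Real.add_one_le_exp _) (ha n)
  have hlhs : HasSum (fun n : ℕ => Real.exp (-(t * m)) * ((1 + t * m) * a n - t * (a n * n)))
      (Real.exp (-(t * m)) * ((1 + t * m) * Z - t * (m * Z))) :=
    ((hs.hasSum.mul_left _).sub ((hmZ ▸ hs1.hasSum).mul_left _)).mul_left _
  have hle := hasSum_le hpt hlhs (summable_exp_neg_mul ha hs ht).hasSum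
  rw [show (1 + t * m) * Z - t * (m * Z) = Z by ring] at hle
  calc _ = Real.log (Real.exp (-(t * m)) * Z) := by
        rw [Real.log_mul (Real.exp_ne_zero _) hpos.ne', Real.log_exp]; ring
    _ ≤ _ := Real.log_le_log (by positivity) hle

/-- A function whose chords from `0` have antitone and bounded slopes has a right derivative. -/
lemma exists_hasDerivWithinAt_of_slope_antitone {f : ℝ → ℝ} {C : ℝ}
    (hconc : ∀ t, 0 ≤ t → ∀ θ, 0 ≤ θ → θ ≤ 1 → (1 - θ) * f 0 + θ * f t ≤ f (θ * t))
    (hbd : ∀ t, 0 < t → f t - f 0 ≤ C * t) :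
    ∃ D, HasDerivWithinAt f D (Set.Ici 0) 0 ∧ D ≤ C := by
  have hq : AntitoneOn (slope f 0) (Set.Ioi 0) := by
    intro x hx y hy hxy
    have hx : 0 < x := hx
    have hy : 0 < y := hy
    have h := hconc y hy.le (x / y) (by positivity) ((div_le_one hy).2 hxy)
    rw [div_mul_cancel₀ _ hy.ne'] at h
    rw [slope_def_field, slope_def_field, sub_zero, sub_zero, div_le_div_iff₀ hy hx]
    have h2 := mul_le_mul_of_nonneg_left h hy.le
    have h3 : y * ((1 - x / y) * f 0 + x / y * f y) = (y - x) * f 0 + x * f y := by field_simp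
    rw [h3] at h2
    linarith
  have hle : ∀ x ∈ slope f 0 '' Set.Ioi 0, x ≤ C := by
    rintro _ ⟨x, hx, rfl⟩
    rw [slope_def_field, sub_zero, div_le_iff₀ hx]
    exact hbd x hx
  have hbdd : BddAbove (slope f 0 '' Set.Ioi 0) := ⟨C, hle⟩
  -- The slopes increase as the endpoint decreases to 0, so their right limit is the supremum.
  refine ⟨sSup (slope f 0 '' Set.Ioi 0), ?_, csSup_le (Set.nonempty_Ioi.image _) hle⟩
  rw [← hasDerivWithinAt_Ioi_iff_Ici, hasDerivWithinAt_iff_tendsto_slope' (Set.notMem_Ioi.2 le_rfl)]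
  exact hq.tendsto_nhdsGT hbdd

end ExponentialTilt

/-! ### The potential t + V as an exponential tilt of the crossing time -/

section ShiftedPotential

variable {Ω : Type*}

lemma shiftPotential_zero (V : (Fin d → ℤ) → Ω → ℝ≥0∞) : shiftPotential 0 V = V := by
  ext z ω
  simp [shiftPotential]

lemma killedStep_const_add (A : Set (Fin d → ℤ)) (c : ℝ≥0∞) (v f : (Fin d → ℤ) → ℝ≥0∞) :
    killedStep A (fun z => c + v z) f = fun x => expNeg c * killedStep A v f x := by
  ext x
  by_cases hx : x ∈ A
  · rw [killedStep_of_mem hx, killedStep_of_mem hx, expNeg_add, mul_assoc]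
  · simp [killedStep_of_notMem hx]

lemma killedStep_iterate_const_add (A : Set (Fin d → ℤ)) (c : ℝ≥0∞)
    (v f : (Fin d → ℤ) → ℝ≥0∞) (n : ℕ) :
    (killedStep A fun z => c + v z)^[n] f = fun x => expNeg c ^ n * (killedStep A v)^[n] f x := by
  induction n with
  | zero => simp
  | succ n ih =>
    rw [Function.iterate_succ_apply', ih, killedStep_const_add, killedStep_const_mul]
    ext x
    rw [Function.iterate_succ_apply', pow_succ', mul_assoc]

variable [MeasurableSpace Ω] {μ : Measure Ω} {V : (Fin d → ℤ) → Ω → ℝ≥0∞} {t : ℝ}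

lemma IsIIDField.shiftPotential (hV : IsIIDField μ V) (t : ℝ) :
    IsIIDField μ (shiftPotential t V) where
  meas z := measurable_const.add (hV.meas z)
  indep := hV.indep.comp (fun _ x => ENNReal.ofReal t + x) fun _ => measurable_const_add _
  ident z := (hV.ident z).comp (measurable_const_add (ENNReal.ofReal t))

/-- A path hitting y at time n collects the constant t exactly n times, so t acts as a Laplace
variable for the crossing time. -/
lemma crossMass_shiftPotential (hV : ∀ z, Measurable (V z)) (ht : 0 ≤ t) (y : Fin d → ℤ) (n : ℕ) :
    crossMass μ (shiftPotential t V) y n =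
      ENNReal.ofReal (Real.exp (-(t * n))) * crossMass μ V y n := by
  simp only [crossMass, shiftPotential, killedStep_iterate_const_add]
  rw [lintegral_const_mul _ (measurable_killedStep_iterate (fun z _ => hV z) _ _ _),
    expNeg_ofReal ht,
    ← ENNReal.ofReal_pow (Real.exp_nonneg _), ← Real.exp_nat_mul]
  congr 3
  ring

lemma meanExp_shiftPotential (hV : Measurable (V 0)) (ht : 0 ≤ t) :
    meanExp μ (shiftPotential t V) = ENNReal.ofReal (Real.exp (-t)) * meanExp μ V := by
  simp only [meanExp, shiftPotential, expNeg_add]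
  rw [lintegral_const_mul _ (f := fun ω => expNeg (V 0 ω)) (measurable_expNeg.comp hV),
    expNeg_ofReal ht]

lemma meanExp_shiftPotential_ne_zero (hV : Measurable (V 0)) (h0 : meanExp μ V ≠ 0) (ht : 0 ≤ t) :
    meanExp μ (shiftPotential t V) ≠ 0 := by
  rw [meanExp_shiftPotential hV ht]
  exact mul_ne_zero (ENNReal.ofReal_pos.2 (Real.exp_pos _)).ne' h0

lemma meanExp_ne_zero (hV : Measurable (V 0)) (h : essInf (V 0) μ = 0) : meanExp μ V ≠ 0 := by
  intro h0
  have hae : ∀ᵐ ω ∂μ, V 0 ω = ⊤ := by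
    filter_upwards [(lintegral_eq_zero_iff (measurable_expNeg.comp hV)).1 h0] with ω hω
    by_contra hne
    exact (expNeg_pos hne).ne' hω
  rw [essInf_congr_ae hae, essInf_const_top] at h
  exact ENNReal.top_ne_zero h

/-- This makes -log of `meanExp` strictly positive, so that the exponential moment of the range
controls its mean. -/
lemma meanExp_lt_one [IsProbabilityMeasure μ] (hV : Measurable (V 0)) (h : μ {ω | V 0 ω = 0} < 1) :
    meanExp μ V < 1 := by
  refine lt_of_le_of_ne meanExp_le_one fun h1 => h.ne ?_
  have hae : (fun ω => expNeg (V 0 ω)) =ᵐ[μ] fun _ => 1 := by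
    refine ae_eq_of_ae_le_of_lintegral_le (ae_of_all _ fun ω => expNeg_le_one _) ?_
      aemeasurable_const ?_
    · exact ne_top_of_le_ne_top ENNReal.one_ne_top meanExp_le_one
    · simpa [meanExp] using h1.ge
  refine mem_ae_iff_prob_eq_one (hV (measurableSet_singleton 0)) |>.1 ?_
  filter_upwards [hae] with ω hω
  by_contra hne
  exact (expNeg_lt_one hne).ne hω

variable [NeZero d] [IsProbabilityMeasure μ]

lemma crossMass_ne_top (hV : ∀ z, Measurable (V z)) (y : Fin d → ℤ) (n : ℕ) :
    crossMass μ V y n ≠ ⊤ := by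
  refine ENNReal.ne_top_of_tsum_ne_top ?_ n
  rw [← annealedZ_eq_tsum_crossMass hV]
  exact annealedZ_ne_top 0 y

lemma annealedZ_toReal_eq_tsum (hV : ∀ z, Measurable (V z)) (y : Fin d → ℤ) :
    (annealedZ μ V 0 y).toReal = ∑' n, (crossMass μ V y n).toReal := by
  rw [annealedZ_eq_tsum_crossMass hV, ENNReal.tsum_toReal_eq (crossMass_ne_top hV y)]

lemma annealedZ_shiftPotential_toReal_eq_tsum (hV : IsIIDField μ V) (ht : 0 ≤ t)
    (y : Fin d → ℤ) :
    (annealedZ μ (shiftPotential t V) 0 y).toReal =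
      ∑' n : ℕ, Real.exp (-(t * n)) * (crossMass μ V y n).toReal := by
  rw [annealedZ_toReal_eq_tsum (hV.shiftPotential t).meas]
  refine tsum_congr fun n => ?_
  rw [crossMass_shiftPotential hV.meas ht, ENNReal.toReal_mul,
    ENNReal.toReal_ofReal (Real.exp_nonneg _)]

lemma summable_crossMass_toReal (hV : ∀ z, Measurable (V z)) (y : Fin d → ℤ) :
    Summable fun n => (crossMass μ V y n).toReal := by
  refine ENNReal.summable_toReal ?_
  rw [← annealedZ_eq_tsum_crossMass hV]
  exact annealedZ_ne_top 0 y

lemma log_annealedZ_shiftPotential_le (hV : IsIIDField μ V) (h0 : meanExp μ V ≠ 0) (ht : 0 ≤ t)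
    {θ : ℝ} (hθ0 : 0 ≤ θ) (hθ1 : θ ≤ 1) (y : Fin d → ℤ) :
    Real.log (annealedZ μ (shiftPotential (θ * t) V) 0 y).toReal ≤
      (1 - θ) * Real.log (annealedZ μ V 0 y).toReal +
        θ * Real.log (annealedZ μ (shiftPotential t V) 0 y).toReal := by
  have hpos := annealedZ_toReal_pos hV h0 y
  rw [annealedZ_toReal_eq_tsum hV.meas] at hpos ⊢
  rw [annealedZ_shiftPotential_toReal_eq_tsum hV ht,
    annealedZ_shiftPotential_toReal_eq_tsum hV (mul_nonneg hθ0 ht)]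
  exact log_tsum_exp_neg_mul_le (fun _ => ENNReal.toReal_nonneg)
    (summable_crossMass_toReal hV.meas y) hpos ht hθ0 hθ1

/-- Jensen's bound for the tilt. Finiteness of the mean is required because `toReal` would turn an
infinite mean into 0. -/
lemma log_annealedZ_sub_le (hV : IsIIDField μ V) (h0 : meanExp μ V ≠ 0) (ht : 0 ≤ t)
    {y : Fin d → ℤ} (hy : meanCrossingTime μ V y ≠ ⊤) :
    Real.log (annealedZ μ V 0 y).toReal -
        Real.log (annealedZ μ (shiftPotential t V) 0 y).toReal ≤
      t * (meanCrossingTime μ V y).toReal := by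
  have hpos := annealedZ_toReal_pos hV h0 y
  rw [meanCrossingTime_eq hV.meas] at hy ⊢
  have hfin : ∑' n : ℕ, crossMass μ V y n * n ≠ ⊤ := fun h => by
    rw [h, ENNReal.mul_top (ENNReal.inv_ne_zero.2 (annealedZ_ne_top 0 y))] at hy
    exact hy rfl
  have hsum : Summable fun n : ℕ => (crossMass μ V y n).toReal * n := by
    simpa using ENNReal.summable_toReal hfin
  have htsum : (∑' n : ℕ, crossMass μ V y n * n).toReal =
      ∑' n : ℕ, (crossMass μ V y n).toReal * n := by
    rw [ENNReal.tsum_toReal_eq fun n => ENNReal.ne_top_of_tsum_ne_top hfin n]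
    simp
  rw [ENNReal.toReal_mul, ENNReal.toReal_inv, htsum, annealedZ_shiftPotential_toReal_eq_tsum hV ht,
    annealedZ_toReal_eq_tsum hV.meas]
  rw [annealedZ_toReal_eq_tsum hV.meas] at hpos
  have := log_tsum_sub_le_log_tsum_exp_neg_mul (fun n => ENNReal.toReal_nonneg)
    (summable_crossMass_toReal hV.meas y) hpos hsum ht
  linarith

lemma lyapunov_shiftPotential_concave (hV : IsIIDField μ V) (h0 : meanExp μ V ≠ 0) (ht : 0 ≤ t)
    {θ : ℝ} (hθ0 : 0 ≤ θ) (hθ1 : θ ≤ 1) (h : EuclideanSpace ℝ (Fin d)) :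
    (1 - θ) * lyapunov μ V h + θ * lyapunov μ (shiftPotential t V) h ≤
      lyapunov μ (shiftPotential (θ * t) V) h := by
  have hlim : ∀ t : ℝ, 0 ≤ t → Tendsto (decayRate μ (shiftPotential t V) h) atTop
      (𝓝 (lyapunov μ (shiftPotential t V) h)) := fun t ht => tendsto_decayRate (hV.shiftPotential t)
    (meanExp_shiftPotential_ne_zero (hV.meas 0) h0 ht) h
  refine le_of_tendsto_of_tendsto
    (((tendsto_decayRate hV h0 h).const_mul _).add ((hlim t ht).const_mul _))
    (hlim _ (mul_nonneg hθ0 ht)) ?_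
  filter_upwards [eventually_gt_atTop 0] with r hr
  have := mul_le_mul_of_nonneg_left (log_annealedZ_shiftPotential_le hV h0 ht hθ0 hθ1
    (intPart (r • h))) (one_div_pos.2 hr).le
  unfold decayRate
  linarith

end ShiftedPotential

/-! ### Lattice points along a ray -/

section Norms

lemma latticeDist_zero_le_mul_latticeNorm (y : Fin d → ℤ) :
    (latticeDist 0 y : ℝ) ≤ d * latticeNorm y := by
  unfold latticeDist
  push_cast
  calc ∑ i, (((0 : Fin d → ℤ) i - y i).natAbs : ℝ) ≤ ∑ _i : Fin d, latticeNorm y := by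
        refine Finset.sum_le_sum fun i _ => ?_
        have := PiLp.norm_apply_le (WithLp.toLp 2 fun i => (y i : ℝ) : EuclideanSpace ℝ (Fin d)) i
        refine le_trans (le_of_eq ?_) this
        simp [Nat.cast_natAbs]
    _ = d * latticeNorm y := by simp

lemma tendsto_latticeNorm_intPart_div (s : EuclideanSpace ℝ (Fin d)) :
    Tendsto (fun r : ℝ => latticeNorm (intPart (r • s)) / r) atTop (𝓝 ‖s‖) := by
  have hcoord : Tendsto (fun r : ℝ => fun i => r⁻¹ * (⌊r * s i⌋ : ℝ)) atTop (𝓝 s.ofLp) := by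
    rw [tendsto_pi_nhds]
    intro i
    refine tendsto_of_tendsto_of_tendsto_of_le_of_le' (g := fun r => s i - r⁻¹) (h := fun _ => s i)
      ?_ tendsto_const_nhds ?_ ?_
    · simpa using (tendsto_const_nhds (x := s i)).sub (tendsto_inv_atTop_zero (𝕜 := ℝ))
    · filter_upwards [eventually_gt_atTop 0] with r hr
      have := mul_le_mul_of_nonneg_left (Int.sub_one_lt_floor (r * s i)).le (inv_pos.2 hr).le
      refine le_trans (le_of_eq ?_) this
      field_simp
    · filter_upwards [eventually_gt_atTop 0] with r hr
      have := mul_le_mul_of_nonneg_left (Int.floor_le (r * s i)) (inv_pos.2 hr).le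
      refine this.trans (le_of_eq ?_)
      field_simp
  have hnorm := (((PiLp.continuous_toLp 2 fun _ : Fin d => ℝ).tendsto _).comp hcoord).norm
  refine hnorm.congr' ?_
  filter_upwards [eventually_gt_atTop 0] with r hr
  rw [latticeNorm, div_eq_inv_mul, ← Real.norm_of_nonneg (inv_pos.2 hr).le, ← norm_smul]
  congr 1

lemma tendsto_latticeNorm_intPart {s : EuclideanSpace ℝ (Fin d)} (hs : ‖s‖ = 1) :
    Tendsto (fun r : ℝ => latticeNorm (intPart (r • s))) atTop atTop := by
  have h := tendsto_latticeNorm_intPart_div s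
  rw [hs] at h
  refine (Tendsto.pos_mul_atTop one_pos h tendsto_id).congr' ?_
  filter_upwards [eventually_gt_atTop 0] with r hr
  exact div_mul_cancel₀ _ hr.ne'

end Norms

/-! ### Linear bound on the crossing time and its consequence for the exponents -/

section CrossingTime

variable [NeZero d] {Ω : Type*} [MeasurableSpace Ω] {μ : Measure Ω} [IsProbabilityMeasure μ]
  {V : (Fin d → ℤ) → Ω → ℝ≥0∞}

/-- Along y = [rs] the norm of y is asymptotic to r and the mean crossing time is eventually at most
(C + ε)‖y‖, so Jensen's bound divided by r gives slope at most C + ε; then ε is removed. -/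
lemma lyapunov_shiftPotential_sub_le (hV : IsIIDField μ V) (h0 : meanExp μ V ≠ 0) {C t : ℝ}
    (hC : 0 < C) (hlim : limsupCrossingTime μ V ≤ ENNReal.ofReal C) (ht : 0 ≤ t)
    {s : EuclideanSpace ℝ (Fin d)} (hs : ‖s‖ = 1) :
    lyapunov μ (shiftPotential t V) s - lyapunov μ V s ≤ C * t := by
  have hβ := tendsto_decayRate (hV.shiftPotential t)
    (meanExp_shiftPotential_ne_zero (hV.meas 0) h0 ht) s
  have hβ0 := tendsto_decayRate hV h0 s
  have hnorm := tendsto_latticeNorm_intPart_div s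
  rw [hs] at hnorm
  have key : ∀ ε > 0, lyapunov μ (shiftPotential t V) s - lyapunov μ V s ≤ (C + ε) * t := by
    intro ε hε
    have hlt : limsupCrossingTime μ V < ENNReal.ofReal (C + ε) :=
      hlim.trans_lt ((ENNReal.ofReal_lt_ofReal_iff (by positivity)).2 (by linarith))
    have htend : Tendsto (fun r : ℝ => intPart (r • s)) atTop (comap latticeNorm atTop) :=
      tendsto_comap_iff.2 (tendsto_latticeNorm_intPart hs)
    have hev := htend.eventually (eventually_lt_of_limsup_lt hlt)
    have h1 : Tendsto (fun r : ℝ => t * ((C + ε) * (latticeNorm (intPart (r • s)) / r))) atTop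
        (𝓝 (t * ((C + ε) * 1))) := (hnorm.const_mul _).const_mul _
    rw [show (C + ε) * t = t * ((C + ε) * 1) by ring]
    refine le_of_tendsto_of_tendsto (hβ.sub hβ0) h1 ?_
    filter_upwards [hev, eventually_gt_atTop 0,
      (tendsto_latticeNorm_intPart hs).eventually_gt_atTop 0] with r hr hr0 hn
    have hn' : ENNReal.ofReal (latticeNorm (intPart (r • s))) ≠ 0 := (ENNReal.ofReal_pos.2 hn).ne'
    have hle := ENNReal.div_le_iff hn' ENNReal.ofReal_ne_top |>.1 hr.le
    rw [← ENNReal.ofReal_mul (by positivity)] at hle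
    have hfin := ne_top_of_le_ne_top ENNReal.ofReal_ne_top hle
    have hlog := log_annealedZ_sub_le hV h0 ht hfin
    have hreal := ENNReal.toReal_le_of_le_ofReal (by positivity) hle
    have h2 : t * (meanCrossingTime μ V (intPart (r • s))).toReal ≤
        t * ((C + ε) * latticeNorm (intPart (r • s))) := mul_le_mul_of_nonneg_left hreal ht
    have h3 := mul_le_mul_of_nonneg_left (hlog.trans h2) (one_div_pos.2 hr0).le
    unfold decayRate
    calc _ = 1 / r * (Real.log (annealedZ μ V 0 (intPart (r • s))).toReal -
          Real.log (annealedZ μ (shiftPotential t V) 0 (intPart (r • s))).toReal) := by ring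
      _ ≤ _ := h3
      _ = _ := by ring
  refine le_of_forall_pos_le_add fun δ hδ => ?_
  have := key (δ / (t + 1)) (by positivity)
  have h2 : δ / (t + 1) * t ≤ δ := by
    rw [div_mul_eq_mul_div, div_le_iff₀ (by positivity)]
    nlinarith
  linarith

lemma exists_tsum_crossMass_mul_le (hV : IsIIDField μ V) (h0 : meanExp μ V ≠ 0)
    (hnz : μ {ω | V 0 ω = 0} < 1) (hdim1 : d = 1 → 0 < μ {ω | 0 < V 0 ω ∧ V 0 ω < ⊤}) :
    ∃ C : ℝ≥0∞, C ≠ ⊤ ∧ ∀ y, ∑' n : ℕ, crossMass μ V y n * n ≤ C * ∑' a, visitMass μ V y a := by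
  rcases Nat.lt_or_ge d 2 with hd | hd
  · obtain rfl : d = 1 := by have := NeZero.pos d; omega
    exact exists_tsum_crossMass_mul_le_of_line hV h0 hnz (hdim1 rfl)
  · exact exists_tsum_crossMass_mul_le_of_two_le hd hV h0 hnz

/-- Time is bounded by range, range by (1 - log Z) / (-log φ) times Z, and -log Z linearly in ‖y‖ by
the direct path; the factor Z cancels against the normalization of Q_y. -/
lemma exists_meanCrossingTime_le (hV : IsIIDField μ V) (h0 : meanExp μ V ≠ 0)
    (hnz : μ {ω | V 0 ω = 0} < 1) (hdim1 : d = 1 → 0 < μ {ω | 0 < V 0 ω ∧ V 0 ω < ⊤}) :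
    ∃ C : ℝ, 0 < C ∧ ∀ y, 1 ≤ latticeNorm y →
      meanCrossingTime μ V y ≤ ENNReal.ofReal (C * latticeNorm y) := by
  obtain ⟨C₁, hC₁, hle⟩ := exists_tsum_crossMass_mul_le hV h0 hnz hdim1
  set L := -Real.log (meanExp μ V).toReal with hL
  have hφ : (meanExp μ V).toReal < 1 := by
    rw [← ENNReal.toReal_one]
    exact (ENNReal.toReal_lt_toReal (ne_top_of_le_ne_top ENNReal.one_ne_top meanExp_le_one)
      ENNReal.one_ne_top).2 (meanExp_lt_one (hV.meas 0) hnz)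
  have hL0 : 0 < L := neg_pos.2 (Real.log_neg (ENNReal.toReal_pos h0
    (ne_top_of_le_ne_top ENNReal.one_ne_top meanExp_le_one)) hφ)
  set K := -Real.log ((2 * d : ℝ≥0∞)⁻¹ * meanExp μ V).toReal with hK
  have hK0 : 0 ≤ K := stepMass_log_nonneg
  refine ⟨(C₁.toReal + 1) * L⁻¹ * (K * (d + 1) + 1), by positivity, fun y hy => ?_⟩
  set Z := annealedZ μ V 0 y with hZ
  have hZ0 : Z ≠ 0 := annealedZ_ne_zero hV h0 y
  have hZt : Z ≠ ⊤ := annealedZ_ne_top 0 y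
  have hvisit : ∑' a, visitMass μ V y a ≤
      ENNReal.ofReal L⁻¹ * (ENNReal.ofReal (-Real.log Z.toReal + 1) * Z) := by
    rw [ENNReal.ofReal_inv_of_pos hL0, ← ENNReal.div_eq_inv_mul]
    refine (ENNReal.le_div_iff_mul_le (Or.inl (ENNReal.ofReal_pos.2 hL0).ne')
      (Or.inl ENNReal.ofReal_ne_top)).2 ?_
    rw [mul_comm]
    exact tsum_visitMass_le hV h0 y
  -- The assumption 1 ≤ ‖y‖ absorbs the additive constants into the linear term.
  have hlog : -Real.log Z.toReal + 1 ≤ (K * (d + 1) + 1) * latticeNorm y := by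
    have h1 := neg_log_annealedZ_le hV h0 y
    have h2 : K * (latticeDist 0 y + 1) ≤ K * (d * latticeNorm y + latticeNorm y) :=
      mul_le_mul_of_nonneg_left (add_le_add (latticeDist_zero_le_mul_latticeNorm y) hy) hK0
    linarith
  calc meanCrossingTime μ V y = Z⁻¹ * ∑' n : ℕ, crossMass μ V y n * n :=
        meanCrossingTime_eq hV.meas y
    _ ≤ Z⁻¹ * (C₁ * (ENNReal.ofReal L⁻¹ * (ENNReal.ofReal (-Real.log Z.toReal + 1) * Z))) := by
        gcongr
        exact (hle y).trans (by gcongr)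
    _ = Z⁻¹ * Z * (C₁ * ENNReal.ofReal L⁻¹ * ENNReal.ofReal (-Real.log Z.toReal + 1)) := by ring
    _ = C₁ * ENNReal.ofReal L⁻¹ * ENNReal.ofReal (-Real.log Z.toReal + 1) := by
        rw [ENNReal.inv_mul_cancel hZ0 hZt, one_mul]
    _ ≤ ENNReal.ofReal (C₁.toReal + 1) * ENNReal.ofReal L⁻¹ *
        ENNReal.ofReal ((K * (d + 1) + 1) * latticeNorm y) := by
        gcongr
        rw [← ENNReal.ofReal_toReal hC₁]
        refine ENNReal.ofReal_le_ofReal ?_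
        rw [ENNReal.toReal_ofReal ENNReal.toReal_nonneg]
        linarith
    _ = _ := by
        rw [← ENNReal.ofReal_mul (by positivity), ← ENNReal.ofReal_mul (by positivity)]
        congr 1
        ring

lemma exists_limsupCrossingTime_le (hV : IsIIDField μ V) (h0 : meanExp μ V ≠ 0)
    (hnz : μ {ω | V 0 ω = 0} < 1) (hdim1 : d = 1 → 0 < μ {ω | 0 < V 0 ω ∧ V 0 ω < ⊤}) :
    ∃ C : ℝ, 0 < C ∧ limsupCrossingTime μ V ≤ ENNReal.ofReal C := by
  obtain ⟨C, hC, hle⟩ := exists_meanCrossingTime_le hV h0 hnz hdim1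
  refine ⟨C, hC, limsup_le_of_le ?_ ?_⟩
  · isBoundedDefault
  · filter_upwards [tendsto_comap.eventually_ge_atTop 1] with y hy
    rw [ENNReal.div_le_iff (ENNReal.ofReal_pos.2 (by linarith)).ne' ENNReal.ofReal_ne_top,
      ← ENNReal.ofReal_mul hC.le]
    exact hle y hy

end CrossingTime

end AnnealedWalk

end

theorem corollary1p2 {d : ℕ} [NeZero d] {Ω : Type*} [MeasurableSpace Ω]
    (μ : Measure Ω) [IsProbabilityMeasure μ]
    (V : (Fin d → ℤ) → Ω → ℝ≥0∞)
    (hmeas : ∀ z, Measurable (V z))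
    (hindep : iIndepFun V μ)
    (hident : ∀ z, IdentDistrib (V z) (V 0) μ μ)
    (hnonzero : μ {ω | V 0 ω = 0} < 1)
    (hessInf : essInf (V 0) μ = 0)
    (hdim1 : d = 1 → 0 < μ {ω | 0 < V 0 ω ∧ V 0 ω < ⊤}) :
    -- the Lyapunov exponents of all the potentials `t + V`, `t ≥ 0`, are genuine limits
    (∀ t : ℝ, 0 ≤ t → ∀ h : EuclideanSpace ℝ (Fin d),
      Tendsto (AnnealedWalk.decayRate μ (AnnealedWalk.shiftPotential t V) h) atTop
        (𝓝 (AnnealedWalk.lyapunov μ (AnnealedWalk.shiftPotential t V) h))) ∧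
    -- there is a constant bounding the normalized expected crossing time
    (∃ C : ℝ, 0 < C ∧ AnnealedWalk.limsupCrossingTime μ V ≤ ENNReal.ofReal C) ∧
    -- every such constant bounds the right derivative at `0`, which exists, in every direction
    ∀ C : ℝ, 0 < C → AnnealedWalk.limsupCrossingTime μ V ≤ ENNReal.ofReal C →
      ∀ s : EuclideanSpace ℝ (Fin d), ‖s‖ = 1 →
        ∃ D : ℝ,
          HasDerivWithinAt
            (fun t : ℝ => AnnealedWalk.lyapunov μ (AnnealedWalk.shiftPotential t V) s)
            D (Set.Ici 0) 0 ∧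
          D ≤ C := by
  have hV : AnnealedWalk.IsIIDField μ V := ⟨hmeas, hindep, hident⟩
  have h0 : AnnealedWalk.meanExp μ V ≠ 0 := AnnealedWalk.meanExp_ne_zero (hmeas 0) hessInf
  refine ⟨fun t ht h => AnnealedWalk.tendsto_decayRate (hV.shiftPotential t)
    (AnnealedWalk.meanExp_shiftPotential_ne_zero (hmeas 0) h0 ht) h,
    AnnealedWalk.exists_limsupCrossingTime_le hV h0 hnonzero hdim1, fun C hC hlim s hs => ?_⟩
  refine AnnealedWalk.exists_hasDerivWithinAt_of_slope_antitone (fun t ht θ hθ0 hθ1 => ?_)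
    (fun t ht => ?_)
  · rw [AnnealedWalk.shiftPotential_zero]
    exact AnnealedWalk.lyapunov_shiftPotential_concave hV h0 ht hθ0 hθ1 s
  · rw [AnnealedWalk.shiftPotential_zero]
    exact AnnealedWalk.lyapunov_shiftPotential_sub_le hV h0 hC hlim ht.le hs
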